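/- For $r\ge 1$ let $\mathrm{Spin}^r(N)=(\mathrm{Spin}(N)\times\mathrm{Spin}(r))/\{\pm(1,1)\}$, with the homomorphisms $\lambda\colon\mathrm{Spin}^r(N)\to SO(N)$ and $\xi\colon\mathrm{Spin}^r(N)\to SO(r)$ induced by the standard coverings $\mathrm{Spin}(N)\to SO(N)$ and $\mathrm{Spin}(r)\to SO(r)$. Let $M$ be an oriented Riemannian $N$-manifold on which a Lie group $G$ acts smoothly by orientation-preserving isometries, and let $FM$ be its bundle of positively oriented orthonormal frames. A $G$-invariant spin$^r$ structure on $M$ is a principal $\mathrm{Spin}^r(N)$-bundle $P\to M$ with a bundle map $\Phi\colon P\to FM$ that is equivariant along $\lambda$, together with a smooth action of $G$ on $P$ by bundle homomorphisms over the action on $M$ for which $\Phi$ is $G$-equivariant. Two of them, $(P_1,\Phi_1)$ and $(P_2,\Phi_2)$, are equivalent if there is a $G$-equivariant isomorphism $f\colon P_1\to P_2$ of principal bundles over $M$ with $\Phi_2\circ f=\Phi_1$. The $G$-invariant spin type $\Sigma(M,G)$ is the least $r\ge 1$ for which $M$ has a $G$-invariant spin$^r$ structure. A spin$^{\mathbb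 C}$ structure is a spin$^2$ structure. Let $n\ge 0$, and let $Sp(n+1)\cdot U(1)=(Sp(n+1)\times U(1))/\{\pm(1,1)\}$ act on the round unit sphere $S^{4n+3}\subset\mathbb H^{n+1}$ by $[A,z]\cdot x=Axz^{-1}$. The isotropy group of $(0,\dots,0,1)$ is $H_n=\{[\mathrm{diag}(B,z),z] : B\in Sp(n),\ z\in U(1)\}\cong Sp(n)\cdot U(1)$. A point $p$ of an invariant spin$^{\mathbb C}$ structure $P$ over $(0,\dots,0,1)$ determines a homomorphism $\tau\colon H_n\to\mathrm{Spin}^2(4n+3)$ by $h\cdot p=p\cdot\tau(h)$, and $P$ is said to correspond to $\varphi=\xi\circ\tau\colon H_n\to SO(2)\cong U(1)$; this does not depend on $p$. **Theorem.** For every $n\ge 0$, the $Sp(2n+1)\cdot U(1)$-invariant spin type of $S^{8n+3}$ is $2$. Hence $$\Sigma\bigl(S^{4n+3},Sp(n+1)\cdot U(1)\bigr)=\begin{cases}1,& n\text{ odd},\\ 2,& n\text{ even}.\end{cases}$$ Moreover, the $Sp(2n+1)\cdot U(1)$-invariant spin$^{\mathbb C}$ structures on $S^{8n+3}$ are, up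 to equivalence, the ones corresponding to the homomorphisms $$\varphi_s\colon H_{2n}\to U(1),\qquad [A,z]\mapsto z^s,\qquad s\equiv 2 \pmod 4 .$$ That is, every invariant spin$^{\mathbb C}$ structure corresponds to exactly one homomorphism $\varphi\colon H_{2n}\to U(1)$, the homomorphisms that occur are exactly the $\varphi_s$ with $s\equiv 2\pmod 4$, two structures are equivalent if and only if they correspond to the same homomorphism, and different $s$ give different $\varphi_s$. -/

import Mathlib

open scoped Quaternion ContDiff TensorProduct RealInnerProductSpace

noncomputable section

namespace SpinSphere

/-! ### The groups `Spin(n)` and `Spin^r(n)` -/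

/-- The quadratic form `-(x₁² + ⋯ + xₙ²)` on `ℝⁿ`. -/
def stdForm (n : ℕ) : QuadraticForm ℝ (Fin n → ℝ) :=
  QuadraticMap.weightedSumSquares ℝ (fun _ : Fin n => (-1 : ℝ))

/-- The real Clifford algebra `Cl(n)`, with `v * v = -|v|²` for `v ∈ ℝⁿ`. -/
abbrev Cl (n : ℕ) : Type := CliffordAlgebra (stdForm n)

/-- The group `Spin(n)`, inside the even part of `Cl(n)`. -/
abbrev Spin (n : ℕ) : Type := spinGroup (stdForm n)

theorem ι_stdForm_injective (n : ℕ) :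
    Function.Injective (CliffordAlgebra.ι (stdForm n)) := by
  intro v w h
  have h' := congrArg (CliffordAlgebra.equivExterior (stdForm n)) h
  simp only [CliffordAlgebra.equivExterior, CliffordAlgebra.changeFormEquiv_apply,
    CliffordAlgebra.changeForm_ι] at h'
  exact ExteriorAlgebra.ι_leftInverse.injective h'

theorem spin_conj_mem (n : ℕ) (x : Spin n) (v : Fin n → ℝ) :
    (x : Cl n) * CliffordAlgebra.ι (stdForm n) v * ((x⁻¹ : Spin n) : Cl n) ∈
      LinearMap.range (CliffordAlgebra.ι (stdForm n)) := by
  have h := spinGroup.conjAct_smul_ι_mem_range_ι (Q := stdForm n)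
    (x := spinGroup.toUnits x) x.2 v
  rwa [ConjAct.units_smul_def] at h

/-- The endomorphism `v ↦ x v x⁻¹` of `ℝⁿ ⊆ Cl(n)` defined by `x ∈ Spin(n)`. -/
def spinRotFun (n : ℕ) (x : Spin n) : Module.End ℝ (Fin n → ℝ) :=
  (LinearEquiv.ofInjective _ (ι_stdForm_injective n)).symm.toLinearMap ∘ₗ
    LinearMap.codRestrict _
      (LinearMap.mulRight ℝ ((x⁻¹ : Spin n) : Cl n) ∘ₗ LinearMap.mulLeft ℝ (x : Cl n) ∘ₗ
        CliffordAlgebra.ι (stdForm n))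
      (spin_conj_mem n x)

theorem ι_spinRotFun (n : ℕ) (x : Spin n) (v : Fin n → ℝ) :
    CliffordAlgebra.ι (stdForm n) (spinRotFun n x v) =
      (x : Cl n) * CliffordAlgebra.ι (stdForm n) v * ((x⁻¹ : Spin n) : Cl n) := by
  have h := LinearEquiv.ofInjective_apply (f := CliffordAlgebra.ι (stdForm n))
    (h := ι_stdForm_injective n) (spinRotFun n x v)
  rw [← h, spinRotFun, LinearMap.comp_apply, LinearEquiv.coe_coe, LinearEquiv.apply_symm_apply]
  rfl

/-- The covering homomorphism `λₙ : Spin(n) → SO(n)`, `λₙ(x) v = x v x⁻¹`, with `SO(n)` regarded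
as a group of endomorphisms of `ℝⁿ`. -/
def spinRot (n : ℕ) : Spin n →* Module.End ℝ (Fin n → ℝ) where
  toFun := spinRotFun n
  map_one' := by
    refine LinearMap.ext fun v => ι_stdForm_injective n ?_
    rw [ι_spinRotFun]
    simp
  map_mul' x y := by
    refine LinearMap.ext fun v => ι_stdForm_injective n ?_
    rw [ι_spinRotFun, Module.End.mul_apply, ι_spinRotFun, ι_spinRotFun, mul_inv_rev]
    simp only [Submonoid.coe_mul, mul_assoc]

/-- The subgroup `{(1, 1), (-1, -1)}` of `Spin(n) × Spin(r)`. -/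
def spinCenter (n r : ℕ) : Subgroup (Spin n × Spin r) where
  carrier := {p | ((p.1 : Cl n) = 1 ∧ (p.2 : Cl r) = 1) ∨
    ((p.1 : Cl n) = -1 ∧ (p.2 : Cl r) = -1)}
  one_mem' := by simp
  mul_mem' := by
    rintro a b (⟨ha, ha'⟩ | ⟨ha, ha'⟩) (⟨hb, hb'⟩ | ⟨hb, hb'⟩)
    · left; simp only [Prod.fst_mul, Prod.snd_mul, Submonoid.coe_mul, ha, ha', hb, hb', mul_one, and_self]
    · right; simp only [Prod.fst_mul, Prod.snd_mul, Submonoid.coe_mul, ha, ha', hb, hb', one_mul, and_self]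
    · right; simp only [Prod.fst_mul, Prod.snd_mul, Submonoid.coe_mul, ha, ha', hb, hb', mul_one, and_self]
    · left
      simp only [Prod.fst_mul, Prod.snd_mul, Submonoid.coe_mul, ha, ha', hb, hb', neg_mul_neg, mul_one, and_self]
  inv_mem' := by
    have key : ∀ (m : ℕ) (x : Spin m), ((x⁻¹ : Spin m) : Cl m) = star (x : Cl m) :=
      fun _ _ => rfl
    rintro a (⟨ha, ha'⟩ | ⟨ha, ha'⟩)
    · left; simp only [Prod.fst_inv, Prod.snd_inv, key, ha, ha', star_one, and_self]
    · right; simp only [Prod.fst_inv, Prod.snd_inv, key, ha, ha', star_neg, star_one, and_self]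

instance (n r : ℕ) : (spinCenter n r).Normal where
  conj_mem := by
    have key : ∀ (m : ℕ) (x : Spin m), (x : Cl m) * ((x⁻¹ : Spin m) : Cl m) = 1 :=
      fun _ x => spinGroup.coe_mul_star_self x
    rintro a (⟨ha, ha'⟩ | ⟨ha, ha'⟩) g
    · left; simp [ha, ha', key]
    · right; simp [ha, ha', key]

/-- `Spin^r(n) = (Spin(n) × Spin(r)) / {±(1, 1)}`. -/
def SpinR (n r : ℕ) : Type := (Spin n × Spin r) ⧸ spinCenter n r

instance (n r : ℕ) : Group (SpinR n r) := QuotientGroup.Quotient.group (spinCenter n r)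

/-- `λₙʳ : Spin^r(n) → SO(n)`, `[μ, ν] ↦ λₙ(μ)`. -/
def lamR (n r : ℕ) : SpinR n r →* Module.End ℝ (Fin n → ℝ) :=
  QuotientGroup.lift (spinCenter n r) ((spinRot n).comp (MonoidHom.fst _ _)) (by
    have key : ∀ (m : ℕ) (x : Spin m), ((x⁻¹ : Spin m) : Cl m) = star (x : Cl m) :=
      fun _ _ => rfl
    rintro a (⟨ha, -⟩ | ⟨ha, -⟩) <;>
    · refine LinearMap.ext fun v => ι_stdForm_injective n ?_
      change CliffordAlgebra.ι (stdForm n) (spinRotFun n a.1 v) = _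
      rw [ι_spinRotFun, key, ha]
      simp)

/-- `ξₙʳ : Spin^r(n) → SO(r)`, `[μ, ν] ↦ λᵣ(ν)`. -/
def xiR (n r : ℕ) : SpinR n r →* Module.End ℝ (Fin r → ℝ) :=
  QuotientGroup.lift (spinCenter n r) ((spinRot r).comp (MonoidHom.snd _ _)) (by
    have key : ∀ (m : ℕ) (x : Spin m), ((x⁻¹ : Spin m) : Cl m) = star (x : Cl m) :=
      fun _ _ => rfl
    rintro a (⟨-, ha⟩ | ⟨-, ha⟩) <;>
    · refine LinearMap.ext fun v => ι_stdForm_injective r ?_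
      change CliffordAlgebra.ι (stdForm r) (spinRotFun r a.2 v) = _
      rw [ι_spinRotFun, key, ha]
      simp)

/-- The embedding `[μ, ν] ↦ μ ⊗ ν` of the compact Lie group `Spin^r(n)` into the
finite-dimensional algebra `Cl(n) ⊗ Cl(r)`; it is injective, since `μ ⊗ ν = μ' ⊗ ν'` forces
`(μ', ν') = ±(μ, ν)`. The Lie group structure of `Spin^r(n)` is the one of an embedded submanifold
of `Cl(n) ⊗ Cl(r)`. -/
def spinREmb (n r : ℕ) : SpinR n r →* Cl n ⊗[ℝ] Cl r :=
  QuotientGroup.lift (spinCenter n r)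
    { toFun := fun p => (p.1 : Cl n) ⊗ₜ[ℝ] (p.2 : Cl r)
      map_one' := rfl
      map_mul' := fun p q => by simp [Algebra.TensorProduct.tmul_mul_tmul] }
    (by
      rintro a (⟨ha, ha'⟩ | ⟨ha, ha'⟩)
      · change (a.1 : Cl n) ⊗ₜ[ℝ] (a.2 : Cl r) = 1
        rw [ha, ha']; rfl
      · change (a.1 : Cl n) ⊗ₜ[ℝ] (a.2 : Cl r) = 1
        rw [ha, ha', TensorProduct.neg_tmul, TensorProduct.tmul_neg, neg_neg]; rfl)

/-! ### Smooth maps between embedded submanifolds -/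

/-- Let `T` be a manifold embedded by `e` in a normed space `V`, let `U ⊆ T` be open, and let `W`
be a finite-dimensional vector space. The map `f : T → W` is smooth on `U` if each of its
coordinates is, locally around every point of `U`, the restriction of a smooth function on an open
subset of `V`. A map into a submanifold of `W` is smooth if it is smooth as a map into `W`. -/
def SmoothOnVia {T V W : Type} [NormedAddCommGroup V] [NormedSpace ℝ V] [AddCommGroup W]
    [Module ℝ W] (e : T → V) (f : T → W) (U : Set T) : Prop :=
  ∀ ℓ : W →ₗ[ℝ] ℝ, ∀ t ∈ U, ∃ (O : Set V) (F : V → ℝ), IsOpen O ∧ e t ∈ O ∧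
    ContDiffOn ℝ ∞ F O ∧ ∀ t' ∈ U, e t' ∈ O → F (e t') = ℓ (f t')

/-! ### The group `Sp(m)·U(1)` and its action on `ℍᵐ` -/

/-- The compact symplectic group `Sp(m)` of unitary quaternionic `m × m` matrices. -/
abbrev Sp (m : ℕ) : Type := unitary (Matrix (Fin m) (Fin m) ℍ[ℝ])

/-- The subgroup `{(1, 1), (-1, -1)}` of `Sp(m) × U(1)`. -/
def spuCenter (m : ℕ) : Subgroup (Sp m × Circle) where
  carrier := {p | ((p.1 : Matrix (Fin m) (Fin m) ℍ[ℝ]) = 1 ∧ (p.2 : ℂ) = 1) ∨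
    ((p.1 : Matrix (Fin m) (Fin m) ℍ[ℝ]) = -1 ∧ (p.2 : ℂ) = -1)}
  one_mem' := by simp
  mul_mem' := by
    rintro a b (⟨ha, ha'⟩ | ⟨ha, ha'⟩) (⟨hb, hb'⟩ | ⟨hb, hb'⟩)
    · left; simp only [Prod.fst_mul, Prod.snd_mul, Submonoid.coe_mul, Circle.coe_mul, ha, ha', hb, hb', mul_one, and_self]
    · right; simp only [Prod.fst_mul, Prod.snd_mul, Submonoid.coe_mul, Circle.coe_mul, ha, ha', hb, hb', one_mul, and_self]
    · right; simp only [Prod.fst_mul, Prod.snd_mul, Submonoid.coe_mul, Circle.coe_mul, ha, ha', hb, hb', mul_one, and_self]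
    · left
      simp only [Prod.fst_mul, Prod.snd_mul, Submonoid.coe_mul, Circle.coe_mul, ha, ha', hb, hb', neg_mul_neg, mul_one, and_self]
  inv_mem' := by
    have key : ∀ x : Sp m, ((x⁻¹ : Sp m) : Matrix (Fin m) (Fin m) ℍ[ℝ]) = star x.1 :=
      fun _ => rfl
    rintro a (⟨ha, ha'⟩ | ⟨ha, ha'⟩)
    · left; simp [key, ha, Circle.coe_inv, ha']
    · right; simp [key, ha, Circle.coe_inv, ha', inv_neg]

instance (m : ℕ) : (spuCenter m).Normal where
  conj_mem := by
    have key : ∀ x : Sp m, (x.1 : Matrix (Fin m) (Fin m) ℍ[ℝ]) * (x⁻¹ : Sp m).1 = 1 :=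
      fun x => Unitary.coe_mul_star_self x
    rintro a (⟨ha, ha'⟩ | ⟨ha, ha'⟩) g
    · left; simp [ha, ha', key]
    · right; simp [ha, ha', key]

/-- `Sp(m)·U(1) = (Sp(m) × U(1)) / {±(1, 1)}`. -/
def SpU (m : ℕ) : Type := (Sp m × Circle) ⧸ spuCenter m

instance (m : ℕ) : Group (SpU m) := QuotientGroup.Quotient.group (spuCenter m)

/-- The class `[A, z] ∈ Sp(m)·U(1)`. -/
def SpU.mk {m : ℕ} (A : Sp m) (z : Circle) : SpU m :=
  (QuotientGroup.mk (A, z) : (Sp m × Circle) ⧸ spuCenter m)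

/-- The Euclidean space `ℍᵐ ≅ ℝ⁴ᵐ`. -/
abbrev QuatSpace (m : ℕ) : Type := PiLp 2 fun _ : Fin m => ℍ[ℝ]

/-- The linear map `v ↦ A v z⁻¹` of `ℍᵐ`. -/
def spuLin (m : ℕ) (A : Matrix (Fin m) (Fin m) ℍ[ℝ]) (z : Circle) : Module.End ℝ (QuatSpace m) where
  toFun v := WithLp.toLp 2 fun i => A.mulVec (fun j => v j) i * (((z⁻¹ : Circle) : ℂ) : ℍ[ℝ])
  map_add' v w := by
    ext1 i
    simp only [PiLp.add_apply, Matrix.mulVec, dotProduct, mul_add, Finset.sum_add_distrib, add_mul]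
  map_smul' c v := by
    ext1 i
    simp only [PiLp.smul_apply, Matrix.mulVec, dotProduct, RingHom.id_apply, mul_smul_comm,
      ← Finset.smul_sum, smul_mul_assoc]

/-- The action of `Sp(m) × U(1)` on `ℍᵐ` by `(A, z) v = A v z⁻¹`. -/
def spuHom (m : ℕ) : Sp m × Circle →* Module.End ℝ (QuatSpace m) where
  toFun p := spuLin m p.1 p.2
  map_one' := by
    refine LinearMap.ext fun v => ?_
    ext1 i
    simp [spuLin]
  map_mul' p q := by
    refine LinearMap.ext fun v => ?_
    ext1 i
    have h : ((((p.2 * q.2)⁻¹ : Circle) : ℂ) : ℍ[ℝ]) =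
        (((q.2⁻¹ : Circle) : ℂ) : ℍ[ℝ]) * (((p.2⁻¹ : Circle) : ℂ) : ℍ[ℝ]) := by
      rw [← Quaternion.coeComplex_mul, ← Circle.coe_mul, mul_inv_rev]
    have h' : ∀ (B : Matrix (Fin m) (Fin m) ℍ[ℝ]) (w : Fin m → ℍ[ℝ]) (c : ℍ[ℝ]) (k : Fin m),
        B.mulVec (fun j => w j * c) k = B.mulVec w k * c := by
      intro B w c k
      simp only [Matrix.mulVec, dotProduct, Finset.sum_mul, mul_assoc]
    change ((p.1 * q.1 : Sp m) : Matrix (Fin m) (Fin m) ℍ[ℝ]).mulVec (fun j => v j) i * _ =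
      (p.1 : Matrix (Fin m) (Fin m) ℍ[ℝ]).mulVec
        (fun j => (q.1 : Matrix (Fin m) (Fin m) ℍ[ℝ]).mulVec (fun j => v j) j * _) i * _
    rw [h', Submonoid.coe_mul, ← Matrix.mulVec_mulVec, mul_assoc]
    exact congrArg _ h

theorem norm_spuHom (m : ℕ) (p : Sp m × Circle) (v : QuatSpace m) : ‖spuHom m p v‖ = ‖v‖ := by
  have hz : ‖(((p.2⁻¹ : Circle) : ℂ) : ℍ[ℝ])‖ = 1 := by
    rw [← sq_eq_sq₀ (norm_nonneg _) zero_le_one, sq, ← Quaternion.normSq_eq_norm_mul_self,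
      Quaternion.normSq_def']
    have h := Circle.normSq_coe (p.2⁻¹)
    rw [Complex.normSq_apply] at h
    simp only [Quaternion.re_coeComplex, Quaternion.imI_coeComplex, Quaternion.imJ_coeComplex,
      Quaternion.imK_coeComplex]
    linarith
  have hsq : ∀ w : Fin m → ℍ[ℝ],
      ((∑ i, ‖w i‖ ^ 2 : ℝ) : ℍ[ℝ]) = dotProduct (star w) w := by
    intro w
    rw [dotProduct, ← Quaternion.algebraMap_def, map_sum]
    refine Finset.sum_congr rfl fun i _ => ?_
    rw [Pi.star_apply, Quaternion.star_mul_self, Quaternion.normSq_eq_norm_mul_self, sq]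
    rfl
  have hA : star (p.1 : Matrix (Fin m) (Fin m) ℍ[ℝ]) * p.1 = 1 := Unitary.coe_star_mul_self p.1
  have key : (∑ i, ‖(p.1 : Matrix (Fin m) (Fin m) ℍ[ℝ]).mulVec (fun j => v j) i‖ ^ 2 : ℝ) =
      ∑ i, ‖v i‖ ^ 2 := by
    apply Quaternion.coe_injective (R := ℝ)
    rw [hsq, hsq, Matrix.star_mulVec, Matrix.dotProduct_mulVec, Matrix.vecMul_vecMul,
      ← Matrix.star_eq_conjTranspose, hA, Matrix.vecMul_one]
  rw [PiLp.norm_eq_of_L2, PiLp.norm_eq_of_L2, ← key]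
  congr 1
  refine Finset.sum_congr rfl fun i _ => ?_
  change ‖(p.1 : Matrix (Fin m) (Fin m) ℍ[ℝ]).mulVec (fun j => v j) i * _‖ ^ 2 = _
  rw [norm_mul, hz, mul_one]

/-- The action of `Sp(m)·U(1)` on `ℍᵐ` by `[A, z] v = A v z⁻¹`. -/
def spuRep (m : ℕ) : SpU m →* Module.End ℝ (QuatSpace m) :=
  QuotientGroup.lift (spuCenter m) (spuHom m) (by
    have key : ∀ z : Circle, (z : ℂ) = -1 → ((z⁻¹ : Circle) : ℂ) = -1 := by
      intro z hz
      rw [Circle.coe_inv, hz, inv_neg, inv_one]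
    rintro a (⟨ha, ha'⟩ | ⟨ha, ha'⟩)
    · have h2 : a.2 = 1 := Circle.ext ha'
      have h1 : a.1 = 1 := Subtype.ext ha
      have h : a = 1 := Prod.ext h1 h2
      exact h ▸ one_mem _
    · refine LinearMap.ext fun v => ?_
      ext1 i
      change (a.1 : Matrix (Fin m) (Fin m) ℍ[ℝ]).mulVec (fun j => v j) i * _ = v i
      rw [ha, key a.2 ha', Matrix.neg_mulVec, Matrix.one_mulVec]
      change -(v i) * (((-1 : ℂ)) : ℍ[ℝ]) = v i
      have h1 : ((-1 : ℂ) : ℍ[ℝ]) = -1 := by ext <;> simp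
      rw [h1, neg_mul_neg, mul_one])

theorem norm_spuRep (m : ℕ) (g : SpU m) (v : QuatSpace m) : ‖spuRep m g v‖ = ‖v‖ := by
  induction g using QuotientGroup.induction_on with
  | H p => exact norm_spuHom m p v

/-- The sphere `S^{4n+3}`, as the unit sphere of `ℍⁿ⁺¹`. -/
abbrev Sph (n : ℕ) : Type := Metric.sphere (0 : QuatSpace (n + 1)) 1

/-- The action of `Sp(n+1)·U(1)` on `S^{4n+3}` by `[A, z] x = A x z⁻¹`. -/
instance (n : ℕ) : MulAction (SpU (n + 1)) (Sph n) where
  smul g x := ⟨spuRep (n + 1) g x, by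
    rw [mem_sphere_zero_iff_norm, norm_spuRep, norm_eq_of_mem_sphere x]⟩
  one_smul x := Subtype.ext (by
    change spuRep (n + 1) 1 (x : QuatSpace (n + 1)) = x
    rw [map_one]; rfl)
  mul_smul g h x := Subtype.ext (by
    change spuRep (n + 1) (g * h) (x : QuatSpace (n + 1)) =
      spuRep (n + 1) g (spuRep (n + 1) h (x : QuatSpace (n + 1)))
    rw [map_mul]; rfl)

/-- The embedding of `(Sp(m) × U(1)) × S` into the normed space `(m × m matrices) × ℂ × ℍᵐ`. -/
def spuSphEmb (n : ℕ) (t : (Sp (n + 1) × Circle) × Sph n) :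
    (Fin (n + 1) → Fin (n + 1) → ℍ[ℝ]) × ℂ × QuatSpace (n + 1) :=
  (fun i j => (t.1.1 : Matrix (Fin (n + 1)) (Fin (n + 1)) ℍ[ℝ]) i j, (t.1.2 : ℂ),
    (t.2 : QuatSpace (n + 1)))

/-! ### Oriented orthonormal frames of `S^{4n+3}` -/

/-- The standard real basis of `ℍᵐ`: `1, i, j, k` in the first coordinate, then in the second
coordinate, and so on. -/
def quatBasis (n : ℕ) : Module.Basis (Fin (4 * n + 3 + 1)) ℝ (QuatSpace (n + 1)) :=
  ((Pi.basis fun _ : Fin (n + 1) => QuaternionAlgebra.basisOneIJK (-1 : ℝ) 0 (-1)).map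
    (WithLp.linearEquiv 2 ℝ (Fin (n + 1) → ℍ[ℝ])).symm).reindex
    (((Equiv.sigmaEquivProd (Fin (n + 1)) (Fin 4)).trans finProdFinEquiv).trans
      (finCongr (by ring)))

/-- `u : ℝ^{4n+3} → T_x S^{4n+3} = x^⊥ ⊆ ℍⁿ⁺¹` is a positively oriented orthonormal frame of the
sphere at `x`, the sphere being oriented as the boundary of the unit ball (outward normal first). -/
def IsPosFrame (n : ℕ) (x : Sph n) (u : (Fin (4 * n + 3) → ℝ) →ₗ[ℝ] QuatSpace (n + 1)) : Prop :=
  (∀ v, ⟪(x : QuatSpace (n + 1)), u v⟫ = 0) ∧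
  Orthonormal ℝ (fun i => u (Pi.single i 1)) ∧
  0 < (quatBasis n).det (Fin.cons (x : QuatSpace (n + 1)) fun i => u (Pi.single i 1))

/-! ### Spin^r structures -/

/-- A spin^r structure on the oriented Riemannian manifold `S^{4n+3}`: a smooth principal
`Spin^r(4n+3)`-bundle `P` with a smooth bundle map `frame` from `P` to the bundle of positively
oriented orthonormal frames, equivariant along `λʳ`. The smooth structure of `P` is given by an
atlas of local sections `sec i` over open sets `dom i`, that is, of local trivialisations
`(x, k) ↦ sec i x · k`, with smooth transition functions. -/
structure SpinStructure (n r : ℕ) where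
  /-- The total space. -/
  P : Type
  /-- The right action of the structure group. -/
  act : P → SpinR (4 * n + 3) r → P
  act_one : ∀ p, act p 1 = p
  act_mul : ∀ p k l, act p (k * l) = act (act p k) l
  /-- The bundle projection. -/
  proj : P → Sph n
  proj_act : ∀ p k, proj (act p k) = proj p
  /-- The structure group acts simply transitively on the fibres. -/
  act_simply_transitive : ∀ p q, proj p = proj q → ∃! k, act p k = q
  /-- The index set of the bundle atlas. -/
  I : Type
  dom : I → Set (Sph n)
  isOpen_dom : ∀ i, IsOpen (dom i)
  exists_mem_dom : ∀ x, ∃ i, x ∈ dom i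
  /-- The local sections of the bundle atlas, on their domains. -/
  sec : I → Sph n → P
  proj_sec : ∀ i, ∀ x ∈ dom i, proj (sec i x) = x
  smooth_transition : ∀ i j, ∃ c : Sph n → SpinR (4 * n + 3) r,
    (∀ x ∈ dom i ∩ dom j, sec j x = act (sec i x) (c x)) ∧
    SmoothOnVia (fun x : Sph n => (x : QuatSpace (n + 1)))
      (fun x => spinREmb (4 * n + 3) r (c x)) (dom i ∩ dom j)
  /-- The bundle map to the frame bundle. -/
  frame : P → ((Fin (4 * n + 3) → ℝ) →ₗ[ℝ] QuatSpace (n + 1))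
  isPosFrame_frame : ∀ p, IsPosFrame n (proj p) (frame p)
  frame_act : ∀ p k, frame (act p k) = frame p ∘ₗ lamR (4 * n + 3) r k
  smooth_frame : ∀ i, SmoothOnVia (fun x : Sph n => (x : QuatSpace (n + 1)))
    (fun x => frame (sec i x)) (dom i)

/-- An `Sp(n+1)·U(1)`-invariant spin^r structure on `S^{4n+3}`: a spin^r structure with a smooth
left action of `Sp(n+1)·U(1)` on `P` by bundle homomorphisms over the action on the sphere, such
that the map to the frame bundle is equivariant. Smoothness of the action is expressed in the
bundle atlas, and on the double cover `Sp(n+1) × U(1)` of `Sp(n+1)·U(1)`. -/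
structure InvariantSpinStructure (n r : ℕ) extends SpinStructure n r where
  /-- The left action of the group. -/
  gact : SpU (n + 1) → P → P
  gact_one : ∀ p, gact 1 p = p
  gact_mul : ∀ g h p, gact (g * h) p = gact g (gact h p)
  gact_act : ∀ g p k, gact g (act p k) = act (gact g p) k
  proj_gact : ∀ g p, proj (gact g p) = g • proj p
  frame_gact : ∀ g p, frame (gact g p) = spuRep (n + 1) g ∘ₗ frame p
  smooth_gact : ∀ i j, ∃ c : (Sp (n + 1) × Circle) × Sph n → SpinR (4 * n + 3) r,
    (∀ A z, ∀ x ∈ dom i, SpU.mk A z • x ∈ dom j →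
      gact (SpU.mk A z) (sec i x) = act (sec j (SpU.mk A z • x)) (c ((A, z), x))) ∧
    SmoothOnVia (spuSphEmb n) (fun t => spinREmb (4 * n + 3) r (c t))
      {t | t.2 ∈ dom i ∧ SpU.mk t.1.1 t.1.2 • t.2 ∈ dom j}

/-- Equivariant equivalence of invariant spin^r structures: there is a smooth map `f` of the total
spaces over the identity of the sphere that is equivariant for the structure group and for
`Sp(n+1)·U(1)` and compatible with the maps to the frame bundle. Such an `f` is automatically a
diffeomorphism. -/
def InvariantSpinStructure.Equivalent {n r : ℕ} (S T : InvariantSpinStructure n r) : Prop :=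
  ∃ f : S.P → T.P,
    (∀ p, T.proj (f p) = S.proj p) ∧
    (∀ p k, f (S.act p k) = T.act (f p) k) ∧
    (∀ g p, f (S.gact g p) = T.gact g (f p)) ∧
    (∀ p, T.frame (f p) = S.frame p) ∧
    ∀ i j, ∃ c : Sph n → SpinR (4 * n + 3) r,
      (∀ x ∈ S.dom i ∩ T.dom j, f (S.sec i x) = T.act (T.sec j x) (c x)) ∧
      SmoothOnVia (fun x : Sph n => (x : QuatSpace (n + 1)))
        (fun x => spinREmb (4 * n + 3) r (c x)) (S.dom i ∩ T.dom j)

/-- The invariant spin type `Σ(S^{4n+3}, Sp(n+1)·U(1))`: the least `r ≥ 1` such that `S^{4n+3}`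
admits an `Sp(n+1)·U(1)`-invariant spin^r structure. -/
def invariantSpinType (n : ℕ) : ℕ :=
  sInf {r : ℕ | 1 ≤ r ∧ Nonempty (InvariantSpinStructure n r)}

/-! ### The homomorphism of the isotropy group attached to an invariant spin^ℂ structure -/

/-- The base point `(0, …, 0, 1)` of `S^{4n+3}`. -/
def basePoint (n : ℕ) : Sph n :=
  ⟨WithLp.toLp 2 (Pi.single (Fin.last n) 1), by simp⟩

/-- The isotropy group of the base point: the subgroup `Sp(n)·U(1)` of `Sp(n+1)·U(1)` consisting
of the elements `[diag(B, z), z]` with `B ∈ Sp(n)` and `z ∈ U(1)`. -/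
abbrev isotropy (n : ℕ) : Subgroup (SpU (n + 1)) :=
  MulAction.stabilizer (SpU (n + 1)) (basePoint n)

/-- The identification of `U(1)` with `SO(2)`: multiplication by `w` on `ℝ² = ℂ`. -/
def rotation (w : Circle) : Module.End ℝ (Fin 2 → ℝ) :=
  Matrix.toLin' !![(w : ℂ).re, -(w : ℂ).im; (w : ℂ).im, (w : ℂ).re]

/-- The homomorphism `Sp(m)·U(1) → U(1)`, `[A, z] ↦ zˢ`, for `s` even. -/
def powHom (m : ℕ) (s : ℤ) (hs : Even s) : SpU m →* Circle :=
  QuotientGroup.lift (spuCenter m) ((zpowGroupHom s).comp (MonoidHom.snd _ _)) (by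
    rintro a (⟨-, ha⟩ | ⟨-, ha⟩)
    · apply Circle.ext
      simp [ha]
    · apply Circle.ext
      simp [ha, hs.neg_one_zpow])

/-- The invariant spin^ℂ structure `S` on `S^{4n+3}` corresponds to the homomorphism `φ` from the
isotropy group `H` to `U(1) ≅ SO(2)`: for some point `p` of `P` over the base point, the
homomorphism `τ : H → Spin^2(4n+3)` with `h p = p τ(h)`, which is a lift of the isotropy
representation, satisfies `ξ ∘ τ = φ`. -/
def InvariantSpinStructure.CorrespondsTo {n : ℕ} (S : InvariantSpinStructure n 2)
    (φ : isotropy n →* Circle) : Prop :=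
  ∃ p : S.P, S.proj p = basePoint n ∧ ∃ τ : isotropy n →* SpinR (4 * n + 3) 2,
    (∀ h : isotropy n, S.gact h p = S.act p (τ h)) ∧
    ∀ h : isotropy n, xiR (4 * n + 3) 2 (τ h) = rotation (φ h)

/-- The homomorphism `φₛ : [A, z] ↦ zˢ` from the isotropy group of the base point of `S^{4n+3}`
to `U(1)`, for `s` even. -/
def phi (n : ℕ) (s : ℤ) (hs : Even s) : isotropy n →* Circle :=
  (powHom (n + 1) s hs).comp (isotropy n).subtype

end SpinSphere

end

open SpinSphere

noncomputable section

namespace SpinSphere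

open CliffordAlgebra

/-! ### The Clifford algebra of `ℝⁿ` -/

/-! An invariant spin^r structure on a homogeneous space G/H is determined, up to equivalence, by a
lift τ : H → Spin^r of the isotropy representation, and every smooth lift occurs. So the theorem is
a statement about lifts of one representation. It is convenient to work on the preimage `isoCover n`
≅ Sp(n) × U(1) of H, the pairs (A, z) with A e = e z for the last basis vector e. It acts on the
tangent space e^⊥ by v ↦ A v z⁻¹, and its elements over 1 are (1, 1) and (-1, -1).

On `isoCover n` the representation lifts to Spin(4n+3). The Clifford algebra acts on the Fock space,
the exterior algebra of ℍⁿ⁺¹ regarded as ℂ²ⁿ⁺² through right multiplication by i. The isotropy group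
is complex linear, so suitable lifts have the vacuum 1 as an eigenvector, with eigenvalue an inverse
square root of the complex determinant, namely z^(n+1). A prescribed nonzero vacuum eigenvalue
removes the sign ambiguity (`IsLift.unique`), which makes the lift `isoLift` a homomorphism. Since
(-1, -1) acts trivially on e^⊥, its lift is ±1, and the vacuum shows that it is (-1)^(n+1)
(`isoLift_isoNegOne`).

Every τ therefore has the form [`isoLift`, ν] with ν : `isoCover n` → Spin(r) and ν(-1, -1) =
(-1)^(n+1) (`exists_nu`, `nu_isoNegOne`). Homomorphisms to abelian groups are trivial on Sp(n), so
they depend only on z (`isoCover_hom_eq`). For r = 1, ν takes values in {±1} and is trivial because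
U(1) is divisible; hence n must be odd (`odd_of_spin`). For r = 2, smoothness forces ν(A, z) = z^k
in Spin(2) ≅ U(1), with k of the parity of n+1 (`exists_eq_zpow`). The covering Spin(2) → SO(2)
squares, so φ is z^(2k), and for even n this is s = 2k ≡ 2 mod 4.

Conversely, each such k defines a structure (`homogeneousStructure`). If two structures have the
same φ, their characters have equal squares; the quotient of the characters has exponent two and is
trivial, so after matching frames the isotropy homomorphisms coincide and the structures are
equivalent (`CorrespondsTo.equivalent`). -/

theorem stdForm_apply (n : ℕ) (v : Fin n → ℝ) : stdForm n v = -(v ⬝ᵥ v) := by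
  simp [stdForm, QuadraticMap.weightedSumSquares_apply, dotProduct]

theorem ι_mul_self (n : ℕ) (v : Fin n → ℝ) :
    ι (stdForm n) v * ι (stdForm n) v = algebraMap ℝ (Cl n) (-(v ⬝ᵥ v)) := by
  rw [ι_sq_scalar, stdForm_apply]

theorem ι_mul_ι_add (n : ℕ) (v w : Fin n → ℝ) :
    ι (stdForm n) v * ι (stdForm n) w + ι (stdForm n) w * ι (stdForm n) v =
      algebraMap ℝ (Cl n) (-(2 * (v ⬝ᵥ w))) := by
  rw [ι_mul_ι_add_swap, QuadraticMap.polar]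
  congr 1
  simp only [stdForm_apply, add_dotProduct, dotProduct_add, dotProduct_comm w v]
  ring

/-- The generator `eₖ` of the Clifford algebra. -/
def gen (n : ℕ) (k : Fin n) : Cl n := ι (stdForm n) (Pi.single k 1)

theorem gen_mul_self (n : ℕ) (k : Fin n) : gen n k * gen n k = -1 := by
  rw [gen, ι_mul_self]
  simp

theorem gen_anticomm (n : ℕ) {j k : Fin n} (h : j ≠ k) :
    gen n j * gen n k = -(gen n k * gen n j) := by
  have := ι_mul_ι_add n (Pi.single j 1) (Pi.single k 1)
  rw [single_one_dotProduct, Pi.single_eq_of_ne h] at this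
  simpa [gen] using eq_neg_of_add_eq_zero_left (by simpa using this)

theorem involute_gen (n : ℕ) (k : Fin n) : involute (gen n k) = -gen n k :=
  involute_ι _

theorem ι_eq_sum_gen (n : ℕ) (v : Fin n → ℝ) : ι (stdForm n) v = ∑ k, v k • gen n k := by
  conv_lhs => rw [pi_eq_sum_univ' v]
  simp only [map_sum, map_smul, gen]

/-- The subalgebra of `Cl(n)` generated by `e₀, …, e_{k-1}`. -/
def firstGens (n k : ℕ) : Subalgebra ℝ (Cl n) :=
  Algebra.adjoin ℝ (gen n '' {j | j.val < k})

theorem gen_mem_firstGens {n k : ℕ} {j : Fin n} (h : j.val < k) : gen n j ∈ firstGens n k :=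
  Algebra.subset_adjoin ⟨j, h, rfl⟩

theorem firstGens_zero (n : ℕ) : firstGens n 0 = ⊥ := by
  simp [firstGens]

theorem firstGens_self (n : ℕ) : firstGens n n = ⊤ := by
  rw [eq_top_iff, ← adjoin_range_ι, Algebra.adjoin_le_iff]
  rintro _ ⟨v, rfl⟩
  rw [ι_eq_sum_gen]
  exact Subalgebra.sum_mem _ fun k _ => Subalgebra.smul_mem _ (gen_mem_firstGens k.2) _

theorem involute_mem_firstGens {n k : ℕ} {a : Cl n} (ha : a ∈ firstGens n k) :
    involute a ∈ firstGens n k := by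
  induction ha using Algebra.adjoin_induction with
  | mem x hx =>
    obtain ⟨j, hj, rfl⟩ := hx
    rw [involute_gen]
    exact neg_mem (gen_mem_firstGens hj)
  | algebraMap r => rw [AlgHom.commutes]; exact Subalgebra.algebraMap_mem _ _
  | add x y _ _ hx hy => rw [map_add]; exact add_mem hx hy
  | mul x y _ _ hx hy => rw [map_mul]; exact mul_mem hx hy

theorem gen_mul_of_mem {n k : ℕ} {a : Cl n} (ha : a ∈ firstGens n k) {j : Fin n}
    (hj : k ≤ j.val) : gen n j * a = involute a * gen n j := by
  induction ha using Algebra.adjoin_induction with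
  | mem x hx =>
    obtain ⟨i, hi, rfl⟩ := hx
    rw [involute_gen, neg_mul]
    refine gen_anticomm n ?_
    rintro rfl
    exact absurd hi (not_lt.mpr hj)
  | algebraMap r => rw [AlgHom.commutes]; exact (Algebra.commutes r _).symm
  | add x y _ _ hx hy => rw [map_add, mul_add, add_mul, hx, hy]
  | mul x y _ _ hx hy => rw [map_mul, ← mul_assoc, hx, mul_assoc, hy, mul_assoc]

/-- The new generator e anticommutes with the earlier ones and squares to -1, so sums a + e b are
closed under multiplication. Together with `eq_zero_of_decomp` this gives a normal form for
induction on the number of generators, which takes the place of a monomial basis. -/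
theorem exists_decomp {n k : ℕ} (hk : k < n) {x : Cl n} (hx : x ∈ firstGens n (k + 1)) :
    ∃ a ∈ firstGens n k, ∃ b ∈ firstGens n k, x = a + gen n ⟨k, hk⟩ * b := by
  induction hx using Algebra.adjoin_induction with
  | mem x hx =>
    obtain ⟨j, hj, rfl⟩ := hx
    rcases Nat.lt_succ_iff_lt_or_eq.mp hj with h | h
    · exact ⟨_, gen_mem_firstGens h, 0, zero_mem _, by simp⟩
    · refine ⟨0, zero_mem _, 1, one_mem _, ?_⟩
      have : j = ⟨k, hk⟩ := Fin.ext h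
      simp [this]
  | algebraMap r => exact ⟨_, Subalgebra.algebraMap_mem _ r, 0, zero_mem _, by simp⟩
  | add x y _ _ hx hy =>
    obtain ⟨a, ha, b, hb, rfl⟩ := hx
    obtain ⟨c, hc, d, hd, rfl⟩ := hy
    exact ⟨a + c, add_mem ha hc, b + d, add_mem hb hd, by rw [mul_add]; abel⟩
  | mul x y _ _ hx hy =>
    obtain ⟨a, ha, b, hb, rfl⟩ := hx
    obtain ⟨c, hc, d, hd, rfl⟩ := hy
    refine ⟨a * c - involute b * d, sub_mem (mul_mem ha hc) (mul_mem (involute_mem_firstGens hb) hd),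
      involute a * d + b * c, add_mem (mul_mem (involute_mem_firstGens ha) hd) (mul_mem hb hc), ?_⟩
    have h1 : gen n ⟨k, hk⟩ * involute a = a * gen n ⟨k, hk⟩ := by
      rw [gen_mul_of_mem (involute_mem_firstGens ha) le_rfl, involute_involute]
    have h2 : gen n ⟨k, hk⟩ * b * (gen n ⟨k, hk⟩ * d) = -(involute b * d) := by
      rw [gen_mul_of_mem hb le_rfl, mul_assoc, ← mul_assoc (gen n _) (gen n _), gen_mul_self]
      simp
    rw [add_mul, mul_add, mul_add, h2, mul_add, ← mul_assoc _ (involute a), h1]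
    noncomm_ring

/-- Moving e across with the grade involution changes the sign of exactly the component that
contains e. This is how the two components are separated below. -/
theorem gen_mul_involute_decomp {n k : ℕ} (hk : k < n) {a b : Cl n} (ha : a ∈ firstGens n k)
    (hb : b ∈ firstGens n k) :
    gen n ⟨k, hk⟩ * involute (a + gen n ⟨k, hk⟩ * b) =
      (a - gen n ⟨k, hk⟩ * b) * gen n ⟨k, hk⟩ := by
  have h1 := gen_mul_of_mem (involute_mem_firstGens ha) (j := ⟨k, hk⟩) le_rfl
  have h2 := gen_mul_of_mem (involute_mem_firstGens hb) (j := ⟨k, hk⟩) le_rfl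
  rw [involute_involute] at h1 h2
  rw [map_add, map_mul, involute_gen, mul_add, h1, neg_mul, mul_neg, h2, sub_mul, mul_assoc,
    sub_eq_add_neg]

theorem gen_mul_cancel {n : ℕ} {k : Fin n} {x y : Cl n} (h : gen n k * x = gen n k * y) :
    x = y := by
  have := congrArg (gen n k * ·) h
  simpa [← mul_assoc, gen_mul_self] using this

theorem mul_gen_cancel {n : ℕ} {k : Fin n} {x y : Cl n} (h : x * gen n k = y * gen n k) :
    x = y := by
  have := congrArg (· * gen n k) h
  simpa [mul_assoc, gen_mul_self] using this

theorem eq_zero_of_eq_neg_self {V : Type*} [AddCommGroup V] [Module ℝ V] {x : V} (h : x = -x) :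
    x = 0 := by
  have h2 : (2 : ℝ) • x = 0 := by rw [two_smul]; nth_rewrite 1 [h]; simp
  exact (smul_eq_zero.mp h2).resolve_left two_ne_zero

theorem mem_firstGens_of_gen_mul_involute {n k : ℕ} (hk : k < n) {x : Cl n}
    (hx : x ∈ firstGens n (k + 1)) (h : gen n ⟨k, hk⟩ * involute x = x * gen n ⟨k, hk⟩) :
    x ∈ firstGens n k := by
  obtain ⟨a, ha, b, hb, rfl⟩ := exists_decomp hk hx
  rw [gen_mul_involute_decomp hk ha hb] at h
  have h1 := mul_gen_cancel h
  have h2 : gen n ⟨k, hk⟩ * b = -(gen n ⟨k, hk⟩ * b) := by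
    have := congrArg (fun y => y - a) h1
    simpa [sub_eq_add_neg] using this.symm
  rw [eq_zero_of_eq_neg_self h2, add_zero]
  exact ha

theorem eq_zero_of_decomp {n k : ℕ} (hk : k < n) {a b : Cl n} (ha : a ∈ firstGens n k)
    (hb : b ∈ firstGens n k) (h : a + gen n ⟨k, hk⟩ * b = 0) : a = 0 ∧ b = 0 := by
  have h1 := gen_mul_involute_decomp hk ha hb
  rw [h, map_zero, mul_zero] at h1
  have h2 : a - gen n ⟨k, hk⟩ * b = 0 := mul_gen_cancel (by rw [← h1, zero_mul])
  have h3 : a = -a := eq_neg_of_add_eq_zero_left (by nth_rewrite 2 [sub_eq_zero.mp h2]; exact h)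
  have ha0 := eq_zero_of_eq_neg_self h3
  refine ⟨ha0, gen_mul_cancel (k := ⟨k, hk⟩) ?_⟩
  rw [ha0, zero_add] at h
  rw [h, mul_zero]

/-- An element `x` with `v x' = x v` for all vectors `v`, where `x'` is its grade involution, is a
scalar. -/
theorem exists_algebraMap_eq {n : ℕ} {x : Cl n}
    (h : ∀ k, gen n k * involute x = x * gen n k) : ∃ r : ℝ, algebraMap ℝ (Cl n) r = x := by
  have key : ∀ k ≤ n, x ∈ firstGens n (n - k) := by
    intro k
    induction k with
    | zero => intro _; rw [Nat.sub_zero, firstGens_self]; trivial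
    | succ k ih =>
      intro hk
      have h1 : n - (k + 1) < n := by omega
      have h2 : n - k = n - (k + 1) + 1 := by omega
      exact mem_firstGens_of_gen_mul_involute h1 (h2 ▸ ih (by omega)) (h _)
  have := key n le_rfl
  rw [Nat.sub_self, firstGens_zero, Algebra.mem_bot] at this
  exact this

/-- This is the simplicity of Cl(n) as a graded algebra. If x = a + e b is homogeneous and killed by
f, twisting by e shows that a - e b is killed too, so a and b are. Their parities are ε and -ε,
which is why the induction carries both signs. -/
theorem eq_zero_of_map_eq_zero_aux {n : ℕ} {B : Type*} [Ring B] [Algebra ℝ B] [Nontrivial B]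
    (f : Cl n →ₐ[ℝ] B) (k : ℕ) : k ≤ n → ∀ ε : ℝ, (ε = 1 ∨ ε = -1) → ∀ x ∈ firstGens n k,
      involute x = ε • x → f x = 0 → x = 0 := by
  induction k with
  | zero =>
    intro _ ε _ x hx _ hf
    rw [firstGens_zero, Algebra.mem_bot] at hx
    obtain ⟨r, rfl⟩ := hx
    rw [AlgHom.commutes, map_eq_zero_iff _ (algebraMap ℝ B).injective] at hf
    rw [hf, map_zero]
  | succ k ih =>
    intro hk ε hε x hx hinv hf
    obtain ⟨a, ha, b, hb, rfl⟩ := exists_decomp hk hx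
    set e := gen n ⟨k, hk⟩ with he
    have hε2 : ε * ε = 1 := by rcases hε with rfl | rfl <;> norm_num
    have h0 : (involute a - ε • a) + e * (-involute b - ε • b) = 0 := by
      rw [map_add, map_mul, he, involute_gen, ← he] at hinv
      have := sub_eq_zero.mpr hinv
      rw [← this, mul_sub, smul_add, mul_smul_comm]
      noncomm_ring
    obtain ⟨hia, hib⟩ := eq_zero_of_decomp hk
      (sub_mem (involute_mem_firstGens ha) (Subalgebra.smul_mem _ ha _))
      (sub_mem (neg_mem (involute_mem_firstGens hb)) (Subalgebra.smul_mem _ hb _)) h0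
    have h1 := gen_mul_involute_decomp hk ha hb
    rw [hinv] at h1
    have h2 : f (a - e * b) = 0 := by
      have h3 := congrArg (fun y => f (-(y * e))) h1
      simp only [mul_assoc] at h3
      rw [he, gen_mul_self, mul_neg_one, neg_neg, ← he, map_neg, map_mul, map_mul, map_smul, hf] at h3
      rw [← h3]; simp
    have h4 : f a = 0 := by
      rw [map_add] at hf
      rw [map_sub] at h2
      apply eq_zero_of_eq_neg_self
      rw [eq_neg_of_add_eq_zero_left hf, neg_neg]
      rw [sub_eq_zero.mp h2] at hf
      have := eq_zero_of_eq_neg_self (eq_neg_of_add_eq_zero_left hf)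
      rw [this, neg_zero]
    have h5 : f b = 0 := by
      rw [map_add, h4, zero_add] at hf
      have h6 : b = -(e * (e * b)) := by rw [← mul_assoc, he, gen_mul_self]; simp
      rw [h6, map_neg, map_mul, hf, mul_zero, neg_zero]
    have ha0 := ih (by omega) ε hε a ha (sub_eq_zero.mp hia) h4
    have hb0 := ih (by omega) (-ε) (by rcases hε with rfl | rfl <;> norm_num) b hb (by
      rw [neg_smul, ← sub_eq_zero.mp hib, neg_neg]) h5
    rw [ha0, hb0, mul_zero, add_zero]

/-- An algebra homomorphism out of `Cl(n)` is injective on the even part. -/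
theorem eq_zero_of_map_eq_zero {n : ℕ} {B : Type*} [Ring B] [Algebra ℝ B] [Nontrivial B]
    (f : Cl n →ₐ[ℝ] B) {x : Cl n} (hx : involute x = x) (hf : f x = 0) : x = 0 :=
  eq_zero_of_map_eq_zero_aux f n le_rfl 1 (Or.inl rfl) x (by rw [firstGens_self]; trivial)
    (by rw [one_smul, hx]) hf

instance (n : ℕ) : Module.Finite ℝ (Cl n) :=
  have : Module.Finite ℝ (ExteriorAlgebra ℝ (Fin n → ℝ)) :=
    Module.Finite.of_basis (Pi.basisFun ℝ (Fin n)).ExteriorAlgebra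
  Module.Finite.equiv (equivExterior (stdForm n)).symm

/-! ### The spin group -/

theorem spin_inv (n : ℕ) (x : Spin n) : ((x⁻¹ : Spin n) : Cl n) = star (x : Cl n) := rfl

theorem spin_star_mul (n : ℕ) (x : Spin n) : star (x : Cl n) * x = 1 :=
  spinGroup.coe_star_mul_self x

theorem spin_mul_star (n : ℕ) (x : Spin n) : (x : Cl n) * star (x : Cl n) = 1 :=
  spinGroup.coe_mul_star_self x

theorem spin_involute (n : ℕ) (x : Spin n) : involute (x : Cl n) = x :=
  spinGroup.involute_eq x.2

theorem spinRot_apply_eq_iff (n : ℕ) (x : Spin n) (v w : Fin n → ℝ) :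
    spinRot n x v = w ↔ (x : Cl n) * ι (stdForm n) v = ι (stdForm n) w * x := by
  change spinRotFun n x v = w ↔ _
  rw [← (ι_stdForm_injective n).eq_iff, ι_spinRotFun, spin_inv]
  constructor
  · intro h; rw [← h, mul_assoc, spin_star_mul, mul_one]
  · intro h; rw [h, mul_assoc, spin_mul_star, mul_one]

theorem spin_mul_ι (n : ℕ) (x : Spin n) (v : Fin n → ℝ) :
    (x : Cl n) * ι (stdForm n) v = ι (stdForm n) (spinRot n x v) * x :=
  (spinRot_apply_eq_iff n x v _).mp rfl

theorem spinRot_dotProduct (n : ℕ) (x : Spin n) (v : Fin n → ℝ) :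
    spinRot n x v ⬝ᵥ spinRot n x v = v ⬝ᵥ v := by
  have h : ι (stdForm n) (spinRot n x v) * ι (stdForm n) (spinRot n x v) =
      (x : Cl n) * (ι (stdForm n) v * ι (stdForm n) v) * star (x : Cl n) := by
    have h1 : ι (stdForm n) (spinRot n x v) = (x : Cl n) * ι (stdForm n) v * star (x : Cl n) :=
      ι_spinRotFun n x v
    rw [h1]
    simp only [mul_assoc]
    rw [← mul_assoc (star (x : Cl n)) (x : Cl n), spin_star_mul, one_mul]
  rw [ι_mul_self, ι_mul_self, ← Algebra.commutes, mul_assoc, spin_mul_star, mul_one] at h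
  exact neg_injective ((algebraMap ℝ (Cl n)).injective h)

theorem mem_even_of_involute_eq {n : ℕ} {x : Cl n} (h : involute x = x) :
    x ∈ even (stdForm n) := by
  have hx : x ∈ evenOdd (stdForm n) 0 ⊔ evenOdd (stdForm n) 1 := by
    rw [(evenOdd_isCompl (stdForm n)).sup_eq_top]; trivial
  obtain ⟨a, ha, b, hb, rfl⟩ := Submodule.mem_sup.mp hx
  rw [map_add, involute_eq_of_mem_even ha, involute_eq_of_mem_odd hb] at h
  have hb0 : b = 0 := eq_zero_of_eq_neg_self (add_left_cancel h).symm
  rw [hb0, add_zero, ← SetLike.mem_coe, ← Subalgebra.coe_toSubmodule, even_toSubmodule]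
  exact ha

theorem unit_ι_mem_pin {n : ℕ} {a : Fin n → ℝ} (ha : a ⬝ᵥ a = 1) :
    ι (stdForm n) a ∈ pinGroup (stdForm n) := by
  have h1 : ι (stdForm n) a * ι (stdForm n) a = -1 := by rw [ι_mul_self, ha]; simp
  refine ⟨⟨⟨ι (stdForm n) a, -ι (stdForm n) a, by simp [-ι_sq_scalar, h1],
    by simp [-ι_sq_scalar, h1]⟩, Subgroup.subset_closure ⟨a, rfl⟩, rfl⟩, ?_⟩
  rw [SetLike.mem_coe, Unitary.mem_iff, star_ι]
  simp [-ι_sq_scalar, h1]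

theorem mem_spin_of_mem_pin {n : ℕ} {x : Cl n} (hx : x ∈ pinGroup (stdForm n))
    (h : involute x = x) : x ∈ spinGroup (stdForm n) :=
  ⟨hx, mem_even_of_involute_eq h⟩

theorem mul_mem_spin {n : ℕ} {a b : Fin n → ℝ} (ha : a ⬝ᵥ a = 1) (hb : b ⬝ᵥ b = 1) :
    ι (stdForm n) a * ι (stdForm n) b ∈ spinGroup (stdForm n) :=
  mem_spin_of_mem_pin (mul_mem (unit_ι_mem_pin ha) (unit_ι_mem_pin hb)) (by simp)

theorem neg_one_mem_spin (n : ℕ) [NeZero n] : (-1 : Cl n) ∈ spinGroup (stdForm n) := by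
  have h : (Pi.single 0 1 : Fin n → ℝ) ⬝ᵥ Pi.single 0 1 = 1 := by simp
  have := mul_mem_spin h h
  rwa [ι_mul_self, h, map_neg, map_one] at this

/-- The element `-1 ∈ Spin(n)`, for `n ≥ 1`. -/
def spinNegOne (n : ℕ) [NeZero n] : Spin n := ⟨-1, neg_one_mem_spin n⟩

theorem ι_mul_ι_of_unit {n : ℕ} {a : Fin n → ℝ} (ha : a ⬝ᵥ a = 1) (v : Fin n → ℝ) :
    ι (stdForm n) a * ι (stdForm n) v =
      ι (stdForm n) ((2 * (a ⬝ᵥ v)) • a - v) * ι (stdForm n) a := by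
  rw [eq_sub_of_add_eq (ι_mul_ι_add n a v), map_sub, map_smul, sub_mul, smul_mul_assoc, ι_mul_self,
    ha, Algebra.smul_def, ← (algebraMap ℝ (Cl n)).map_mul]
  congr 2
  ring

/-- The element y⁻¹x is even and commutes with all vectors, so it is a real scalar by
`exists_algebraMap_eq`; being unitary, it is ±1. -/
theorem spin_eq_or_eq_neg {n : ℕ} {x y : Spin n} (h : spinRot n x = spinRot n y) :
    (x : Cl n) = y ∨ (x : Cl n) = -y := by
  have h1 : spinRot n (y⁻¹ * x) = 1 := by rw [map_mul, h, ← map_mul, inv_mul_cancel, map_one]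
  obtain ⟨r, hr⟩ := exists_algebraMap_eq (x := ((y⁻¹ * x : Spin n) : Cl n)) fun k => by
    rw [spin_involute, gen, spin_mul_ι, h1]; rfl
  have h2 := spin_star_mul n (y⁻¹ * x)
  rw [← hr, star_algebraMap, ← map_mul, ← map_one (algebraMap ℝ (Cl n))] at h2
  have h3 : (x : Cl n) = y * ((y⁻¹ * x : Spin n) : Cl n) := by
    rw [← Submonoid.coe_mul, mul_inv_cancel_left]
  rcases mul_self_eq_one_iff.mp ((algebraMap ℝ (Cl n)).injective h2) with h | h
  · left; rw [h3, ← hr, h, map_one, mul_one]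
  · right; rw [h3, ← hr, h, map_neg, map_one, mul_neg_one]

/-- Each nonzero vector of the list contributes its normalisation as a factor on the left, changing
parity and determinant together; a zero vector contributes the identity. Conjugation by a unit
vector is minus the reflection, and the grade involution on the right absorbs that sign. -/
theorem exists_pin_of_reflections (n : ℕ) (l : List (EuclideanSpace ℝ (Fin n))) :
    ∃ y ∈ pinGroup (stdForm n),
      ((involute y = y ∧ LinearMap.det
        ((l.map fun v => (ℝ ∙ v)ᗮ.reflection).prod.toLinearEquiv : EuclideanSpace ℝ (Fin n) →ₗ[ℝ] EuclideanSpace ℝ (Fin n)) = 1) ∨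
       (involute y = -y ∧ LinearMap.det
        ((l.map fun v => (ℝ ∙ v)ᗮ.reflection).prod.toLinearEquiv : EuclideanSpace ℝ (Fin n) →ₗ[ℝ] EuclideanSpace ℝ (Fin n)) = -1)) ∧
      ∀ v : EuclideanSpace ℝ (Fin n), y * ι (stdForm n) v.ofLp =
        ι (stdForm n) ((l.map fun v => (ℝ ∙ v)ᗮ.reflection).prod v).ofLp * involute y := by
  induction l with
  | nil =>
    refine ⟨1, one_mem _, Or.inl ⟨map_one _, ?_⟩, fun v => by simp⟩
    exact LinearMap.det_id
  | cons a l ih =>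
    obtain ⟨y, hy, hdet, hconj⟩ := ih
    rw [List.map_cons, List.prod_cons]
    set φ := (l.map fun v => (ℝ ∙ v)ᗮ.reflection).prod with hφ
    have hmul : (((ℝ ∙ a)ᗮ.reflection * φ).toLinearEquiv : EuclideanSpace ℝ (Fin n) →ₗ[ℝ] EuclideanSpace ℝ (Fin n)) =
      ((ℝ ∙ a)ᗮ.reflection.toLinearEquiv : EuclideanSpace ℝ (Fin n) →ₗ[ℝ] EuclideanSpace ℝ (Fin n)) ∘ₗ
        (φ.toLinearEquiv : EuclideanSpace ℝ (Fin n) →ₗ[ℝ] EuclideanSpace ℝ (Fin n)) :=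
      LinearMap.ext fun _ => rfl
    by_cases ha : a = 0
    · have h1 : (ℝ ∙ a)ᗮ.reflection = 1 := by
        ext1 v
        subst ha
        simpa using Submodule.reflection_mem_subspace_eq_self (K := (⊤ : Submodule ℝ _)) (x := v) trivial
      refine ⟨y, hy, ?_, ?_⟩
      · rw [h1, one_mul]; exact hdet
      · rw [h1, one_mul]; exact hconj
    · have hn : ‖a‖ ≠ 0 := norm_ne_zero_iff.mpr ha
      set b : Fin n → ℝ := (‖a‖⁻¹ • a).ofLp with hb
      have haa : a.ofLp ⬝ᵥ a.ofLp = ‖a‖ ^ 2 := by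
        rw [EuclideanSpace.norm_sq_eq]
        simp [dotProduct, sq]
      have hb1 : b ⬝ᵥ b = 1 := by
        rw [hb, WithLp.ofLp_smul, smul_dotProduct, dotProduct_smul, haa]
        simp only [smul_eq_mul]
        field_simp
      have hrefl : ∀ v : EuclideanSpace ℝ (Fin n), ((ℝ ∙ a)ᗮ.reflection v).ofLp =
          -((2 * (b ⬝ᵥ v.ofLp)) • b - v.ofLp) := by
        intro v
        rw [Submodule.reflection_orthogonal_apply, Submodule.reflection_singleton_apply]
        have h2 : ⟪a, v⟫ = a.ofLp ⬝ᵥ v.ofLp := by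
          rw [PiLp.inner_apply, dotProduct]
          simp [mul_comm]
        rw [h2, hb]
        ext i
        simp [smul_dotProduct]
        field_simp
      have hdr : LinearMap.det ((ℝ ∙ a)ᗮ.reflection.toLinearEquiv : EuclideanSpace ℝ (Fin n) →ₗ[ℝ] EuclideanSpace ℝ (Fin n)) = -1 := by
        have := (ℝ ∙ a)ᗮ.det_reflection
        rw [Submodule.orthogonal_orthogonal, finrank_span_singleton ha, pow_one] at this
        exact this
      refine ⟨ι (stdForm n) b * y, mul_mem (unit_ι_mem_pin hb1) hy, ?_, ?_⟩
      · rw [hmul, LinearMap.det_comp, hdr, map_mul, involute_ι]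
        rcases hdet with ⟨h1, h2⟩ | ⟨h1, h2⟩
        · right; rw [h1, h2]; simp
        · left; rw [h1, h2]; simp
      · intro v
        rw [mul_assoc, hconj, ← mul_assoc, ι_mul_ι_of_unit hb1, map_mul, involute_ι,
          LinearIsometryEquiv.coe_mul, Function.comp_apply, hrefl, map_neg]
        simp only [mul_assoc, neg_mul, mul_neg, neg_neg]

/-- **Cartan–Dieudonné**: every orthogonal transformation of `ℝⁿ` is given by an element of
`Pin(n)`, even or odd according to the determinant. -/
theorem exists_pin (n : ℕ) (g : Module.End ℝ (Fin n → ℝ)) (hg : ∀ v, g v ⬝ᵥ g v = v ⬝ᵥ v) :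
    ∃ y ∈ pinGroup (stdForm n),
      ((involute y = y ∧ LinearMap.det g = 1) ∨ (involute y = -y ∧ LinearMap.det g = -1)) ∧
      ∀ v, y * ι (stdForm n) v = ι (stdForm n) (g v) * involute y := by
  set e : EuclideanSpace ℝ (Fin n) ≃ₗ[ℝ] (Fin n → ℝ) := WithLp.linearEquiv 2 ℝ (Fin n → ℝ)
  have hnorm : ∀ w : EuclideanSpace ℝ (Fin n), ‖w‖ ^ 2 = w.ofLp ⬝ᵥ w.ofLp := by
    intro w
    rw [EuclideanSpace.norm_sq_eq]
    simp [dotProduct, sq]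
  let f : EuclideanSpace ℝ (Fin n) →ₗᵢ[ℝ] EuclideanSpace ℝ (Fin n) :=
    { e.symm.toLinearMap ∘ₗ g ∘ₗ e.toLinearMap with
      norm_map' := fun w => by
        rw [← sq_eq_sq₀ (norm_nonneg _) (norm_nonneg _), hnorm, hnorm]
        exact hg _ }
  let φ := f.toLinearIsometryEquiv rfl
  obtain ⟨l, -, hl⟩ := φ.reflections_generate_dim
  obtain ⟨y, hy, hdet, hconj⟩ := exists_pin_of_reflections n l
  rw [← hl] at hdet hconj
  have hd : LinearMap.det (φ.toLinearEquiv : EuclideanSpace ℝ (Fin n) →ₗ[ℝ] EuclideanSpace ℝ (Fin n)) =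
      LinearMap.det g := by
    have : (φ.toLinearEquiv : EuclideanSpace ℝ (Fin n) →ₗ[ℝ] EuclideanSpace ℝ (Fin n)) =
      e.symm.toLinearMap ∘ₗ g ∘ₗ e.symm.symm.toLinearMap := rfl
    rw [this, LinearMap.det_conj]
  rw [hd] at hdet
  exact ⟨y, hy, hdet, fun v => hconj (WithLp.toLp 2 v)⟩

theorem spinRot_surjective (n : ℕ) (g : Module.End ℝ (Fin n → ℝ))
    (hg : ∀ v, g v ⬝ᵥ g v = v ⬝ᵥ v) (hdet : 0 < LinearMap.det g) :
    ∃ x : Spin n, spinRot n x = g := by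
  obtain ⟨y, hy, h | h, hconj⟩ := exists_pin n g hg
  · refine ⟨⟨y, mem_spin_of_mem_pin hy h.1⟩, LinearMap.ext fun v => ?_⟩
    rw [spinRot_apply_eq_iff]
    have := hconj v
    rwa [h.1] at this
  · rw [h.2] at hdet
    norm_num at hdet

/-- With determinant -1 there would be an odd element y of the pin group inducing the same
transformation up to the twist. Then `star y * x` is odd and, by `exists_algebraMap_eq`, a scalar;
so it vanishes, although x is invertible. -/
theorem spinRot_det (n : ℕ) (x : Spin n) : LinearMap.det (spinRot n x) = 1 := by
  obtain ⟨y, hy, h | h, hconj⟩ := exists_pin n _ (spinRot_dotProduct n x)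
  · exact h.2
  · exfalso
    have hy1 : star y * y = 1 := pinGroup.star_mul_self_of_mem hy
    have hy2 : y * star y = 1 := pinGroup.mul_star_self_of_mem hy
    have hstar : involute (star y) = -star y := by
      rw [star_def, reverse_involute, involute_involute, ← reverse_involute, h.1, map_neg, neg_neg]
    have hz : involute (star y * (x : Cl n)) = -(star y * (x : Cl n)) := by
      rw [map_mul, hstar, spin_involute, neg_mul]
    obtain ⟨r, hr⟩ := exists_algebraMap_eq (x := star y * (x : Cl n)) fun k => by
      have h1 := hconj (Pi.single k 1)
      have h2 : star y * ι (stdForm n) (spinRot n x (Pi.single k 1)) = -(gen n k * star y) := by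
        rw [h.1] at h1
        have h3 := congrArg (fun t => star y * t * star y) h1
        simp only [← mul_assoc, hy1, one_mul, mul_neg, neg_mul] at h3
        rw [mul_assoc (star y * _), hy2, mul_one] at h3
        rw [gen, h3, neg_neg]
      rw [hz, mul_assoc, gen, spin_mul_ι, ← mul_assoc, h2, gen]
      noncomm_ring
    have h0 : star y * (x : Cl n) = 0 := by
      apply eq_zero_of_eq_neg_self
      rw [← hz, ← hr, AlgHom.commutes]
    have h4 : (x : Cl n) = 0 := by
      rw [← one_mul (x : Cl n), ← hy2, mul_assoc, h0, mul_zero]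
    have h5 := spin_mul_star n x
    rw [h4, zero_mul] at h5
    exact zero_ne_one h5

/-! ### The groups `Spin(1)` and `Spin(2)` -/

theorem spin_one_eq (x : Spin 1) : (x : Cl 1) = 1 ∨ (x : Cl 1) = -1 := by
  apply spin_eq_or_eq_neg (x := x) (y := 1)
  obtain ⟨r, hr⟩ : ∃ r : ℝ, algebraMap ℝ (Cl 1) r = x := by
    have hx : (x : Cl 1) ∈ firstGens 1 1 := by rw [firstGens_self]; trivial
    obtain ⟨a, ha, b, hb, hab⟩ := exists_decomp (n := 1) (k := 0) one_pos hx
    rw [firstGens_zero, Algebra.mem_bot] at ha hb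
    obtain ⟨r, rfl⟩ := ha
    obtain ⟨t, rfl⟩ := hb
    have h := spin_involute 1 x
    rw [hab, map_add, map_mul, AlgHom.commutes, AlgHom.commutes, involute_gen, neg_mul] at h
    have h0 := eq_zero_of_eq_neg_self (add_left_cancel h).symm
    exact ⟨r, by rw [hab, h0, add_zero]⟩
  refine LinearMap.ext fun v => ?_
  rw [spinRot_apply_eq_iff, ← hr, map_one]
  exact Algebra.commutes r _

theorem spin_two_eq (x : Spin 2) :
    ∃ a b : ℝ, (x : Cl 2) = algebraMap ℝ _ a + b • (gen 2 0 * gen 2 1) := by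
  have hx : (x : Cl 2) ∈ firstGens 2 2 := by rw [firstGens_self]; trivial
  obtain ⟨a, ha, b, hb, hab⟩ := exists_decomp (n := 2) (k := 1) (by norm_num) hx
  obtain ⟨c, hc, d, hd, rfl⟩ := exists_decomp (n := 2) (k := 0) (by norm_num) ha
  obtain ⟨p, hp, q, hq, rfl⟩ := exists_decomp (n := 2) (k := 0) (by norm_num) hb
  rw [firstGens_zero, Algebra.mem_bot] at hc hd hp hq
  obtain ⟨c, rfl⟩ := hc
  obtain ⟨d, rfl⟩ := hd
  obtain ⟨p, rfl⟩ := hp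
  obtain ⟨q, rfl⟩ := hq
  have hab' : (x : Cl 2) = algebraMap ℝ _ c + (gen 2 0 * algebraMap ℝ _ d +
      gen 2 1 * algebraMap ℝ _ p) + gen 2 1 * gen 2 0 * algebraMap ℝ _ q := by
    rw [hab]
    change _ + gen 2 0 * _ + gen 2 1 * (_ + gen 2 0 * _) = _
    noncomm_ring
  have h := spin_involute 2 x
  rw [hab'] at h
  simp only [map_add, map_mul, AlgHom.commutes, involute_gen] at h
  have h0 : gen 2 0 * algebraMap ℝ _ d + gen 2 1 * algebraMap ℝ _ p = 0 := by
    apply eq_zero_of_eq_neg_self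
    rw [neg_mul_neg, add_right_cancel_iff, add_right_inj] at h
    nth_rewrite 1 [← h]
    noncomm_ring
  refine ⟨c, -q, ?_⟩
  rw [hab', h0, add_zero, gen_anticomm 2 (show (1 : Fin 2) ≠ 0 by decide), neg_mul,
    ← Algebra.commutes, ← Algebra.smul_def, neg_smul]

/-- The quaternion `i`. -/
def quatI : ℍ[ℝ] := ⟨0, 1, 0, 0⟩

/-- The quaternion `j`. -/
def quatJ : ℍ[ℝ] := ⟨0, 0, 1, 0⟩

/-- The quaternion `k`. -/
def quatK : ℍ[ℝ] := ⟨0, 0, 0, 1⟩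

@[simp] theorem quatI_re : quatI.re = 0 := rfl
@[simp] theorem quatI_imI : quatI.imI = 1 := rfl
@[simp] theorem quatI_imJ : quatI.imJ = 0 := rfl
@[simp] theorem quatI_imK : quatI.imK = 0 := rfl
@[simp] theorem quatJ_re : quatJ.re = 0 := rfl
@[simp] theorem quatJ_imI : quatJ.imI = 0 := rfl
@[simp] theorem quatJ_imJ : quatJ.imJ = 1 := rfl
@[simp] theorem quatJ_imK : quatJ.imK = 0 := rfl
@[simp] theorem quatK_re : quatK.re = 0 := rfl
@[simp] theorem quatK_imI : quatK.imI = 0 := rfl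
@[simp] theorem quatK_imJ : quatK.imJ = 0 := rfl
@[simp] theorem quatK_imK : quatK.imK = 1 := rfl

/-- The algebra homomorphism `Cl(2) → ℍ` with `e₀ ↦ i` and `e₁ ↦ j`. -/
def clTwoQuat : Cl 2 →ₐ[ℝ] ℍ[ℝ] :=
  CliffordAlgebra.lift (stdForm 2)
    ⟨(LinearMap.proj 0 : (Fin 2 → ℝ) →ₗ[ℝ] ℝ).smulRight quatI +
      (LinearMap.proj 1 : (Fin 2 → ℝ) →ₗ[ℝ] ℝ).smulRight quatJ, fun v => by
      rw [stdForm_apply, Quaternion.algebraMap_def]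
      ext <;> simp [dotProduct, Fin.sum_univ_two] <;> ring⟩

theorem clTwoQuat_gen_mul_gen : clTwoQuat (gen 2 0 * gen 2 1) = quatK := by
  rw [map_mul, gen, gen, clTwoQuat, lift_ι_apply, lift_ι_apply]
  ext <;> simp

/-- The element `re w + im w e₀e₁` of `Spin(2)`. -/
def spinTwoFun (w : Circle) : Cl 2 :=
  algebraMap ℝ _ (w : ℂ).re + (w : ℂ).im • (gen 2 0 * gen 2 1)

theorem Circle.re_sq_add_im_sq (w : Circle) : (w : ℂ).re ^ 2 + (w : ℂ).im ^ 2 = 1 := by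
  have := Circle.normSq_coe w
  rw [Complex.normSq_apply] at this
  linarith

theorem gen_two_mul_gen_sq : gen 2 0 * gen 2 1 * (gen 2 0 * gen 2 1) = -1 := by
  rw [mul_assoc, ← mul_assoc (gen 2 1), gen_anticomm 2 (show (1 : Fin 2) ≠ 0 by decide), neg_mul,
    mul_assoc, gen_mul_self, mul_neg, ← mul_assoc, gen_mul_self]
  simp

theorem spinTwoFun_mul (w z : Circle) :
    spinTwoFun (w * z) = spinTwoFun w * spinTwoFun z := by
  simp only [spinTwoFun, Circle.coe_mul, Complex.mul_re, Complex.mul_im, add_mul, mul_add,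
    smul_mul_assoc, mul_smul_comm, gen_two_mul_gen_sq,
    Algebra.algebraMap_eq_smul_one, one_mul, mul_one]
  module

theorem spinTwoFun_mem (w : Circle) : spinTwoFun w ∈ spinGroup (stdForm 2) := by
  -- With w = c + s i, the element c + s e₀e₁ equals e₀(-c e₀ + s e₁), a product of two unit
  -- vectors.
  have h : spinTwoFun w = ι (stdForm 2) (Pi.single 0 1) *
      ι (stdForm 2) ((-(w : ℂ).re) • Pi.single 0 1 + (w : ℂ).im • Pi.single 1 1) := by
    rw [map_add, map_smul, map_smul, ← gen, ← gen, spinTwoFun, mul_add, mul_smul_comm,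
      mul_smul_comm, gen_mul_self, Algebra.algebraMap_eq_smul_one]
    simp
  rw [h]
  refine mul_mem_spin (by simp) ?_
  have := Circle.re_sq_add_im_sq w
  simp [dotProduct, Fin.sum_univ_two]
  linarith

/-- The isomorphism `U(1) → Spin(2)`, as a homomorphism. -/
def spinTwo : Circle →* Spin 2 where
  toFun w := ⟨spinTwoFun w, spinTwoFun_mem w⟩
  map_one' := Subtype.ext (by simp [spinTwoFun])
  map_mul' w z := Subtype.ext (spinTwoFun_mul w z)

theorem coe_spinTwo (w : Circle) : (spinTwo w : Cl 2) =
    algebraMap ℝ _ (w : ℂ).re + (w : ℂ).im • (gen 2 0 * gen 2 1) := rfl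

theorem clTwoQuat_spinTwo (w : Circle) :
    clTwoQuat (spinTwo w) = (w : ℂ).re + (w : ℂ).im • quatK := by
  rw [coe_spinTwo, map_add, AlgHom.commutes, map_smul, clTwoQuat_gen_mul_gen]
  rfl

/-- The quaternions serve as a model in which 1 and e₀e₁ ↦ k are visibly independent, so that the
real and imaginary parts of w can be read off. -/
theorem spinTwo_injective : Function.Injective spinTwo := by
  intro w z h
  have h1 := clTwoQuat_spinTwo w
  rw [h, clTwoQuat_spinTwo] at h1
  apply Circle.ext
  apply Complex.ext
  · simpa using (congrArg QuaternionAlgebra.re h1).symm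
  · simpa using (congrArg QuaternionAlgebra.imK h1).symm

theorem star_gen (n : ℕ) (k : Fin n) : star (gen n k) = -gen n k := star_ι _

theorem spinTwo_surjective : Function.Surjective spinTwo := by
  intro x
  obtain ⟨a, b, hx⟩ := spin_two_eq x
  have h := spin_mul_star 2 x
  rw [hx, star_add, star_algebraMap, CliffordAlgebra.star_smul, star_mul, star_gen, star_gen, neg_mul_neg,
    gen_anticomm 2 (show (1 : Fin 2) ≠ 0 by decide)] at h
  have h1 : algebraMap ℝ (Cl 2) (a ^ 2 + b ^ 2) = algebraMap ℝ (Cl 2) 1 := by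
    rw [map_one, ← h]
    simp only [add_mul, mul_add, smul_mul_assoc, mul_smul_comm, mul_neg, gen_two_mul_gen_sq,
      Algebra.algebraMap_eq_smul_one, one_mul, mul_one]
    module
  have h2 := (algebraMap ℝ (Cl 2)).injective h1
  refine ⟨⟨⟨a, b⟩, ?_⟩, Subtype.ext ?_⟩
  · rw [Submonoid.unitSphere, Submonoid.mem_mk, Subsemigroup.mem_mk, mem_sphere_zero_iff_norm, ← sq_eq_sq₀ (norm_nonneg _) zero_le_one, Complex.sq_norm,
      Complex.normSq_apply]
    simp only
    linarith
  · rw [hx]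
    exact coe_spinTwo _

/-- The isomorphism `U(1) ≅ Spin(2)`. -/
def spinTwoEquiv : Circle ≃* Spin 2 :=
  MulEquiv.ofBijective spinTwo ⟨spinTwo_injective, spinTwo_surjective⟩

/-- The double covering of SO(2) is squaring. This is the origin of the factor 2 in s = 2k. -/
theorem spinRot_spinTwo (w : Circle) : spinRot 2 (spinTwo w) = rotation (w ^ 2) := by
  refine LinearMap.ext fun v => ?_
  rw [spinRot_apply_eq_iff, coe_spinTwo]
  have h := Circle.re_sq_add_im_sq w
  have h1 : gen 2 1 * gen 2 0 = -(gen 2 0 * gen 2 1) :=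
    gen_anticomm 2 (show (1 : Fin 2) ≠ 0 by decide)
  have e1 : gen 2 0 * gen 2 1 * gen 2 0 = gen 2 1 := by
    rw [mul_assoc, h1, mul_neg, ← mul_assoc, gen_mul_self]; simp
  have e2 : gen 2 0 * gen 2 1 * gen 2 1 = -gen 2 0 := by
    rw [mul_assoc, gen_mul_self]; simp
  have e3 : gen 2 0 * (gen 2 0 * gen 2 1) = -gen 2 1 := by
    rw [← mul_assoc, gen_mul_self]; simp
  have e4 : gen 2 1 * (gen 2 0 * gen 2 1) = gen 2 0 := by
    rw [← mul_assoc, h1, neg_mul, mul_assoc, gen_mul_self]; simp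
  rw [ι_eq_sum_gen, ι_eq_sum_gen, Fin.sum_univ_two, Fin.sum_univ_two]
  simp only [rotation, Matrix.toLin'_apply, Matrix.mulVec, dotProduct, Fin.sum_univ_two, sq,
    Circle.coe_mul, Complex.mul_re, Complex.mul_im, add_mul, mul_add, smul_mul_assoc,
    mul_smul_comm, e1, e2, e3, e4, Algebra.algebraMap_eq_smul_one, one_mul, mul_one]
  simp
  set a := (w : ℂ).re
  set b := (w : ℂ).im
  match_scalars
  · linear_combination (-v 0 * a + v 1 * b) * h
  · linear_combination (-v 0 * b - v 1 * a) * h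

/-! ### Quaternionic reflections -/

section Reflections

open Matrix

variable {m : ℕ}

/-- The matrix `1 + u c u*`. -/
def quatRefl (u : Fin m → ℍ[ℝ]) (c : ℍ[ℝ]) : Matrix (Fin m) (Fin m) ℍ[ℝ] :=
  1 + Matrix.of fun a b => u a * (c * star (u b))

theorem quatRefl_mulVec (u v : Fin m → ℍ[ℝ]) (c : ℍ[ℝ]) :
    quatRefl u c *ᵥ v = fun a => v a + u a * (c * (star u ⬝ᵥ v)) := by
  funext a
  rw [quatRefl, add_mulVec, one_mulVec, Pi.add_apply]
  simp only [mulVec, dotProduct, of_apply, Pi.star_apply, Finset.mul_sum, mul_assoc]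

theorem quatRefl_zero (u : Fin m → ℍ[ℝ]) : quatRefl u 0 = 1 := by
  ext1 a b
  simp [quatRefl]

theorem quatRefl_mul (u : Fin m → ℍ[ℝ]) (c d : ℍ[ℝ]) :
    quatRefl u c * quatRefl u d = quatRefl u (c + d + c * (star u ⬝ᵥ u) * d) := by
  rw [quatRefl, quatRefl, quatRefl, add_mul, mul_add, mul_add, one_mul, mul_one, one_mul, add_assoc]
  congr 1
  ext1 a b
  simp only [Matrix.add_apply, Matrix.mul_apply, of_apply, dotProduct, Pi.star_apply, Finset.mul_sum,
    Finset.sum_mul, mul_add, add_mul, mul_assoc]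
  abel

theorem star_quatRefl (u : Fin m → ℍ[ℝ]) (c : ℍ[ℝ]) :
    star (quatRefl u c) = quatRefl u (star c) := by
  rw [quatRefl, quatRefl, star_add, star_one]
  congr 1
  ext1 a b
  simp [star_apply, mul_assoc]

theorem quatRefl_smul_right (u : Fin m → ℍ[ℝ]) (p c : ℍ[ℝ]) :
    quatRefl (fun a => u a * p) c = quatRefl u (p * c * star p) := by
  simp only [quatRefl, star_mul, mul_assoc]

theorem quatRefl_mem {u : Fin m → ℍ[ℝ]} {c : ℍ[ℝ]}
    (h1 : star c + c + star c * (star u ⬝ᵥ u) * c = 0)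
    (h2 : c + star c + c * (star u ⬝ᵥ u) * star c = 0) :
    quatRefl u c ∈ unitary (Matrix (Fin m) (Fin m) ℍ[ℝ]) := by
  rw [Unitary.mem_iff, star_quatRefl, quatRefl_mul, quatRefl_mul, h1, h2, quatRefl_zero]
  exact ⟨rfl, rfl⟩

/-- For a unit vector `u`, the homomorphism `q ↦ 1 + u (q - 1) u*` from the unit quaternions to
`Sp(m)`. -/
def spRefl (u : Fin m → ℍ[ℝ]) (hu : star u ⬝ᵥ u = 1) : unitary ℍ[ℝ] →* Sp m where
  toFun q := ⟨quatRefl u (q - 1), by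
    have h := q.2
    rw [Unitary.mem_iff] at h
    apply quatRefl_mem
    · rw [hu, star_sub, star_one, mul_one, sub_mul, mul_sub, h.1]; simp
    · rw [hu, star_sub, star_one, mul_one, sub_mul, mul_sub, h.2]; simp⟩
  map_one' := Subtype.ext (by simp [quatRefl_zero])
  map_mul' p q := Subtype.ext (by
    refine Eq.trans (congrArg (quatRefl u) ?_) (quatRefl_mul u _ _).symm
    rw [hu]
    rw [Submonoid.coe_mul]
    noncomm_ring)

theorem coe_spRefl (u : Fin m → ℍ[ℝ]) (hu : star u ⬝ᵥ u = 1) (q : unitary ℍ[ℝ]) :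
    (spRefl u hu q : Matrix (Fin m) (Fin m) ℍ[ℝ]) = quatRefl u (q - 1) := rfl

theorem star_dotProduct_self (w : Fin m → ℍ[ℝ]) :
    star w ⬝ᵥ w = ((∑ i, Quaternion.normSq (w i) : ℝ) : ℍ[ℝ]) := by
  rw [dotProduct, ← Quaternion.algebraMap_def, map_sum]
  exact Finset.sum_congr rfl fun i _ => Quaternion.star_mul_self _

theorem eq_zero_of_star_dotProduct_self {w : Fin m → ℍ[ℝ]} (h : star w ⬝ᵥ w = 0) : w = 0 := by
  rw [star_dotProduct_self] at h
  have h1 : (∑ i, Quaternion.normSq (w i) : ℝ) = 0 := Quaternion.coe_injective h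
  rw [Finset.sum_eq_zero_iff_of_nonneg fun i _ => Quaternion.normSq_nonneg] at h1
  funext i
  exact Quaternion.normSq_eq_zero.mp (h1 i (Finset.mem_univ i))

theorem star_dotProduct_star (x y : Fin m → ℍ[ℝ]) : star (star x ⬝ᵥ y) = star y ⬝ᵥ x := by
  simp [dotProduct]

/-- With t = 1 - y*x this reads |x - y|² = t + t*, which is exactly the condition for 1 - (x - y)
t⁻¹ (x - y)* to be unitary. -/
theorem star_sub_dotProduct_sub {x y : Fin m → ℍ[ℝ]} (hx : star x ⬝ᵥ x = 1)
    (hy : star y ⬝ᵥ y = 1) :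
    star (x - y) ⬝ᵥ (x - y) = (1 - star y ⬝ᵥ x) + star (1 - star y ⬝ᵥ x) := by
  rw [star_sub x y, sub_dotProduct, dotProduct_sub, dotProduct_sub, hx, hy, star_sub, star_one,
    star_dotProduct_star]
  abel

theorem one_sub_ne_zero {x y : Fin m → ℍ[ℝ]} (hx : star x ⬝ᵥ x = 1)
    (hy : star y ⬝ᵥ y = 1) (h : x ≠ y) : 1 - star y ⬝ᵥ x ≠ 0 := by
  intro h0
  have := star_sub_dotProduct_sub hx hy
  rw [h0, star_zero, add_zero] at this
  exact h (sub_eq_zero.mp (eq_zero_of_star_dotProduct_self this))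

/-- The quaternionic reflection taking `x` to `y`, for unit vectors `x ≠ y`. -/
def reflTo (x y : Fin m → ℍ[ℝ]) : Matrix (Fin m) (Fin m) ℍ[ℝ] :=
  quatRefl (x - y) (-(1 - star y ⬝ᵥ x)⁻¹)

theorem reflTo_mem {x y : Fin m → ℍ[ℝ]} (hx : star x ⬝ᵥ x = 1)
    (hy : star y ⬝ᵥ y = 1) (h : x ≠ y) : reflTo x y ∈ unitary (Matrix (Fin m) (Fin m) ℍ[ℝ]) := by
  have ht := one_sub_ne_zero hx hy h
  have ht' : star (1 - star y ⬝ᵥ x) ≠ 0 := fun h0 => ht (by simpa using congrArg star h0)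
  apply quatRefl_mem
  · rw [star_sub_dotProduct_sub hx hy, star_neg, star_inv₀, neg_mul, neg_mul_neg, mul_add, add_mul,
      inv_mul_cancel₀ ht', one_mul, mul_assoc, mul_inv_cancel₀ ht, mul_one]
    abel
  · rw [star_sub_dotProduct_sub hx hy, star_neg, star_inv₀, neg_mul, neg_mul_neg, mul_add, add_mul,
      inv_mul_cancel₀ ht, one_mul, mul_assoc, mul_inv_cancel₀ ht', mul_one]
    abel

theorem reflTo_mulVec {x y : Fin m → ℍ[ℝ]} (hx : star x ⬝ᵥ x = 1)
    (hy : star y ⬝ᵥ y = 1) (h : x ≠ y) : reflTo x y *ᵥ x = y := by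
  have ht := one_sub_ne_zero hx hy h
  rw [reflTo, quatRefl_mulVec, star_sub x y, sub_dotProduct, hx, neg_mul, inv_mul_cancel₀ ht]
  funext a
  simp

theorem coeComplex_mem_unitary (z : Circle) : ((z : ℂ) : ℍ[ℝ]) ∈ unitary ℍ[ℝ] := by
  have h := Circle.re_sq_add_im_sq z
  rw [Unitary.mem_iff]
  constructor <;> ext <;> simp <;> linarith

/-- The embedding of `U(1)` into the unit quaternions. -/
def circleQuat : Circle →* unitary ℍ[ℝ] where
  toFun z := ⟨((z : ℂ) : ℍ[ℝ]), coeComplex_mem_unitary z⟩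
  map_one' := Subtype.ext (by simp)
  map_mul' z w := Subtype.ext (by simp)

theorem coe_circleQuat (z : Circle) : (circleQuat z : ℍ[ℝ]) = ((z : ℂ) : ℍ[ℝ]) := rfl

theorem unitary_quat_norm (q : unitary ℍ[ℝ]) : ‖(q : ℍ[ℝ])‖ = 1 := by
  have h := (Unitary.mem_iff.mp q.2).1
  rw [Quaternion.star_mul_self] at h
  have h1 : Quaternion.normSq (q : ℍ[ℝ]) = 1 := Quaternion.coe_injective h
  rw [Quaternion.normSq_eq_norm_mul_self] at h1
  nlinarith [norm_nonneg (q : ℍ[ℝ])]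

theorem mem_unitary_of_norm {q : ℍ[ℝ]} (h : ‖q‖ = 1) : q ∈ unitary ℍ[ℝ] := by
  rw [Unitary.mem_iff, Quaternion.star_mul_self, Quaternion.self_mul_star,
    Quaternion.normSq_eq_norm_mul_self, h]
  simp

/-- Every unit quaternion is conjugate to a complex number. -/
theorem exists_conj_circle (q : unitary ℍ[ℝ]) :
    ∃ (p : unitary ℍ[ℝ]) (z : Circle), q = p * circleQuat z * p⁻¹ := by
  obtain ⟨P, w, hP, hw⟩ : ∃ (P : ℍ[ℝ]) (w : ℂ), P ≠ 0 ∧ (q : ℍ[ℝ]) * P = P * (w : ℍ[ℝ]) := by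
    set a := (q : ℍ[ℝ]).re
    set b := (q : ℍ[ℝ]).imI
    set c := (q : ℍ[ℝ]).imJ
    set d := (q : ℍ[ℝ]).imK
    by_cases h : c = 0 ∧ d = 0
    · refine ⟨1, ⟨a, b⟩, one_ne_zero, ?_⟩
      obtain ⟨h1, h2⟩ := h
      ext
      · simp [a]
      · simp [b]
      · simpa using h1
      · simpa using h2
    · set r := Real.sqrt (b ^ 2 + c ^ 2 + d ^ 2)
      have hr : r ^ 2 = b ^ 2 + c ^ 2 + d ^ 2 := Real.sq_sqrt (by positivity)
      -- This P is r - v i, where v is the imaginary part of q and r = |v|. From v² = -r² one gets v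
      -- P = r v + r² i = P (r i). It can vanish only when v is already complex, whence the case
      -- distinction.
      refine ⟨((r + b : ℝ) : ℍ[ℝ]) + ((-d) • quatJ + c • quatK), ⟨a, r⟩, ?_, ?_⟩
      · intro h0
        apply h
        constructor
        · simpa using congrArg QuaternionAlgebra.imK h0
        · simpa using congrArg QuaternionAlgebra.imJ h0
      · ext
        · simp only [a, b, c, d] at hr ⊢
          simp
          ring
        · simp only [a, b, c, d] at hr ⊢
          simp
          linear_combination -hr
        · simp only [a, b, c, d]
          simp
          ring
        · simp only [a, b, c, d]
          simp
          ring
  have hn : ‖P‖ ≠ 0 := norm_ne_zero_iff.mpr hP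
  have hp : ‖(‖P‖⁻¹ • P)‖ = 1 := by rw [norm_smul, norm_inv, norm_norm, inv_mul_cancel₀ hn]
  have hwn : ‖(w : ℍ[ℝ])‖ = 1 := by
    have := congrArg norm hw
    rw [norm_mul, norm_mul, unitary_quat_norm, one_mul] at this
    exact (mul_left_cancel₀ hn (by rw [mul_one]; exact this)).symm
  have hwc : w ∈ Submonoid.unitSphere ℂ := by
    rw [Submonoid.unitSphere, Submonoid.mem_mk, Subsemigroup.mem_mk, mem_sphere_zero_iff_norm,
      ← sq_eq_sq₀ (norm_nonneg _) zero_le_one, Complex.sq_norm, Complex.normSq_apply]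
    have h := congrArg (fun t => t * t) hwn
    simp only [← Quaternion.normSq_eq_norm_mul_self, Quaternion.normSq_def',
      Quaternion.re_coeComplex, Quaternion.imI_coeComplex, Quaternion.imJ_coeComplex,
      Quaternion.imK_coeComplex] at h
    linarith
  refine ⟨⟨‖P‖⁻¹ • P, mem_unitary_of_norm hp⟩, ⟨w, hwc⟩, ?_⟩
  rw [eq_mul_inv_iff_mul_eq]
  refine Subtype.ext ?_
  rw [Submonoid.coe_mul, Submonoid.coe_mul]
  change (q : ℍ[ℝ]) * (‖P‖⁻¹ • P) = (‖P‖⁻¹ • P) * (w : ℍ[ℝ])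
  rw [mul_smul_comm, hw, smul_mul_assoc]

theorem spRefl_conj {u : Fin m → ℍ[ℝ]} (hu : star u ⬝ᵥ u = 1) (p q : unitary ℍ[ℝ])
    (hup : star (fun a => u a * (p : ℍ[ℝ])) ⬝ᵥ (fun a => u a * (p : ℍ[ℝ])) = 1) :
    spRefl u hu (p * q * p⁻¹) = spRefl (fun a => u a * (p : ℍ[ℝ])) hup q := by
  refine Subtype.ext ?_
  rw [coe_spRefl, coe_spRefl, quatRefl_smul_right]
  congr 1
  have h := (Unitary.mem_iff.mp p.2).2
  change (p : ℍ[ℝ]) * q * star (p : ℍ[ℝ]) - 1 = _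
  rw [mul_sub, sub_mul, mul_one, h]

theorem unit_smul_right {u : Fin m → ℍ[ℝ]} (hu : star u ⬝ᵥ u = 1) (p : unitary ℍ[ℝ]) :
    star (fun a => u a * (p : ℍ[ℝ])) ⬝ᵥ (fun a => u a * (p : ℍ[ℝ])) = 1 := by
  have : star (fun a => u a * (p : ℍ[ℝ])) ⬝ᵥ (fun a => u a * (p : ℍ[ℝ])) =
      star (p : ℍ[ℝ]) * (star u ⬝ᵥ u) * p := by
    simp only [dotProduct, Pi.star_apply, star_mul, Finset.mul_sum, Finset.sum_mul, mul_assoc]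
  rw [this, hu, mul_one]
  exact (Unitary.mem_iff.mp p.2).1

/-- Let t = 1 - y*x and s = |x - y|² = t + t*. Normalising x - y turns the parameter of the
reflection into 1 - s t⁻¹ = -t* t⁻¹, a unit quaternion. Multiplying the unit vector on the right by
a unit quaternion conjugates this parameter into ℂ and leaves zero coordinates zero. -/
theorem reflTo_eq_spRefl {x y : Fin m → ℍ[ℝ]} (hx : star x ⬝ᵥ x = 1)
    (hy : star y ⬝ᵥ y = 1) (h : x ≠ y) : ∃ (u : Fin m → ℍ[ℝ]) (hu : star u ⬝ᵥ u = 1) (z : Circle),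
      (∀ a, x a = y a → u a = 0) ∧
      reflTo x y = (spRefl u hu (circleQuat z) : Matrix (Fin m) (Fin m) ℍ[ℝ]) := by
  set s : ℝ := ∑ i, Quaternion.normSq ((x - y) i) with hs
  have hw : star (x - y) ⬝ᵥ (x - y) = (s : ℍ[ℝ]) := star_dotProduct_self _
  have hs0 : 0 < s := by
    refine lt_of_le_of_ne (Finset.sum_nonneg fun i _ => Quaternion.normSq_nonneg) fun h0 => h ?_
    rw [← h0, Quaternion.coe_zero] at hw
    exact sub_eq_zero.mp (eq_zero_of_star_dotProduct_self hw)
  set t : ℝ := Real.sqrt s with ht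
  have ht0 : t ≠ 0 := (Real.sqrt_pos.mpr hs0).ne'
  have ht2 : t * t = s := Real.mul_self_sqrt hs0.le
  set c : ℍ[ℝ] := -(1 - star y ⬝ᵥ x)⁻¹ with hc
  set v : Fin m → ℍ[ℝ] := fun a => (x - y) a * ((t⁻¹ : ℝ) : ℍ[ℝ]) with hv
  have hv1 : star v ⬝ᵥ v = 1 := by
    have : star v ⬝ᵥ v = ((t⁻¹ : ℝ) : ℍ[ℝ]) * (star (x - y) ⬝ᵥ (x - y)) * ((t⁻¹ : ℝ) : ℍ[ℝ]) := by
      simp only [hv, dotProduct, Pi.star_apply, star_mul, Finset.mul_sum, Finset.sum_mul, mul_assoc,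
        Quaternion.star_coe]
    rw [this, hw, ← Quaternion.coe_mul, ← Quaternion.coe_mul, ← ht2]
    rw [← Quaternion.coe_one]
    congr 1
    field_simp
  have hrefl : reflTo x y = quatRefl v (s * c) := by
    rw [hv, quatRefl_smul_right, reflTo, ← hc, Quaternion.star_coe, ← mul_assoc,
      ← Quaternion.coe_mul, ← Quaternion.coe_commutes, ← mul_assoc, ← Quaternion.coe_mul, ← ht2]
    have : t⁻¹ * (t⁻¹ * (t * t)) = 1 := by field_simp
    rw [this]
    simp
  have hT := one_sub_ne_zero hx hy h
  have hT' : star (1 - star y ⬝ᵥ x) ≠ 0 := fun h0 => hT (by simpa using congrArg star h0)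
  have hq : (1 + s * c : ℍ[ℝ]) ∈ unitary ℍ[ℝ] := by
    have hsc : (1 + s * c : ℍ[ℝ]) = -(star (1 - star y ⬝ᵥ x) * (1 - star y ⬝ᵥ x)⁻¹) := by
      rw [← hw, star_sub_dotProduct_sub hx hy, hc, mul_neg, add_mul, mul_inv_cancel₀ hT]
      abel
    rw [hsc]
    apply mem_unitary_of_norm
    rw [norm_neg, norm_mul, norm_inv, norm_star]
    exact mul_inv_cancel₀ (norm_ne_zero_iff.mpr hT)
  obtain ⟨p, z, hpz⟩ := exists_conj_circle ⟨_, hq⟩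
  refine ⟨fun a => v a * (p : ℍ[ℝ]), unit_smul_right hv1 p, z, ?_, ?_⟩
  · intro a ha
    simp [hv, ha]
  · rw [← spRefl_conj hv1, ← hpz, coe_spRefl, hrefl]
    simp

/-- The elements of `Sp(m)` fixing a set of basis vectors are generated by reflections. -/
theorem fix_induction (p : Sp m → Prop) (h1 : p 1) (k : ℕ) : ∀ (T : Finset (Fin m)),
    Tᶜ.card = k →
    (∀ (u : Fin m → ℍ[ℝ]) (hu : star u ⬝ᵥ u = 1), (∀ j ∈ T, u j = 0) → ∀ (z : Circle) (A : Sp m),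
      p A → p (spRefl u hu (circleQuat z) * A)) →
    ∀ A : Sp m, (∀ j ∈ T, (A : Matrix (Fin m) (Fin m) ℍ[ℝ]) *ᵥ Pi.single j 1 = Pi.single j 1) →
      p A := by
  induction k with
  | zero =>
    intro T hT _ A hA
    rw [Finset.card_eq_zero, Finset.compl_eq_empty_iff] at hT
    subst hT
    have : A = 1 := Subtype.ext (by
      ext1 i j
      have := congrFun (hA j (Finset.mem_univ j)) i
      rw [mulVec_single_one] at this
      rw [← Matrix.col_apply (A : Matrix (Fin m) (Fin m) ℍ[ℝ]), this, Submonoid.coe_one, one_apply, Pi.single_apply])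
    rw [this]
    exact h1
  | succ k ih =>
    intro T hT hmul A hA
    obtain ⟨l, hl⟩ : Tᶜ.Nonempty := Finset.card_pos.mp (by omega)
    rw [Finset.mem_compl] at hl
    have hcard : (insert l T)ᶜ.card = k := by
      rw [Finset.card_compl, Finset.card_insert_of_notMem hl]
      rw [Finset.card_compl] at hT
      omega
    have hmul' : ∀ (u : Fin m → ℍ[ℝ]) (hu : star u ⬝ᵥ u = 1), (∀ j ∈ insert l T, u j = 0) →
        ∀ (z : Circle) (A : Sp m), p A → p (spRefl u hu (circleQuat z) * A) :=
      fun u hu h => hmul u hu fun j hj => h j (Finset.mem_insert_of_mem hj)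
    set x : Fin m → ℍ[ℝ] := Pi.single l 1 with hx
    set y : Fin m → ℍ[ℝ] := (A : Matrix (Fin m) (Fin m) ℍ[ℝ]) *ᵥ x with hy
    by_cases hxy : x = y
    · refine ih _ hcard hmul' A fun j hj => ?_
      rcases Finset.mem_insert.mp hj with rfl | hj
      · exact hxy.symm
      · exact hA j hj
    · have hx1 : star x ⬝ᵥ x = 1 := by simp [hx]
      have hAd : ∀ v w : Fin m → ℍ[ℝ], star ((A : Matrix (Fin m) (Fin m) ℍ[ℝ]) *ᵥ v) ⬝ᵥ
          ((A : Matrix (Fin m) (Fin m) ℍ[ℝ]) *ᵥ w) = star v ⬝ᵥ w := by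
        intro v w
        rw [star_mulVec, dotProduct_mulVec, vecMul_vecMul, ← star_eq_conjTranspose,
          Unitary.coe_star_mul_self, vecMul_one]
      have hy1 : star y ⬝ᵥ y = 1 := by rw [hy, hAd, hx1]
      obtain ⟨u, hu, z, hu0, hR⟩ := reflTo_eq_spRefl hx1 hy1 hxy
      -- The j-th entry of A e_l is ⟨e_j, A e_l⟩ = ⟨A e_j, A e_l⟩ = ⟨e_j, e_l⟩ = 0, so the
      -- reflection does not involve the vectors that are already fixed.
      have hsupp : ∀ j ∈ T, u j = 0 := by
        intro j hj
        apply hu0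
        have hjl : j ≠ l := fun h => hl (h ▸ hj)
        have h2 := hAd (Pi.single j 1) x
        rw [hA j hj, ← hy] at h2
        simpa [hx, hjl] using h2.symm
      have hfix : ∀ w : Circle, ∀ j ∈ T, (spRefl u hu (circleQuat w) :
          Matrix (Fin m) (Fin m) ℍ[ℝ]) *ᵥ Pi.single j 1 = Pi.single j 1 := by
        intro w j hj
        rw [coe_spRefl, quatRefl_mulVec]
        funext a
        simp [hsupp j hj]
      have hinv : spRefl u hu (circleQuat z) * spRefl u hu (circleQuat z⁻¹) = 1 := by
        rw [← map_mul, ← map_mul, mul_inv_cancel, map_one, map_one]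
      have hinv' : spRefl u hu (circleQuat z⁻¹) * spRefl u hu (circleQuat z) = 1 := by
        rw [← map_mul, ← map_mul, inv_mul_cancel, map_one, map_one]
      -- Removing the reflection that takes e_l to A e_l leaves an element that fixes e_l as well as
      -- the vectors indexed by T.
      have hA' : A = spRefl u hu (circleQuat z) * (spRefl u hu (circleQuat z⁻¹) * A) := by
        rw [← mul_assoc, hinv, one_mul]
      rw [hA']
      refine hmul u hu hsupp z _ (ih _ hcard hmul' _ fun j hj => ?_)
      rw [Submonoid.coe_mul, ← mulVec_mulVec]
      rcases Finset.mem_insert.mp hj with rfl | hj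
      · rw [← hx, ← hy, ← reflTo_mulVec hx1 hy1 hxy, hR, mulVec_mulVec, ← Submonoid.coe_mul, hinv',
          Submonoid.coe_one, one_mulVec]
      · rw [hA j hj, hfix _ j hj]

end Reflections

/-! ### The Fock representation -/

section Fock

open Matrix

variable {m : ℕ}

/-- The complex vector space `ℂ²ᵐ`, isomorphic to `ℍᵐ` with `i` acting by right multiplication. -/
abbrev FockBase (m : ℕ) : Type := Fin m → ℂ × ℂ

/-- The Fock space. -/
abbrev Fock (m : ℕ) : Type := ExteriorAlgebra ℂ (FockBase m)

/-- The identification `q = α + β j ↦ (α, conj β)`. -/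
def quatCoord : ℍ[ℝ] →ₗ[ℝ] ℂ × ℂ where
  toFun q := (⟨q.re, q.imI⟩, ⟨q.imJ, -q.imK⟩)
  map_add' p q := by
    refine Prod.ext (Complex.ext ?_ ?_) (Complex.ext ?_ ?_) <;> simp
    ring
  map_smul' c q := by
    refine Prod.ext (Complex.ext ?_ ?_) (Complex.ext ?_ ?_) <;> simp

theorem quatCoord_apply (q : ℍ[ℝ]) : quatCoord q = (⟨q.re, q.imI⟩, ⟨q.imJ, -q.imK⟩) := rfl

/-- Since β j c = β c̄ j, the conjugate in the second coordinate is what makes right multiplication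
by ℂ complex linear. -/
theorem quatCoord_mul_coe (q : ℍ[ℝ]) (c : ℂ) : quatCoord (q * (c : ℍ[ℝ])) = c • quatCoord q := by
  rw [quatCoord_apply, quatCoord_apply]
  refine Prod.ext (Complex.ext ?_ ?_) (Complex.ext ?_ ?_) <;> simp <;> ring

/-- The identification of `ℍᵐ` with `ℂ²ᵐ`. -/
def fockCoord (m : ℕ) : (Fin m → ℍ[ℝ]) →ₗ[ℝ] FockBase m where
  toFun v i := quatCoord (v i)
  map_add' v w := by funext i; exact map_add quatCoord _ _
  map_smul' c v := by funext i; exact map_smul quatCoord _ _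

theorem fockCoord_apply (v : Fin m → ℍ[ℝ]) (i : Fin m) : fockCoord m v i = quatCoord (v i) := rfl

theorem fockCoord_mul_coe (v : Fin m → ℍ[ℝ]) (c : ℂ) :
    fockCoord m (fun i => v i * (c : ℍ[ℝ])) = c • fockCoord m v := by
  funext i
  exact quatCoord_mul_coe _ _

/-- The complex part of the quaternionic scalar product of `v` and `w`. -/
def hermDot (v w : Fin m → ℍ[ℝ]) : ℂ := ⟨(star v ⬝ᵥ w).re, (star v ⬝ᵥ w).imI⟩

/-- The functional on `ℂ²ᵐ` that is the hermitian product with `v`. -/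
def fockDual (v : Fin m → ℍ[ℝ]) : Module.Dual ℂ (FockBase m) where
  toFun w := ∑ i, (star (quatCoord (v i)).1 * (w i).1 + star (quatCoord (v i)).2 * (w i).2)
  map_add' w x := by
    rw [← Finset.sum_add_distrib]
    refine Finset.sum_congr rfl fun i _ => ?_
    simp only [Pi.add_apply, Prod.fst_add, Prod.snd_add]
    ring
  map_smul' c w := by
    simp only [Pi.smul_apply, Prod.smul_fst, Prod.smul_snd, smul_eq_mul, RingHom.id_apply,
      Finset.mul_sum]
    refine Finset.sum_congr rfl fun i _ => ?_
    ring

theorem fockDual_apply (v : Fin m → ℍ[ℝ]) (w : FockBase m) : fockDual v w =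
    ∑ i, (star (quatCoord (v i)).1 * (w i).1 + star (quatCoord (v i)).2 * (w i).2) := rfl

theorem fockDual_add (v w : Fin m → ℍ[ℝ]) : fockDual (v + w) = fockDual v + fockDual w := by
  refine LinearMap.ext fun x => ?_
  rw [LinearMap.add_apply, fockDual_apply, fockDual_apply, fockDual_apply,
    ← Finset.sum_add_distrib]
  refine Finset.sum_congr rfl fun i _ => ?_
  simp only [Pi.add_apply, map_add, Prod.fst_add, Prod.snd_add, star_add]
  ring

theorem fockDual_mul_coe (v : Fin m → ℍ[ℝ]) (c : ℂ) :
    fockDual (fun i => v i * (c : ℍ[ℝ])) = star c • fockDual v := by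
  refine LinearMap.ext fun x => ?_
  rw [LinearMap.smul_apply, fockDual_apply, fockDual_apply, smul_eq_mul, Finset.mul_sum]
  refine Finset.sum_congr rfl fun i _ => ?_
  rw [quatCoord_mul_coe, Prod.smul_fst, Prod.smul_snd, smul_eq_mul, smul_eq_mul, star_mul, star_mul]
  ring

theorem quat_sum_re (f : Fin m → ℍ[ℝ]) : (∑ i, f i).re = ∑ i, (f i).re := by
  induction (Finset.univ : Finset (Fin m)) using Finset.induction_on with
  | empty => simp
  | insert a s ha ih => rw [Finset.sum_insert ha, Finset.sum_insert ha, Quaternion.re_add, ih]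

theorem quat_sum_imI (f : Fin m → ℍ[ℝ]) : (∑ i, f i).imI = ∑ i, (f i).imI := by
  induction (Finset.univ : Finset (Fin m)) using Finset.induction_on with
  | empty => simp
  | insert a s ha ih => rw [Finset.sum_insert ha, Finset.sum_insert ha, Quaternion.imI_add, ih]

theorem fockDual_fockCoord (v w : Fin m → ℍ[ℝ]) :
    fockDual v (fockCoord m w) = hermDot v w := by
  rw [fockDual_apply]
  apply Complex.ext
  · rw [Complex.re_sum]
    simp only [hermDot, dotProduct, quat_sum_re]
    refine Finset.sum_congr rfl fun i _ => ?_
    simp [fockCoord_apply, quatCoord_apply]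
    ring
  · rw [Complex.im_sum]
    simp only [hermDot, dotProduct, quat_sum_imI]
    refine Finset.sum_congr rfl fun i _ => ?_
    simp [fockCoord_apply, quatCoord_apply]
    ring

theorem hermDot_self (v : Fin m → ℍ[ℝ]) : hermDot v v = ((star v ⬝ᵥ v).re : ℂ) := by
  apply Complex.ext
  · rfl
  · change (star v ⬝ᵥ v).imI = 0
    rw [star_dotProduct_self, Quaternion.imI_coe]

/-- The Clifford action of `v ∈ ℍᵐ` on the Fock space: exterior multiplication minus
contraction. -/
def fockVec (m : ℕ) : (Fin m → ℍ[ℝ]) →ₗ[ℝ] Module.End ℂ (Fock m) where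
  toFun v := LinearMap.mulLeft ℂ (ExteriorAlgebra.ι ℂ (fockCoord m v)) -
    contractLeft (Q := (0 : QuadraticForm ℂ (FockBase m))) (fockDual v)
  map_add' v w := by
    refine LinearMap.ext fun x => ?_
    simp only [map_add, fockDual_add, LinearMap.sub_apply, LinearMap.add_apply,
      LinearMap.mulLeft_apply, add_mul]
    abel
  map_smul' c v := by
    have h : fockDual (c • v) = (c : ℂ) • fockDual v := by
      have := fockDual_mul_coe v (c : ℂ)
      rw [show star (c : ℂ) = c from Complex.conj_ofReal c] at this
      rw [← this]
      congr 1
      funext i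
      rw [Quaternion.coeComplex_coe, Pi.smul_apply, ← Quaternion.coe_commutes,
        Quaternion.coe_mul_eq_smul]
    have h' : fockCoord m (c • v) = (c : ℂ) • fockCoord m v := by
      rw [map_smul]; rfl
    refine LinearMap.ext fun x => ?_
    rw [h, h']
    simp only [map_smul, LinearMap.sub_apply, LinearMap.smul_apply, LinearMap.mulLeft_apply,
      smul_mul_assoc, RingHom.id_apply, ← smul_sub]
    rfl

theorem fockVec_apply (v : Fin m → ℍ[ℝ]) (x : Fock m) :
    fockVec m v x = ExteriorAlgebra.ι ℂ (fockCoord m v) * x -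
      contractLeft (Q := (0 : QuadraticForm ℂ (FockBase m))) (fockDual v) x := rfl

/-- Exterior multiplication and contraction both square to zero, and because contraction is an
antiderivation, their anticommutator is the scalar ⟨v, v⟩. -/
theorem fockVec_mul_self (v : Fin m → ℍ[ℝ]) :
    fockVec m v * fockVec m v = algebraMap ℝ _ (-(star v ⬝ᵥ v).re) := by
  refine LinearMap.ext fun x => ?_
  have h := contractLeft_ι_mul (Q := (0 : QuadraticForm ℂ (FockBase m))) (fockDual v)
    (fockCoord m v) x
  have h0 : ExteriorAlgebra.ι ℂ (fockCoord m v) * ExteriorAlgebra.ι ℂ (fockCoord m v) = 0 :=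
    ExteriorAlgebra.ι_sq_zero _
  rw [fockDual_fockCoord, hermDot_self] at h
  rw [Module.End.mul_apply, fockVec_apply, fockVec_apply, mul_sub, map_sub,
    contractLeft_contractLeft, ← mul_assoc, h0, zero_mul]
  erw [h]
  rw [Module.algebraMap_end_apply]
  have h2 : ((((star v ⬝ᵥ v).re : ℝ) : ℂ) • x : Fock m) = (star v ⬝ᵥ v).re • x := rfl
  rw [h2, neg_smul, zero_sub, sub_zero]
  refine (neg_sub_left _ _).trans ?_
  simp
  rfl

theorem fockVec_one (v : Fin m → ℍ[ℝ]) : fockVec m v 1 = ExteriorAlgebra.ι ℂ (fockCoord m v) := by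
  rw [fockVec_apply, mul_one, contractLeft_one, sub_zero]

end Fock

/-! ### Lifts to Spin(4n+3) normalised by their action on the vacuum. -/

section Lifts

open Matrix

variable {n : ℕ}

/-- `u` is an isometry of `ℝ^{4n+3}` onto the orthogonal complement of the last basis vector. -/
structure IsIsoFrame (u : (Fin (4 * n + 3) → ℝ) →ₗ[ℝ] (Fin (n + 1) → ℍ[ℝ])) : Prop where
  norm_sq : ∀ v, (star (u v) ⬝ᵥ u v).re = v ⬝ᵥ v
  mem_range : ∀ w, (∃ v, u v = w) ↔ (w (Fin.last n)).re = 0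

variable {u : (Fin (4 * n + 3) → ℝ) →ₗ[ℝ] (Fin (n + 1) → ℍ[ℝ])}

theorem re_dotProduct_comm {m : ℕ} (v w : Fin m → ℍ[ℝ]) :
    (star v ⬝ᵥ w).re = (star w ⬝ᵥ v).re := by
  rw [← star_dotProduct_star v w, Quaternion.re_star]

theorem IsIsoFrame.dot (hu : IsIsoFrame u) (v w : Fin (4 * n + 3) → ℝ) :
    (star (u v) ⬝ᵥ u w).re = v ⬝ᵥ w := by
  have h := hu.norm_sq (v + w)
  rw [map_add, star_add, add_dotProduct, dotProduct_add, dotProduct_add, add_dotProduct,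
    dotProduct_add, dotProduct_add, Quaternion.re_add, Quaternion.re_add, Quaternion.re_add,
    hu.norm_sq, hu.norm_sq, re_dotProduct_comm (u w), dotProduct_comm w v] at h
  linarith

theorem IsIsoFrame.injective (hu : IsIsoFrame u) : Function.Injective u := by
  rw [injective_iff_map_eq_zero]
  intro v hv
  have h := hu.norm_sq v
  rw [hv, star_zero, zero_dotProduct, Quaternion.re_zero] at h
  exact dotProduct_self_eq_zero.mp h.symm

/-- The Fock representation of `Cl(4n+3)` attached to a frame. -/
def fockRep (hu : IsIsoFrame u) : Cl (4 * n + 3) →ₐ[ℝ] Module.End ℂ (Fock (n + 1)) :=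
  CliffordAlgebra.lift (stdForm (4 * n + 3)) ⟨fockVec (n + 1) ∘ₗ u, fun v => by
    rw [LinearMap.comp_apply, fockVec_mul_self, hu.norm_sq, stdForm_apply]⟩

theorem fockRep_ι (hu : IsIsoFrame u) (v : Fin (4 * n + 3) → ℝ) :
    fockRep hu (ι (stdForm (4 * n + 3)) v) = fockVec (n + 1) (u v) :=
  lift_ι_apply _ _ _

/-- `x ∈ Spin(4n+3)` covers the transformation `g` of `ℍⁿ⁺¹` in the frame `u`, and acts on the
vacuum of the Fock space by `χ`. -/
def IsLift (hu : IsIsoFrame u) (g : (Fin (n + 1) → ℍ[ℝ]) → (Fin (n + 1) → ℍ[ℝ])) (χ : ℂ)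
    (x : Spin (4 * n + 3)) : Prop :=
  (∀ v, u (spinRot (4 * n + 3) x v) = g (u v)) ∧ fockRep hu x 1 = χ • (1 : Fock (n + 1))

theorem IsLift.mul {hu : IsIsoFrame u} {g h : (Fin (n + 1) → ℍ[ℝ]) → (Fin (n + 1) → ℍ[ℝ])}
    {χ ψ : ℂ} {x y : Spin (4 * n + 3)} (hx : IsLift hu g χ x) (hy : IsLift hu h ψ y) :
    IsLift hu (fun v => g (h v)) (χ * ψ) (x * y) := by
  refine ⟨fun v => ?_, ?_⟩
  · rw [map_mul, Module.End.mul_apply, hx.1, hy.1]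
  · rw [Submonoid.coe_mul, map_mul, Module.End.mul_apply, hy.2, map_smul, hx.2, smul_smul, mul_comm]

theorem IsLift.one (hu : IsIsoFrame u) : IsLift hu (fun v => v) 1 1 :=
  ⟨fun v => by rw [map_one]; rfl, by rw [Submonoid.coe_one, map_one (fockRep hu), one_smul]; rfl⟩

theorem IsLift.congr {hu : IsIsoFrame u} {g h : (Fin (n + 1) → ℍ[ℝ]) → (Fin (n + 1) → ℍ[ℝ])}
    {χ ψ : ℂ} {x : Spin (4 * n + 3)} (hx : IsLift hu g χ x) (hg : ∀ v, g v = h v) (hχ : χ = ψ) :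
    IsLift hu h ψ x := by
  subst hχ
  exact ⟨fun v => (hx.1 v).trans (hg _), hx.2⟩

theorem fock_one_ne_zero {m : ℕ} : (1 : Fock m) ≠ 0 := one_ne_zero

/-- Two lifts differ by a sign, and -1 acts as -1 on the vacuum, so a nonzero eigenvalue selects the
sign. This turns lifts of single elements into a homomorphism. -/
theorem IsLift.unique {hu : IsIsoFrame u} {g : (Fin (n + 1) → ℍ[ℝ]) → (Fin (n + 1) → ℍ[ℝ])}
    {χ : ℂ} (hχ : χ ≠ 0) {x y : Spin (4 * n + 3)} (hx : IsLift hu g χ x) (hy : IsLift hu g χ y) :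
    x = y := by
  have h : spinRot (4 * n + 3) x = spinRot (4 * n + 3) y :=
    LinearMap.ext fun v => hu.injective ((hx.1 v).trans (hy.1 v).symm)
  rcases spin_eq_or_eq_neg h with h | h
  · exact Subtype.ext h
  · exfalso
    have h1 := hx.2
    rw [h, map_neg, LinearMap.neg_apply, hy.2] at h1
    have h2 : χ • (1 : Fock (n + 1)) = 0 := eq_zero_of_eq_neg_self h1.symm
    exact (smul_ne_zero hχ fock_one_ne_zero) h2

/-- The complex reflection along `a` with eigenvalue `w`. -/
def complexRefl (a : Fin (n + 1) → ℍ[ℝ]) (w : ℂ) (v : Fin (n + 1) → ℍ[ℝ]) : Fin (n + 1) → ℍ[ℝ] :=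
  fun i => v i + a i * (((w - 1) * hermDot a v : ℂ) : ℍ[ℝ])

theorem unit_mul_unit_conj {N : ℕ} {a b : Fin N → ℝ} (ha : a ⬝ᵥ a = 1) (hb : b ⬝ᵥ b = 1)
    (v : Fin N → ℝ) : ι (stdForm N) a * ι (stdForm N) b * ι (stdForm N) v =
      ι (stdForm N) ((2 * (a ⬝ᵥ ((2 * (b ⬝ᵥ v)) • b - v))) • a - ((2 * (b ⬝ᵥ v)) • b - v)) *
        (ι (stdForm N) a * ι (stdForm N) b) := by
  rw [mul_assoc, ι_mul_ι_of_unit hb, ← mul_assoc, ι_mul_ι_of_unit ha, mul_assoc]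

/-- The hypotheses on the last coordinate make a and a i tangent vectors. The complex reflection
rotates their plane by twice the argument of ζ, so it is covered by a product of two unit vectors of
that plane. Its vacuum eigenvalue is an inverse square root of its complex determinant ζ². -/
theorem exists_lift_complexRefl (hu : IsIsoFrame u) {a : Fin (n + 1) → ℍ[ℝ]}
    (ha : star a ⬝ᵥ a = 1) (h0 : (a (Fin.last n)).re = 0) (h1 : (a (Fin.last n)).imI = 0)
    (ζ : Circle) : ∃ x, IsLift hu (complexRefl a ((ζ : ℂ) ^ 2)) (star (ζ : ℂ)) x := by
  obtain ⟨a', ha'⟩ := (hu.mem_range a).mpr h0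
  obtain ⟨b', hb'⟩ := (hu.mem_range (fun i => a i * ((Complex.I : ℂ) : ℍ[ℝ]))).mpr (by
    simp [h1])
  set c := (ζ : ℂ).re with hc
  set s := (ζ : ℂ).im with hs
  have hcs : c ^ 2 + s ^ 2 = 1 := Circle.re_sq_add_im_sq ζ
  have hstar : ∀ w : Fin (n + 1) → ℍ[ℝ], star (fun i => a i * ((Complex.I : ℂ) : ℍ[ℝ])) ⬝ᵥ w =
      star ((Complex.I : ℂ) : ℍ[ℝ]) * (star a ⬝ᵥ w) := by
    intro w
    simp only [dotProduct, Pi.star_apply, star_mul, Finset.mul_sum, mul_assoc]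
  have haa : a' ⬝ᵥ a' = 1 := by rw [← hu.norm_sq, ha', ha]; simp
  have hbv : ∀ v, b' ⬝ᵥ v = (star a ⬝ᵥ u v).imI := by
    intro v
    rw [← hu.dot, hb', hstar]
    simp
  have hav : ∀ v, a' ⬝ᵥ v = (star a ⬝ᵥ u v).re := by
    intro v
    rw [← hu.dot, ha']
  have hba : b' ⬝ᵥ a' = 0 := by rw [hbv, ha', ha]; simp
  have hbb : b' ⬝ᵥ b' = 1 := by
    rw [← hu.dot, hb', hstar]
    have : star a ⬝ᵥ (fun i => a i * ((Complex.I : ℂ) : ℍ[ℝ])) =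
        (star a ⬝ᵥ a) * ((Complex.I : ℂ) : ℍ[ℝ]) := by
      simp only [dotProduct, Finset.sum_mul, mul_assoc]
    rw [this, ha]
    simp
  have hab : a' ⬝ᵥ b' = 0 := by rw [dotProduct_comm, hba]
  -- With ζ = c + s i and b = a i, the spin element is a d = c + s a b. On the vacuum, d gives (-c +
  -- s i) a, and multiplying by a again yields c - s i, the conjugate of ζ.
  set d : Fin (4 * n + 3) → ℝ := (-c) • a' + s • b' with hd
  have hdd : d ⬝ᵥ d = 1 := by
    rw [hd, add_dotProduct, dotProduct_add, dotProduct_add]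
    simp only [smul_dotProduct, dotProduct_smul, haa, hbb, hab, hba, smul_eq_mul]
    linarith
  refine ⟨⟨_, mul_mem_spin haa hdd⟩, fun v => ?_, ?_⟩
  · have h2 := (spinRot_apply_eq_iff _ ⟨_, mul_mem_spin haa hdd⟩ v _).mpr
      (unit_mul_unit_conj haa hdd v)
    rw [h2]
    set x := a' ⬝ᵥ v with hx
    set y := b' ⬝ᵥ v with hy
    have hdv : d ⬝ᵥ v = -c * x + s * y := by
      rw [hd, add_dotProduct, smul_dotProduct, smul_dotProduct, smul_eq_mul, smul_eq_mul]
    have had : a' ⬝ᵥ d = -c := by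
      rw [hd, dotProduct_add, dotProduct_smul, dotProduct_smul, haa, hab]; simp
    rw [dotProduct_sub, dotProduct_smul, hdv, had, ← hx, smul_eq_mul]
    have h3 : (2 * (2 * (-c * x + s * y) * -c - x)) • a' - ((2 * (-c * x + s * y)) • d - v) =
        v + ((c ^ 2 - s ^ 2 - 1) * x - 2 * c * s * y) • a' +
          ((c ^ 2 - s ^ 2 - 1) * y + 2 * c * s * x) • b' := by
      rw [hd]
      match_scalars
      · linear_combination x * hcs
      · linear_combination (-y) * hcs
      · ring
    rw [h3, map_add, map_add, map_smul, map_smul, ha', hb']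
    have h4 : ((ζ : ℂ) ^ 2 - 1) * hermDot a (u v) =
        ⟨(c ^ 2 - s ^ 2 - 1) * x - 2 * c * s * y, (c ^ 2 - s ^ 2 - 1) * y + 2 * c * s * x⟩ := by
      have h5 : hermDot a (u v) = ⟨x, y⟩ := by rw [hx, hy, hav, hbv]; rfl
      rw [h5]
      apply Complex.ext
      · simp [sq, ← hc, ← hs, -mul_eq_mul_right_iff]; ring
      · simp [sq, ← hc, ← hs, -mul_eq_mul_right_iff]; ring
    funext i
    rw [complexRefl, h4]
    simp only [Pi.add_apply, Pi.smul_apply]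
    rw [add_assoc]
    congr 1
    have h6 : ∀ (p q : ℝ) (t : ℍ[ℝ]),
        t * ((⟨p, q⟩ : ℂ) : ℍ[ℝ]) = p • t + q • (t * ((Complex.I : ℂ) : ℍ[ℝ])) := by
      intro p q t
      have h7 : ((⟨p, q⟩ : ℂ) : ℍ[ℝ]) = p + q * ((Complex.I : ℂ) : ℍ[ℝ]) := by ext <;> simp
      rw [h7, mul_add, ← Quaternion.coe_commutes, Quaternion.coe_mul_eq_smul,
        Quaternion.coe_mul_eq_smul, mul_smul_comm]
    exact (h6 _ _ _).symm
  · change fockRep hu (_ * _) 1 = _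
    have hI : fockCoord (n + 1) (u b') = Complex.I • fockCoord (n + 1) (u a') := by
      rw [hb', fockCoord_mul_coe, ha']
    have h7 : fockVec (n + 1) (u a') (ExteriorAlgebra.ι ℂ (fockCoord (n + 1) (u a'))) =
        -(1 : Fock (n + 1)) := by
      rw [← fockVec_one, ← Module.End.mul_apply, fockVec_mul_self, hu.norm_sq, haa]
      simp
    have h8 : fockVec (n + 1) (u d) 1 =
        (-(c : ℂ) + s * Complex.I) • ExteriorAlgebra.ι ℂ (fockCoord (n + 1) (u a')) := by
      rw [fockVec_one, hd, map_add, map_smul, map_smul, map_add, map_smul, map_smul, hI]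
      have h9 : ∀ (r : ℝ) (x : FockBase (n + 1)), r • x = (r : ℂ) • x := fun _ _ => rfl
      rw [h9, h9, smul_smul, ← add_smul, map_smul]
      simp
    rw [map_mul, Module.End.mul_apply, fockRep_ι, fockRep_ι, h8, map_smul, h7, smul_neg, ← neg_smul]
    congr 1
    apply Complex.ext
    · simp [hc]
    · simp [hs]

end Lifts

/-! ### The spin lift of the isotropy representation. -/

section IsotropyLift

open Matrix

variable {n : ℕ} {u : (Fin (4 * n + 3) → ℝ) →ₗ[ℝ] (Fin (n + 1) → ℍ[ℝ])}

theorem Circle.exists_sq (z : Circle) : ∃ w : Circle, w ^ 2 = z := by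
  refine ⟨Circle.exp (Complex.arg z / 2), ?_⟩
  rw [sq, ← Circle.exp_add, add_halves, Circle.exp_arg]

theorem star_mul_right_dotProduct {m : ℕ} (a v : Fin m → ℍ[ℝ]) (q : ℍ[ℝ]) :
    star (fun i => a i * q) ⬝ᵥ v = star q * (star a ⬝ᵥ v) := by
  simp only [dotProduct, Pi.star_apply, star_mul, Finset.mul_sum, mul_assoc]

theorem dotProduct_mul_right {m : ℕ} (a v : Fin m → ℍ[ℝ]) (q : ℍ[ℝ]) :
    a ⬝ᵥ (fun i => v i * q) = a ⬝ᵥ v * q := by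
  simp only [dotProduct, Finset.sum_mul, mul_assoc]

/-- The effect of two successive complex reflections along `a` and `a j`. -/
theorem complexRefl_pair {a : Fin (n + 1) → ℍ[ℝ]} (ha : star a ⬝ᵥ a = 1) (w w' : ℂ)
    (v : Fin (n + 1) → ℍ[ℝ]) :
    complexRefl a w (complexRefl (fun i => a i * quatJ) w' v) = fun i => v i + a i *
      (quatJ * (((w' - 1) * ⟨(star a ⬝ᵥ v).imJ, -(star a ⬝ᵥ v).imK⟩ : ℂ) : ℍ[ℝ]) +
        (((w - 1) * ⟨(star a ⬝ᵥ v).re, (star a ⬝ᵥ v).imI⟩ : ℂ) : ℍ[ℝ])) := by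
  have h1 : hermDot (fun i => a i * quatJ) v = ⟨(star a ⬝ᵥ v).imJ, -(star a ⬝ᵥ v).imK⟩ := by
    rw [hermDot, star_mul_right_dotProduct]
    apply Complex.ext <;> simp
  have h2 : hermDot a (complexRefl (fun i => a i * quatJ) w' v) =
      ⟨(star a ⬝ᵥ v).re, (star a ⬝ᵥ v).imI⟩ := by
    have h3 : star a ⬝ᵥ (complexRefl (fun i => a i * quatJ) w' v) =
        star a ⬝ᵥ v + quatJ * (((w' - 1) * hermDot (fun i => a i * quatJ) v : ℂ) : ℍ[ℝ]) := by
      have h4 : complexRefl (fun i => a i * quatJ) w' v = v + fun i => a i *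
          (quatJ * (((w' - 1) * hermDot (fun i => a i * quatJ) v : ℂ) : ℍ[ℝ])) := by
        funext i
        rw [complexRefl, Pi.add_apply, mul_assoc]
      rw [h4, dotProduct_add, dotProduct_mul_right, ha, one_mul]
    rw [hermDot, h3]
    apply Complex.ext <;> simp
  funext i
  rw [complexRefl, h2, complexRefl, h1, mul_add, mul_assoc, add_assoc]

/-- Left multiplication by z on the quaternionic line through a is, for the right complex structure,
diagonal with eigenvalues z and z⁻¹ on a and a j. The complex determinant is 1, and the two vacuum
eigenvalues cancel. -/
theorem exists_lift_spRefl (hu : IsIsoFrame u) {a : Fin (n + 1) → ℍ[ℝ]}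
    (ha : star a ⬝ᵥ a = 1) (h0 : a (Fin.last n) = 0) (z : Circle) :
    ∃ x, IsLift hu (fun v => (spRefl a ha (circleQuat z) :
      Matrix (Fin (n + 1)) (Fin (n + 1)) ℍ[ℝ]) *ᵥ v) 1 x := by
  obtain ⟨ζ, rfl⟩ := Circle.exists_sq z
  have hj : quatJ ∈ unitary ℍ[ℝ] := by
    rw [Unitary.mem_iff]
    constructor <;> ext <;> simp
  obtain ⟨x, hx⟩ := exists_lift_complexRefl hu ha (by rw [h0]; simp) (by rw [h0]; simp) ζ
  obtain ⟨y, hy⟩ := exists_lift_complexRefl hu (unit_smul_right ha ⟨quatJ, hj⟩) (by rw [h0]; simp)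
    (by rw [h0]; simp) ζ⁻¹
  refine ⟨x * y, (hx.mul hy).congr (fun v => ?_) ?_⟩
  · rw [complexRefl_pair ha, coe_spRefl, quatRefl_mulVec]
    funext i
    congr 2
    rw [coe_circleQuat, Circle.coe_inv_eq_conj]
    ext <;> simp [sq] <;> ring
  · rw [← star_mul, ← Circle.coe_mul, inv_mul_cancel, Circle.coe_one, star_one]

theorem exists_lift_fix (hu : IsIsoFrame u) (A : Sp (n + 1))
    (hA : (A : Matrix (Fin (n + 1)) (Fin (n + 1)) ℍ[ℝ]) *ᵥ Pi.single (Fin.last n) 1 =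
      Pi.single (Fin.last n) 1) :
    ∃ x, IsLift hu (fun v => (A : Matrix (Fin (n + 1)) (Fin (n + 1)) ℍ[ℝ]) *ᵥ v) 1 x := by
  refine fix_induction (fun A : Sp (n + 1) => ∃ x, IsLift hu
    (fun v => (A : Matrix (Fin (n + 1)) (Fin (n + 1)) ℍ[ℝ]) *ᵥ v) 1 x) ?_ _ {Fin.last n} rfl ?_ A ?_
  · exact ⟨1, (IsLift.one hu).congr (fun v => by simp) rfl⟩
  · rintro a ha h0 z B ⟨y, hy⟩
    obtain ⟨x, hx⟩ := exists_lift_spRefl hu ha (h0 _ (Finset.mem_singleton_self _)) z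
    refine ⟨x * y, (hx.mul hy).congr (fun v => ?_) (one_mul 1)⟩
    rw [Submonoid.coe_mul, mulVec_mulVec]
  · intro j hj
    rw [Finset.mem_singleton] at hj
    rw [hj, hA]

theorem single_unit {m : ℕ} (i : Fin m) : star (Pi.single i 1 : Fin m → ℍ[ℝ]) ⬝ᵥ Pi.single i 1 = 1 := by
  simp

theorem star_single_dotProduct {m : ℕ} (i : Fin m) (v : Fin m → ℍ[ℝ]) :
    star (Pi.single i 1 : Fin m → ℍ[ℝ]) ⬝ᵥ v = v i := by
  simp

/-- Each quaternionic coordinate is two complex dimensions with eigenvalue z⁻¹. Two reflections with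
ζ² = z⁻¹ contribute ζ̄² = z to the vacuum eigenvalue. -/
theorem exists_lift_scale (hu : IsIsoFrame u) (z : Circle) (T : Finset (Fin (n + 1))) :
    Fin.last n ∉ T → ∃ x, IsLift hu
      (fun v i => if i ∈ T then v i * (((z⁻¹ : Circle) : ℂ) : ℍ[ℝ]) else v i)
      ((z : ℂ) ^ T.card) x := by
  induction T using Finset.induction_on with
  | empty => exact fun _ => ⟨1, (IsLift.one hu).congr (fun v => by simp) (by simp)⟩
  | insert k T hk ih =>
    intro hl
    rw [Finset.mem_insert, not_or] at hl
    obtain ⟨x, hx⟩ := ih hl.2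
    obtain ⟨ζ, hζ⟩ := Circle.exists_sq z⁻¹
    have hζ' : ((ζ : ℂ)) ^ 2 = ((z⁻¹ : Circle) : ℂ) := by rw [← hζ, Circle.coe_pow]
    have hj : quatJ ∈ unitary ℍ[ℝ] := by
      rw [Unitary.mem_iff]
      constructor <;> ext <;> simp
    have h0 : (Pi.single k 1 : Fin (n + 1) → ℍ[ℝ]) (Fin.last n) = 0 := Pi.single_eq_of_ne hl.1 _
    obtain ⟨y, hy⟩ := exists_lift_complexRefl hu (single_unit k) (by rw [h0]; simp)
      (by rw [h0]; simp) ζ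
    obtain ⟨y', hy'⟩ := exists_lift_complexRefl hu (unit_smul_right (single_unit k) ⟨quatJ, hj⟩)
      (by rw [h0]; simp) (by rw [h0]; simp) ζ
    refine ⟨y * y' * x, ((hy.mul hy').mul hx).congr (fun v => ?_) ?_⟩
    · rw [complexRefl_pair (single_unit k), hζ', star_single_dotProduct, if_neg hk]
      funext i
      by_cases hi : i = k
      · subst hi
        rw [if_neg hk, if_pos (Finset.mem_insert_self _ _), Pi.single_eq_same, one_mul]
        ext <;> simp <;> ring
      · rw [Pi.single_eq_of_ne hi, zero_mul, add_zero]
        simp [Finset.mem_insert, hi]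
    · rw [Finset.card_insert_of_notMem hk, pow_succ', ← star_mul, ← sq, hζ',
        Circle.coe_inv_eq_conj, Complex.star_def, Complex.conj_conj]

/-- The action of `(A, z)` on `ℍᵐ`. -/
def spuFun {m : ℕ} (A : Matrix (Fin m) (Fin m) ℍ[ℝ]) (z : Circle) (v : Fin m → ℍ[ℝ]) :
    Fin m → ℍ[ℝ] :=
  fun i => (A *ᵥ v) i * (((z⁻¹ : Circle) : ℂ) : ℍ[ℝ])

/-- The element `diag(1, …, 1, z)` of `Sp(n+1)`. -/
def diagLast (n : ℕ) (z : Circle) : Sp (n + 1) := spRefl _ (single_unit (Fin.last n)) (circleQuat z)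

theorem diagLast_mulVec (z : Circle) (v : Fin (n + 1) → ℍ[ℝ]) (i : Fin (n + 1)) :
    ((diagLast n z : Matrix (Fin (n + 1)) (Fin (n + 1)) ℍ[ℝ]) *ᵥ v) i =
      if i = Fin.last n then ((z : ℂ) : ℍ[ℝ]) * v i else v i := by
  rw [diagLast, coe_spRefl, quatRefl_mulVec, star_single_dotProduct, coe_circleQuat]
  dsimp only
  split_ifs with h
  · subst h
    rw [Pi.single_eq_same]
    noncomm_ring
  · rw [Pi.single_eq_of_ne h, zero_mul, add_zero]

/-- The first n coordinates contribute z^n. On the last one, v ↦ z v z⁻¹ fixes ℂ and has the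
eigenvalue z⁻² on the complex line through j, so the reflection with ζ = z⁻¹ contributes one more
factor z. -/
theorem exists_lift_diag (hu : IsIsoFrame u) (z : Circle) :
    ∃ x, IsLift hu (spuFun (diagLast n z : Matrix (Fin (n + 1)) (Fin (n + 1)) ℍ[ℝ]) z)
      ((z : ℂ) ^ (n + 1)) x := by
  obtain ⟨x, hx⟩ := exists_lift_scale hu z {Fin.last n}ᶜ (by simp)
  have hj : quatJ ∈ unitary ℍ[ℝ] := by
    rw [Unitary.mem_iff]
    constructor <;> ext <;> simp
  obtain ⟨y, hy⟩ := exists_lift_complexRefl hu (unit_smul_right (single_unit (Fin.last n))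
    ⟨quatJ, hj⟩) (by simp) (by simp) z⁻¹
  refine ⟨y * x, (hy.mul hx).congr (fun v => ?_) ?_⟩
  · funext i
    rw [complexRefl, hermDot, star_mul_right_dotProduct, star_single_dotProduct, spuFun,
      diagLast_mulVec]
    by_cases hi : i = Fin.last n
    · subst hi
      have h := Circle.re_sq_add_im_sq z
      have h1 : ((z : ℂ) : ℍ[ℝ]) * star ((z : ℂ) : ℍ[ℝ]) = 1 :=
        (Unitary.mem_iff.mp (coeComplex_mem_unitary z)).2
      simp only [Finset.mem_compl, Finset.mem_singleton, not_true_eq_false, if_false, if_true,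
        Pi.single_eq_same, one_mul, Circle.coe_inv_eq_conj]
      ext
      · simp [sq]; linear_combination (-(v (Fin.last n)).re) * h
      · simp [sq]; linear_combination (-(v (Fin.last n)).imI) * h
      · simp [sq]; ring
      · simp [sq]; ring
    · simp [hi]
  · rw [Finset.card_compl, Finset.card_singleton, Fintype.card_fin, Nat.add_sub_cancel,
      Circle.coe_inv_eq_conj, Complex.star_def, Complex.conj_conj, pow_succ']

/-- The preimage of the isotropy group in `Sp(n+1) × U(1)`. -/
def isoCover (n : ℕ) : Subgroup (Sp (n + 1) × Circle) :=
  (isotropy n).comap (QuotientGroup.mk' (spuCenter (n + 1)))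

theorem mem_isoCover {k : Sp (n + 1) × Circle} : k ∈ isoCover n ↔
    (k.1 : Matrix (Fin (n + 1)) (Fin (n + 1)) ℍ[ℝ]) *ᵥ Pi.single (Fin.last n) 1 =
      Pi.single (Fin.last n) ((k.2 : ℂ) : ℍ[ℝ]) := by
  have h0 : k ∈ isoCover n ↔ SpU.mk k.1 k.2 • basePoint n = basePoint n := Iff.rfl
  have h1 : SpU.mk k.1 k.2 • basePoint n = basePoint n ↔
      spuFun (k.1 : Matrix (Fin (n + 1)) (Fin (n + 1)) ℍ[ℝ]) k.2 (Pi.single (Fin.last n) 1) =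
        Pi.single (Fin.last n) 1 := by
    rw [Subtype.ext_iff, ← (WithLp.ofLp_injective 2).eq_iff]
    rfl
  have h2 : (((k.2⁻¹ : Circle) : ℂ) : ℍ[ℝ]) * ((k.2 : ℂ) : ℍ[ℝ]) = 1 := by
    rw [← Quaternion.coeComplex_mul, ← Circle.coe_mul, inv_mul_cancel]; simp
  have h3 : ((k.2 : ℂ) : ℍ[ℝ]) * (((k.2⁻¹ : Circle) : ℂ) : ℍ[ℝ]) = 1 := by
    rw [← Quaternion.coeComplex_mul, ← Circle.coe_mul, mul_inv_cancel]; simp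
  rw [h0, h1]
  constructor
  · intro h
    funext i
    have h4 := congrArg (· * ((k.2 : ℂ) : ℍ[ℝ])) (congrFun h i)
    simp only [spuFun, mul_assoc, h2, mul_one] at h4
    rw [h4]
    by_cases hi : i = Fin.last n
    · subst hi; simp
    · simp [hi]
  · intro h
    funext i
    rw [spuFun, h]
    by_cases hi : i = Fin.last n
    · subst hi; rw [Pi.single_eq_same, Pi.single_eq_same, h3]
    · simp [hi]

theorem spuFun_mul {m : ℕ} (A B : Matrix (Fin m) (Fin m) ℍ[ℝ]) (z w : Circle) (v : Fin m → ℍ[ℝ]) :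
    spuFun A z (spuFun B w v) = spuFun (A * B) (z * w) v := by
  funext i
  have h' : ∀ (B : Matrix (Fin m) (Fin m) ℍ[ℝ]) (w : Fin m → ℍ[ℝ]) (c : ℍ[ℝ]),
      B *ᵥ (fun j => w j * c) = fun k => (B *ᵥ w) k * c := by
    intro B w c
    funext k
    simp only [Matrix.mulVec, dotProduct, Finset.sum_mul, mul_assoc]
  have h1 : spuFun B w v = fun j => (B *ᵥ v) j * (((w⁻¹ : Circle) : ℂ) : ℍ[ℝ]) := rfl
  rw [h1, spuFun, spuFun, h', mulVec_mulVec, _root_.mul_inv_rev, Circle.coe_mul, Quaternion.coeComplex_mul, mul_assoc]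

theorem diagLast_mem (n : ℕ) (z : Circle) : (diagLast n z, z) ∈ isoCover n := by
  rw [mem_isoCover]
  funext i
  rw [diagLast_mulVec]
  by_cases hi : i = Fin.last n
  · subst hi; simp
  · simp [hi]

/-- Every element of the isotropy group is a product of one fixing the base vector and one of the
form `(diag(1, …, 1, z), z)`. -/
theorem isoCover_decomp {k : Sp (n + 1) × Circle} (hk : k ∈ isoCover n) :
    ∃ A : Sp (n + 1), (A : Matrix (Fin (n + 1)) (Fin (n + 1)) ℍ[ℝ]) *ᵥ Pi.single (Fin.last n) 1 =
      Pi.single (Fin.last n) 1 ∧ k = (A, 1) * (diagLast n k.2, k.2) := by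
  refine ⟨k.1 * (diagLast n k.2)⁻¹, ?_, ?_⟩
  · have h := mul_mem hk (inv_mem (diagLast_mem n k.2))
    rw [mem_isoCover] at h
    simpa using h
  · refine Prod.ext ?_ ?_ <;> simp

theorem exists_lift (hu : IsIsoFrame u) {k : Sp (n + 1) × Circle} (hk : k ∈ isoCover n) :
    ∃ x, IsLift hu (spuFun (k.1 : Matrix (Fin (n + 1)) (Fin (n + 1)) ℍ[ℝ]) k.2)
      ((k.2 : ℂ) ^ (n + 1)) x := by
  obtain ⟨A, hA, hkA⟩ := isoCover_decomp hk
  obtain ⟨x, hx⟩ := exists_lift_fix hu A hA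
  obtain ⟨y, hy⟩ := exists_lift_diag hu k.2
  refine ⟨x * y, (hx.mul hy).congr (fun v => ?_) (one_mul _)⟩
  have h1 : (A : Matrix (Fin (n + 1)) (Fin (n + 1)) ℍ[ℝ]) * diagLast n k.2 = k.1 := by
    rw [← Submonoid.coe_mul]
    exact congrArg (fun k : Sp (n + 1) × Circle => (k.1 : Matrix (Fin (n + 1)) (Fin (n + 1)) ℍ[ℝ])) hkA.symm
  have h2 : ∀ v : Fin (n + 1) → ℍ[ℝ], (A : Matrix (Fin (n + 1)) (Fin (n + 1)) ℍ[ℝ]) *ᵥ v =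
      spuFun (A : Matrix (Fin (n + 1)) (Fin (n + 1)) ℍ[ℝ]) 1 v := by
    intro v
    funext i
    simp [spuFun]
  rw [h2, spuFun_mul, one_mul, h1]

/-- The lift `Sp(n) × U(1) → Spin(4n+3)` of the isotropy representation in a given frame. -/
def isoLift (hu : IsIsoFrame u) : isoCover n →* Spin (4 * n + 3) where
  -- The chosen lift is the only one with the vacuum eigenvalue z^(n+1). As these eigenvalues are
  -- multiplicative, so are the lifts.
  toFun k := (exists_lift hu k.2).choose
  map_one' := by
    refine IsLift.unique (χ := ((1 : Circle) : ℂ) ^ (n + 1)) (by simp)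
      (exists_lift hu (1 : isoCover n).2).choose_spec ((IsLift.one hu).congr (fun v => ?_) (by simp))
    funext i
    simp [spuFun]
  map_mul' k l := by
    refine IsLift.unique (χ := ((k * l : isoCover n).1.2 : ℂ) ^ (n + 1)) (by simp)
      (exists_lift hu (k * l).2).choose_spec
      (((exists_lift hu k.2).choose_spec.mul (exists_lift hu l.2).choose_spec).congr
        (fun v => ?_) ?_)
    · rw [spuFun_mul]; rfl
    · rw [← mul_pow]; rfl

theorem isLift_isoLift (hu : IsIsoFrame u) (k : isoCover n) :
    IsLift hu (spuFun (k.1.1 : Matrix (Fin (n + 1)) (Fin (n + 1)) ℍ[ℝ]) k.1.2)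
      ((k.1.2 : ℂ) ^ (n + 1)) (isoLift hu k) :=
  (exists_lift hu k.2).choose_spec

end IsotropyLift

/-! ### Homomorphisms from the isotropy group to abelian groups -/

section AbelianHom

open Matrix

variable {n : ℕ}

/-- Write z = w². Conjugation by j inverts w, so in an abelian group w and w⁻¹ have the same image,
and the image of w² is trivial. -/
theorem unitaryQuat_hom_circle {C : Type*} [CommGroup C] (g : unitary ℍ[ℝ] →* C) (z : Circle) :
    g (circleQuat z) = 1 := by
  obtain ⟨w, rfl⟩ := Circle.exists_sq z
  have hj : quatJ ∈ unitary ℍ[ℝ] := by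
    rw [Unitary.mem_iff]
    constructor <;> ext <;> simp
  have h : (⟨quatJ, hj⟩ : unitary ℍ[ℝ]) * circleQuat w = circleQuat w⁻¹ * ⟨quatJ, hj⟩ := by
    refine Subtype.ext ?_
    rw [Submonoid.coe_mul, Submonoid.coe_mul, coe_circleQuat, coe_circleQuat,
      Circle.coe_inv_eq_conj]
    ext <;> simp
  have h1 := congrArg g h
  rw [map_mul, map_mul, mul_comm, mul_right_cancel_iff, map_inv, map_inv] at h1
  rw [map_pow, map_pow, sq]
  nth_rewrite 1 [h1]
  exact inv_mul_cancel _

theorem mem_isoCover_fix {A : Sp (n + 1)} : (A, 1) ∈ isoCover n ↔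
    (A : Matrix (Fin (n + 1)) (Fin (n + 1)) ℍ[ℝ]) *ᵥ Pi.single (Fin.last n) 1 =
      Pi.single (Fin.last n) 1 := by
  rw [mem_isoCover]
  simp

/-- By `fix_induction` the factor Sp(n) is generated by quaternionic reflections, each lying in the
image of a homomorphism from the unit quaternions, where `unitaryQuat_hom_circle` applies. -/
theorem isoCover_hom_fix {C : Type*} [CommGroup C] (f : isoCover n →* C) (A : Sp (n + 1))
    (hA : (A, (1 : Circle)) ∈ isoCover n) : f ⟨(A, 1), hA⟩ = 1 := by
  revert hA
  suffices h : (A : Matrix (Fin (n + 1)) (Fin (n + 1)) ℍ[ℝ]) *ᵥ Pi.single (Fin.last n) 1 =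
      Pi.single (Fin.last n) 1 → ∀ hA : (A, (1 : Circle)) ∈ isoCover n, f ⟨(A, 1), hA⟩ = 1 from
    fun hA => h (mem_isoCover_fix.mp hA) hA
  intro hA0
  refine fix_induction (fun A : Sp (n + 1) => ∀ hA : (A, (1 : Circle)) ∈ isoCover n,
    f ⟨(A, 1), hA⟩ = 1) (fun h => map_one f) _ {Fin.last n} rfl ?_ A ?_
  · intro a ha h0 z B ih hB
    have hmem : ∀ q : unitary ℍ[ℝ], (spRefl a ha q, (1 : Circle)) ∈ isoCover n := by
      intro q
      rw [mem_isoCover_fix, coe_spRefl, quatRefl_mulVec]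
      funext i
      simp [h0 _ (Finset.mem_singleton_self _)]
    let g : unitary ℍ[ℝ] →* C := f.comp
      { toFun := fun q => ⟨(spRefl a ha q, 1), hmem q⟩
        map_one' := Subtype.ext (Prod.ext (map_one _) rfl)
        map_mul' := fun p q => Subtype.ext (Prod.ext (map_mul _ _ _) (mul_one _).symm) }
    have hB' : (B, (1 : Circle)) ∈ isoCover n := by
      have := mul_mem (inv_mem (hmem (circleQuat z))) hB
      simpa using this
    have h1 : (⟨(spRefl a ha (circleQuat z) * B, 1), hB⟩ : isoCover n) =
        ⟨(spRefl a ha (circleQuat z), 1), hmem _⟩ * ⟨(B, 1), hB'⟩ :=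
      Subtype.ext (Prod.ext rfl (mul_one _).symm)
    rw [h1, map_mul, ih hB', mul_one]
    exact unitaryQuat_hom_circle g z
  · intro j hj
    rw [Finset.mem_singleton] at hj
    rw [hj, hA0]

/-- The homomorphism `z ↦ (diag(1, …, 1, z), z)`. -/
def diagHom (n : ℕ) : Circle →* isoCover n where
  toFun z := ⟨(diagLast n z, z), diagLast_mem n z⟩
  map_one' := Subtype.ext (Prod.ext (by simp [diagLast]) rfl)
  map_mul' z w := Subtype.ext (Prod.ext (by simp [diagLast]) rfl)

theorem isoCover_hom_eq {C : Type*} [CommGroup C] (f : isoCover n →* C) (k : isoCover n) :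
    f k = f (diagHom n k.1.2) := by
  obtain ⟨A, hA, hk⟩ := isoCover_decomp k.2
  have h : k = ⟨(A, 1), mem_isoCover_fix.mpr hA⟩ * diagHom n k.1.2 := Subtype.ext hk
  conv_lhs => rw [h]
  rw [map_mul, isoCover_hom_fix, one_mul]

/-- A homomorphism from the isotropy group to an abelian group of exponent two is trivial. -/
theorem isoCover_hom_trivial {C : Type*} [CommGroup C] (f : isoCover n →* C)
    (hC : ∀ k, f k ^ 2 = 1) (k : isoCover n) : f k = 1 := by
  rw [isoCover_hom_eq]
  obtain ⟨w, hw⟩ := Circle.exists_sq k.1.2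
  rw [← hw, map_pow, map_pow, hC]

theorem negOne_mem_isoCover (n : ℕ) : ((-1 : Sp (n + 1)), (-1 : Circle)) ∈ isoCover n := by
  rw [mem_isoCover]
  have h : ((-1 : Circle) : ℂ) = -1 := rfl
  have h' : (((-1 : Sp (n + 1)) : Matrix (Fin (n + 1)) (Fin (n + 1)) ℍ[ℝ])) = -1 := rfl
  rw [h, h', neg_mulVec, one_mulVec, ← Pi.single_neg]
  congr 1
  ext <;> simp

/-- The element `(-1, -1)` of the preimage of the isotropy group. -/
def isoNegOne (n : ℕ) : isoCover n := ⟨(-1, -1), negOne_mem_isoCover n⟩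

/-- The element (-1, -1) acts as the identity, so its lift is a sign, and the vacuum eigenvalue
(-1)^(n+1) decides which. This sign is the whole obstruction to an invariant spin structure. -/
theorem isoLift_isoNegOne {u : (Fin (4 * n + 3) → ℝ) →ₗ[ℝ] (Fin (n + 1) → ℍ[ℝ])}
    (hu : IsIsoFrame u) : isoLift hu (isoNegOne n) = spinNegOne (4 * n + 3) ^ (n + 1) := by
  have h1 : IsLift hu (fun v => v) (-1) (spinNegOne (4 * n + 3)) := by
    refine ⟨fun v => congrArg u ?_, ?_⟩
    · rw [spinRot_apply_eq_iff]
      simp [spinNegOne]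
    · simp [spinNegOne]
  have h2 : ∀ k : ℕ, IsLift hu (fun v => v) ((-1) ^ k) (spinNegOne (4 * n + 3) ^ k) := by
    intro k
    induction k with
    | zero => simpa using IsLift.one hu
    | succ k ih => rw [pow_succ, pow_succ]; exact ih.mul h1
  refine IsLift.unique (pow_ne_zero (n + 1) (neg_ne_zero.mpr one_ne_zero))
    ((isLift_isoLift hu (isoNegOne n)).congr (fun v => ?_) rfl) (h2 (n + 1))
  funext i
  change ((-1 : Matrix (Fin (n + 1)) (Fin (n + 1)) ℍ[ℝ]) *ᵥ v) i *
    ((((-1 : Circle)⁻¹ : Circle) : ℂ) : ℍ[ℝ]) = v i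
  have h : (((-1 : Circle)⁻¹ : Circle) : ℂ) = -1 := by
    rw [Circle.coe_inv]
    change ((-1 : ℂ))⁻¹ = -1
    norm_num
  have h' : (((-1 : ℂ)) : ℍ[ℝ]) = -1 := by ext <;> simp
  rw [h, h', neg_mulVec, one_mulVec]
  simp

end AbelianHom

/-! ### Functions with values in an infinite-dimensional space that are combinations of smooth functions -/

section SmoothVal

variable {V A B C : Type*} [NormedAddCommGroup V] [NormedSpace ℝ V] [AddCommGroup A] [Module ℝ A]
  [AddCommGroup B] [Module ℝ B] [AddCommGroup C] [Module ℝ C]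

/-- On `O`, the function `f` is a finite combination of constant vectors with smooth coefficients. -/
def SmoothVal (O : Set V) (f : V → A) : Prop :=
  ∃ (s : ℕ) (F : Fin s → V → ℝ) (a : Fin s → A), (∀ i, ContDiffOn ℝ ∞ (F i) O) ∧
    ∀ x ∈ O, f x = ∑ i, F i x • a i

theorem SmoothVal.of_fintype {O : Set V} {f : V → A} {κ : Type*} [Fintype κ] (F : κ → V → ℝ)
    (a : κ → A) (hF : ∀ i, ContDiffOn ℝ ∞ (F i) O) (h : ∀ x ∈ O, f x = ∑ i, F i x • a i) :
    SmoothVal O f := by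
  refine ⟨Fintype.card κ, fun i => F ((Fintype.equivFin κ).symm i),
    fun i => a ((Fintype.equivFin κ).symm i), fun i => hF _, fun x hx => ?_⟩
  rw [h x hx]
  exact (Equiv.sum_comp (Fintype.equivFin κ).symm fun i => F i x • a i).symm

theorem SmoothVal.congr {O : Set V} {f g : V → A} (hf : SmoothVal O f) (h : ∀ x ∈ O, g x = f x) :
    SmoothVal O g := by
  obtain ⟨s, F, a, hF, hfa⟩ := hf
  exact ⟨s, F, a, hF, fun x hx => (h x hx).trans (hfa x hx)⟩

theorem SmoothVal.mono {O O' : Set V} {f : V → A} (hf : SmoothVal O f) (h : O' ⊆ O) :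
    SmoothVal O' f := by
  obtain ⟨s, F, a, hF, hfa⟩ := hf
  exact ⟨s, F, a, fun i => (hF i).mono h, fun x hx => hfa x (h hx)⟩

theorem SmoothVal.const (O : Set V) (a : A) : SmoothVal O fun _ => a :=
  SmoothVal.of_fintype (κ := Unit) (fun _ _ => 1) (fun _ => a) (fun _ => contDiffOn_const)
    (fun x _ => by simp)

theorem SmoothVal.bilin {O : Set V} {f : V → A} {g : V → B} (hf : SmoothVal O f)
    (hg : SmoothVal O g) (L : A →ₗ[ℝ] B →ₗ[ℝ] C) : SmoothVal O fun x => L (f x) (g x) := by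
  obtain ⟨s, F, a, hF, hfa⟩ := hf
  obtain ⟨t, G, b, hG, hgb⟩ := hg
  refine SmoothVal.of_fintype (κ := Fin s × Fin t) (fun i x => F i.1 x * G i.2 x)
    (fun i => L (a i.1) (b i.2)) (fun i => (hF i.1).mul (hG i.2)) fun x hx => ?_
  rw [hfa x hx, hgb x hx, Fintype.sum_prod_type]
  simp only [map_sum, map_smul, LinearMap.sum_apply, LinearMap.smul_apply, Finset.smul_sum,
    smul_smul]
  rw [Finset.sum_comm]
  exact Finset.sum_congr rfl fun i _ => Finset.sum_congr rfl fun j _ => by rw [mul_comm]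

theorem SmoothVal.map {O : Set V} {f : V → A} (hf : SmoothVal O f) (L : A →ₗ[ℝ] B) :
    SmoothVal O fun x => L (f x) := by
  obtain ⟨s, F, a, hF, hfa⟩ := hf
  refine ⟨s, F, fun i => L (a i), hF, fun x hx => ?_⟩
  simp only [hfa x hx, map_sum, map_smul]

theorem SmoothVal.add {O : Set V} {f g : V → A} (hf : SmoothVal O f) (hg : SmoothVal O g) :
    SmoothVal O fun x => f x + g x := by
  obtain ⟨s, F, a, hF, hfa⟩ := hf
  obtain ⟨t, G, b, hG, hgb⟩ := hg
  refine SmoothVal.of_fintype (κ := Fin s ⊕ Fin t) (Sum.elim F G) (Sum.elim a b)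
    (fun i => i.rec hF hG) fun x hx => ?_
  rw [hfa x hx, hgb x hx, Fintype.sum_sum_type]
  rfl

theorem SmoothVal.sum {O : Set V} {κ : Type*} (T : Finset κ) {f : κ → V → A}
    (hf : ∀ i ∈ T, SmoothVal O (f i)) : SmoothVal O fun x => ∑ i ∈ T, f i x := by
  classical
  induction T using Finset.induction_on with
  | empty => simpa using SmoothVal.const O (0 : A)
  | insert i T hi ih =>
    refine ((hf i (Finset.mem_insert_self _ _)).add
      (ih fun j hj => hf j (Finset.mem_insert_of_mem hj))).congr fun x _ => ?_
    rw [Finset.sum_insert hi]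

theorem SmoothVal.mul {R : Type*} [Ring R] [Algebra ℝ R] {O : Set V} {f g : V → R}
    (hf : SmoothVal O f) (hg : SmoothVal O g) : SmoothVal O fun x => f x * g x :=
  hf.bilin hg (LinearMap.mul ℝ R)

theorem SmoothVal.pow {R : Type*} [Ring R] [Algebra ℝ R] {O : Set V} {f : V → R}
    (hf : SmoothVal O f) (k : ℕ) : SmoothVal O fun x => f x ^ k := by
  induction k with
  | zero => simpa using SmoothVal.const O (1 : R)
  | succ k ih => simpa only [pow_succ] using ih.mul hf

theorem SmoothVal.comp {V' : Type*} [NormedAddCommGroup V'] [NormedSpace ℝ V'] {O : Set V}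
    {f : V → A} (hf : SmoothVal O f) {O' : Set V'} {g : V' → V} (hg : ContDiffOn ℝ ∞ g O')
    (h : Set.MapsTo g O' O) : SmoothVal O' fun x => f (g x) := by
  obtain ⟨s, F, a, hF, hfa⟩ := hf
  exact ⟨s, fun i x => F i (g x), a, fun i => (hF i).comp hg h, fun x hx => hfa _ (h hx)⟩

theorem smoothVal_of_contDiffOn {W : Type*} [NormedAddCommGroup W] [NormedSpace ℝ W]
    [FiniteDimensional ℝ W] {O : Set V} {f : V → W} (hf : ContDiffOn ℝ ∞ f O) : SmoothVal O f := by
  let b := Module.finBasis ℝ W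
  refine SmoothVal.of_fintype (fun i x => b.coord i (f x)) b (fun i => ?_) fun x _ => ?_
  · have : ContDiff ℝ ∞ (LinearMap.toContinuousLinearMap (b.coord i)) :=
      ContinuousLinearMap.contDiff _
    exact this.comp_contDiffOn hf
  · exact (b.sum_repr (f x)).symm

theorem SmoothVal.contDiffOn {W : Type*} [NormedAddCommGroup W] [NormedSpace ℝ W]
    {O : Set V} {f : V → W} (hf : SmoothVal O f) : ContDiffOn ℝ ∞ f O := by
  obtain ⟨s, F, a, hF, hfa⟩ := hf
  refine ContDiffOn.congr ?_ hfa
  exact ContDiffOn.sum fun i _ => (hF i).smul contDiffOn_const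

/-- A function that is, near every point, the restriction of a combination of smooth functions is
smooth. -/
theorem smoothOnVia_of_smoothVal {T V W : Type} [NormedAddCommGroup V] [NormedSpace ℝ V]
    [AddCommGroup W] [Module ℝ W] {e : T → V} {f : T → W} {U : Set T}
    (h : ∀ t ∈ U, ∃ (O : Set V) (F : V → W), IsOpen O ∧ e t ∈ O ∧ SmoothVal O F ∧
      ∀ t' ∈ U, e t' ∈ O → F (e t') = f t') : SmoothOnVia e f U := by
  intro ℓ t ht
  obtain ⟨O, F, hO, htO, hF, hFf⟩ := h t ht
  exact ⟨O, fun x => ℓ (F x), hO, htO, (hF.map ℓ).contDiffOn, fun t' ht' h' =>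
    congrArg ℓ (hFf t' ht' h')⟩

/-- Conversely, a smooth function to a finite-dimensional space is locally the restriction of a
combination of smooth functions. -/
theorem SmoothOnVia.exists_smoothVal {T V W : Type} [NormedAddCommGroup V] [NormedSpace ℝ V]
    [AddCommGroup W] [Module ℝ W] [Module.Finite ℝ W] {e : T → V} {f : T → W} {U : Set T}
    (h : SmoothOnVia e f U) {t : T} (ht : t ∈ U) :
    ∃ (O : Set V) (F : V → W), IsOpen O ∧ e t ∈ O ∧ SmoothVal O F ∧
      ∀ t' ∈ U, e t' ∈ O → F (e t') = f t' := by
  let b := Module.finBasis ℝ W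
  choose O F hO htO hF hFf using fun i => h (b.coord i) t ht
  refine ⟨⋂ i, O i, fun x => ∑ i, F i x • b i, isOpen_iInter_of_finite hO,
    Set.mem_iInter.mpr htO, ⟨_, F, b, fun i => (hF i).mono (Set.iInter_subset _ i), fun _ _ => rfl⟩,
    fun t' ht' h' => ?_⟩
  rw [Set.mem_iInter] at h'
  simp only [hFf _ t' ht' (h' _)]
  exact b.sum_repr (f t')

end SmoothVal

/-! ### Smooth dependence of the spin lift on the group element. -/

section SmoothLift

open Matrix

variable {n : ℕ} {u : (Fin (4 * n + 3) → ℝ) →ₗ[ℝ] (Fin (n + 1) → ℍ[ℝ])}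

theorem SmoothVal.linear {V A : Type*} [NormedAddCommGroup V] [NormedSpace ℝ V]
    [FiniteDimensional ℝ V] [AddCommGroup A] [Module ℝ A] (O : Set V) (L : V →ₗ[ℝ] A) :
    SmoothVal O fun x => L x :=
  (smoothVal_of_contDiffOn contDiffOn_id).map L

theorem SmoothVal.pi {V A κ : Type*} [NormedAddCommGroup V] [NormedSpace ℝ V] [Fintype κ]
    [AddCommGroup A] [Module ℝ A] {O : Set V} {f : κ → V → A} (hf : ∀ i, SmoothVal O (f i)) :
    SmoothVal O fun x i => f i x := by
  classical
  refine (SmoothVal.sum Finset.univ fun i _ => (hf i).map (LinearMap.single ℝ (fun _ => A) i)).congr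
    fun x _ => ?_
  funext i
  simp [Finset.sum_apply, Pi.single_apply]

/-- The normed space containing `Sp(m) × U(1)`. -/
abbrev SpuSpace (m : ℕ) : Type := (Fin m → Fin m → ℍ[ℝ]) × ℂ

/-- The embedding of `Sp(m) × U(1)`. -/
def spuEmb {m : ℕ} (k : Sp m × Circle) : SpuSpace m :=
  (fun i j => (k.1 : Matrix (Fin m) (Fin m) ℍ[ℝ]) i j, (k.2 : ℂ))

theorem exists_smooth_spuFun {m : ℕ} (v : Fin m → ℍ[ℝ]) :
    ∃ F : SpuSpace m → Fin m → ℍ[ℝ], SmoothVal Set.univ F ∧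
      ∀ k : Sp m × Circle, F (spuEmb k) = spuFun (k.1 : Matrix (Fin m) (Fin m) ℍ[ℝ]) k.2 v := by
  refine ⟨fun p i => (∑ j, p.1 i j * v j) * ((star p.2 : ℂ) : ℍ[ℝ]), SmoothVal.pi fun i =>
    (SmoothVal.sum _ fun j _ => (SmoothVal.linear _ (LinearMap.proj j ∘ₗ LinearMap.proj i ∘ₗ
      LinearMap.fst ℝ (Fin m → Fin m → ℍ[ℝ]) ℂ)).mul (SmoothVal.const _ (v j))).mul
    (SmoothVal.linear _ (Quaternion.ofComplex.toLinearMap ∘ₗ Complex.conjAe.toLinearMap ∘ₗ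
      LinearMap.snd ℝ (Fin m → Fin m → ℍ[ℝ]) ℂ)), fun k => ?_⟩
  funext i
  rw [spuFun, Circle.coe_inv_eq_conj]
  rfl

theorem spin_conj_mul {N : ℕ} (x : Spin N) (a b : Cl N) :
    (x : Cl N) * (a * b) * star (x : Cl N) =
      (x * a * star (x : Cl N)) * (x * b * star (x : Cl N)) := by
  have h := spin_star_mul N x
  calc (x : Cl N) * (a * b) * star (x : Cl N)
      = x * a * 1 * b * star (x : Cl N) := by rw [mul_one]; simp only [mul_assoc]
    _ = _ := by rw [← h]; simp only [mul_assoc]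

/-- On vectors, conjugation by the lift is the underlying rotation, which is polynomial in (A, z).
Multiplicativity extends this to the whole Clifford algebra, so the smoothness of the lift itself is
not presupposed. -/
theorem exists_smooth_conj (hu : IsIsoFrame u) (c : Cl (4 * n + 3)) :
    ∃ F : SpuSpace (n + 1) → Cl (4 * n + 3), SmoothVal Set.univ F ∧ ∀ k : isoCover n,
      F (spuEmb k.1) = (isoLift hu k : Cl (4 * n + 3)) * c * star (isoLift hu k : Cl (4 * n + 3)) := by
  induction c using CliffordAlgebra.induction with
  | algebraMap r =>
    refine ⟨fun _ => algebraMap ℝ _ r, SmoothVal.const _ _, fun k => ?_⟩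
    rw [← Algebra.commutes, mul_assoc, spin_mul_star, mul_one]
  | ι v =>
    obtain ⟨u', hu'⟩ := LinearMap.exists_leftInverse_of_injective u
      (LinearMap.ker_eq_bot.mpr hu.injective)
    obtain ⟨F, hF, hFk⟩ := exists_smooth_spuFun (u v)
    refine ⟨fun p => ι (stdForm (4 * n + 3)) (u' (F p)), hF.map (ι (stdForm (4 * n + 3)) ∘ₗ u'),
      fun k => ?_⟩
    dsimp only
    have h : u' (u (spinRot _ (isoLift hu k) v)) = spinRot _ (isoLift hu k) v :=
      LinearMap.congr_fun hu' _
    rw [hFk, ← (isLift_isoLift hu k).1, h]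
    exact ι_spinRotFun _ _ _
  | mul a b ha hb =>
    obtain ⟨F, hF, hFk⟩ := ha
    obtain ⟨G, hG, hGk⟩ := hb
    refine ⟨_, hF.mul hG, fun k => ?_⟩
    rw [hFk, hGk, spin_conj_mul]
  | add a b ha hb =>
    obtain ⟨F, hF, hFk⟩ := ha
    obtain ⟨G, hG, hGk⟩ := hb
    refine ⟨_, hF.add hG, fun k => ?_⟩
    rw [hFk, hGk, mul_add, add_mul]

/-- The even part of the Clifford algebra. -/
def evenPart (N : ℕ) : Submodule ℝ (Cl N) :=
  LinearMap.ker ((involute (Q := stdForm N)).toLinearMap - LinearMap.id)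

theorem mem_evenPart {N : ℕ} {x : Cl N} : x ∈ evenPart N ↔ involute x = x := by
  rw [evenPart, LinearMap.mem_ker, LinearMap.sub_apply, sub_eq_zero]
  rfl

/-- The values `x b₁ · 1, …, x b_d · 1` in the Fock space, for a basis `b` of `Cl(4n+3)`. -/
def fockValues (hu : IsIsoFrame u) :
    Cl (4 * n + 3) →ₗ[ℝ] Fin (Module.finrank ℝ (Cl (4 * n + 3))) → Fock (n + 1) where
  toFun x i := fockRep hu (x * Module.finBasis ℝ (Cl (4 * n + 3)) i) 1
  map_add' x y := by
    funext i
    rw [add_mul, map_add]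
    rfl
  map_smul' r x := by
    funext i
    rw [smul_mul_assoc, map_smul]
    rfl

/-- The elements that annihilate the vacuum form a proper left ideal I. The hypothesis says that x
acts as zero on Cl/I, and a representation on a nonzero module is injective on even elements by
`eq_zero_of_map_eq_zero`. -/
theorem eq_zero_of_fockValues_eq_zero (hu : IsIsoFrame u) {x : Cl (4 * n + 3)}
    (hx : involute x = x) (h : fockValues hu x = 0) : x = 0 := by
  let I : Submodule (Cl (4 * n + 3)) (Cl (4 * n + 3)) :=
    { carrier := {c | fockRep hu c 1 = 0}
      add_mem' := fun {a b} ha hb => by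
        change fockRep hu (a + b) 1 = 0
        rw [map_add, LinearMap.add_apply, show fockRep hu a 1 = 0 from ha,
          show fockRep hu b 1 = 0 from hb, add_zero]
      zero_mem' := by
        change fockRep hu 0 1 = 0
        rw [map_zero]; rfl
      smul_mem' := fun c a ha => by
        change fockRep hu (c * a) 1 = 0
        rw [map_mul, Module.End.mul_apply, show fockRep hu a 1 = 0 from ha, map_zero] }
  have hI : ∀ c, c ∈ I ↔ fockRep hu c 1 = 0 := fun _ => Iff.rfl
  have hne : (1 : Cl (4 * n + 3)) ∉ I := by
    rw [hI, map_one (fockRep hu), Module.End.one_apply]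
    exact fock_one_ne_zero
  have : Nontrivial (Cl (4 * n + 3) ⧸ I) :=
    Submodule.Quotient.nontrivial_iff.mpr fun ht => hne (ht ▸ Submodule.mem_top)
  have : Nontrivial (Module.End ℝ (Cl (4 * n + 3) ⧸ I)) := inferInstance
  refine eq_zero_of_map_eq_zero (Algebra.lsmul ℝ ℝ (Cl (4 * n + 3) ⧸ I)) hx ?_
  refine LinearMap.ext fun q => ?_
  obtain ⟨c, rfl⟩ := Submodule.Quotient.mk_surjective I q
  change Submodule.Quotient.mk (x * c) = 0
  rw [Submodule.Quotient.mk_eq_zero, hI]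
  have h2 : c ∈ Submodule.span ℝ (Set.range (Module.finBasis ℝ (Cl (4 * n + 3)))) := by
    rw [Module.Basis.span_eq]; exact Submodule.mem_top
  induction h2 using Submodule.span_induction with
  | mem y hy =>
    obtain ⟨i, rfl⟩ := hy
    exact congrFun h i
  | zero => rw [mul_zero, map_zero]; rfl
  | add y z _ _ hy hz => rw [mul_add, map_add, LinearMap.add_apply, hy, hz, add_zero]
  | smul r y _ hy => rw [mul_smul_comm, map_smul, LinearMap.smul_apply, hy, smul_zero]

/-- Multiplication of elements of the Fock space by complex numbers. -/
def fockSMul (m : ℕ) : ℂ →ₗ[ℝ] Fock m →ₗ[ℝ] Fock m :=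
  LinearMap.mk₂ ℝ (fun c y => c • y) (fun c d y => add_smul c d y)
    (fun r c y => by rw [Complex.real_smul, mul_smul]; rfl) (fun c y y' => smul_add c y y')
    (fun r c y => smul_comm c (r : ℂ) y)

/-- The lift of the isotropy representation depends smoothly on the group element. -/
theorem exists_smooth_isoLift (hu : IsIsoFrame u) :
    ∃ F : SpuSpace (n + 1) → Cl (4 * n + 3), SmoothVal Set.univ F ∧
      ∀ k : isoCover n, F (spuEmb k.1) = isoLift hu k := by
  let b := Module.finBasis ℝ (Cl (4 * n + 3))
  choose F hF hFk using fun i => exists_smooth_conj hu (b i)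
  -- An even element is recovered linearly from its vacuum values, so it is enough that these values
  -- depend smoothly on the group element.
  obtain ⟨r, hr⟩ := LinearMap.exists_leftInverse_of_injective
    ((fockValues hu).domRestrict (evenPart (4 * n + 3))) (by
      rw [LinearMap.ker_eq_bot, injective_iff_map_eq_zero]
      intro x hx
      exact Subtype.ext (eq_zero_of_fockValues_eq_zero hu (mem_evenPart.mp x.2) hx))
  let vac : Cl (4 * n + 3) →ₗ[ℝ] Fock (n + 1) :=
    { toFun := fun c => fockRep hu c 1
      map_add' := fun c d => by rw [map_add]; rfl
      map_smul' := fun t c => by rw [map_smul]; rfl }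
  have hs : SmoothVal Set.univ fun p : SpuSpace (n + 1) =>
      (evenPart (4 * n + 3)).subtype (r fun i => p.2 ^ (n + 1) • vac (F i p)) :=
    ((SmoothVal.pi fun i => ((SmoothVal.linear Set.univ
      (LinearMap.snd ℝ (Fin (n + 1) → Fin (n + 1) → ℍ[ℝ]) ℂ)).pow (n + 1)).bilin
        ((hF i).map vac) (fockSMul (n + 1))).map r).map
      (evenPart (4 * n + 3)).subtype
  refine ⟨_, hs, fun k => ?_⟩
  have h1 : (isoLift hu k : Cl (4 * n + 3)) ∈ evenPart (4 * n + 3) :=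
    mem_evenPart.mpr (spin_involute _ _)
  have h2 : (fun i => (spuEmb k.1).2 ^ (n + 1) • vac (F i (spuEmb k.1))) =
      (fockValues hu).domRestrict (evenPart (4 * n + 3)) ⟨_, h1⟩ := by
    funext i
    -- Writing x b = (x b x*) x separates the conjugate, known to be smooth, from x, which acts on
    -- the vacuum by z^(n+1).
    have h3 : (isoLift hu k : Cl (4 * n + 3)) * b i = ((isoLift hu k : Cl (4 * n + 3)) * b i *
        star (isoLift hu k : Cl (4 * n + 3))) * isoLift hu k := by
      rw [mul_assoc, spin_star_mul, mul_one]
    change _ = fockRep hu ((isoLift hu k : Cl (4 * n + 3)) * b i) 1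
    rw [h3, map_mul, Module.End.mul_apply, (isLift_isoLift hu k).2, map_smul, hFk]
    rfl
  rw [h2]
  exact congrArg Subtype.val (LinearMap.congr_fun hr _)

end SmoothLift

/-! ### Positively oriented orthonormal frames. -/

section Frames

open Matrix

variable {n : ℕ}

/-- The determinant of a basis, with the first vector fixed, as an alternating form in the images
of vectors of `ℝ^{4n+3}`. -/
def frameForm (n : ℕ) (x : QuatSpace (n + 1)) (u : (Fin (4 * n + 3) → ℝ) →ₗ[ℝ] QuatSpace (n + 1)) :
    (Fin (4 * n + 3) → ℝ) [⋀^Fin (4 * n + 3)]→ₗ[ℝ] ℝ :=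
  ((quatBasis n).det.curryLeft x).compLinearMap u

theorem frameForm_apply (x : QuatSpace (n + 1))
    (u : (Fin (4 * n + 3) → ℝ) →ₗ[ℝ] QuatSpace (n + 1))
    (v : Fin (4 * n + 3) → Fin (4 * n + 3) → ℝ) :
    frameForm n x u v = (quatBasis n).det (Fin.cons x fun i => u (v i)) := rfl

/-- With x and u fixed, the determinant is an alternating form of top degree on ℝ^{4n+3}, and a
linear map multiplies such a form by its determinant. -/
theorem det_cons_comp (x : QuatSpace (n + 1))
    (u : (Fin (4 * n + 3) → ℝ) →ₗ[ℝ] QuatSpace (n + 1)) (g : Module.End ℝ (Fin (4 * n + 3) → ℝ)) :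
    (quatBasis n).det (Fin.cons x fun i => u (g (Pi.single i 1))) =
      LinearMap.det g * (quatBasis n).det (Fin.cons x fun i => u (Pi.single i 1)) := by
  have h := (frameForm n x u).eq_smul_basis_det (Pi.basisFun ℝ (Fin (4 * n + 3)))
  have h1 := congrArg (fun f => f fun i => g (Pi.single i 1)) h
  have h2 : (fun i => g (Pi.single i 1)) = g ∘ Pi.basisFun ℝ (Fin (4 * n + 3)) := by
    funext i; simp
  have h3 : (⇑(Pi.basisFun ℝ (Fin (4 * n + 3))) : Fin (4 * n + 3) → Fin (4 * n + 3) → ℝ) =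
      fun i => Pi.single i 1 := by
    funext i; simp
  simp only [AlternatingMap.smul_apply, smul_eq_mul] at h1
  rw [h2, Module.Basis.det_comp, Module.Basis.det_self, mul_one, ← h2, h3, frameForm_apply,
    frameForm_apply] at h1
  exact h1.trans (mul_comm _ _)

variable {x : Sph n} {u u' : (Fin (4 * n + 3) → ℝ) →ₗ[ℝ] QuatSpace (n + 1)}

theorem IsPosFrame.inner_map (h : IsPosFrame n x u) (v w : Fin (4 * n + 3) → ℝ) :
    ⟪u v, u w⟫ = v ⬝ᵥ w := by
  have h1 : ∀ v : Fin (4 * n + 3) → ℝ, u v = ∑ i, v i • u (Pi.single i 1) := by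
    intro v
    simp only [← map_smul, ← map_sum]
    congr 1
    funext j
    simp [Finset.sum_apply, Pi.single_apply]
  rw [h1 v, h1 w, h.2.1.inner_sum]
  simp [dotProduct]

theorem IsPosFrame.injective (h : IsPosFrame n x u) : Function.Injective u := by
  rw [injective_iff_map_eq_zero]
  intro v hv
  have h1 := h.inner_map v v
  rw [hv, inner_zero_left] at h1
  exact dotProduct_self_eq_zero.mp h1.symm

theorem finrank_quatSpace (m : ℕ) : Module.finrank ℝ (QuatSpace m) = 4 * m := by
  rw [(WithLp.linearEquiv 2 ℝ (Fin m → ℍ[ℝ])).finrank_eq, Module.finrank_pi_fintype]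
  simp [Quaternion.finrank_eq_four, mul_comm]

theorem finrank_orthogonal_sph (x : Sph n) :
    Module.finrank ℝ (Submodule.span ℝ {(x : QuatSpace (n + 1))})ᗮ = 4 * n + 3 := by
  have : Fact (Module.finrank ℝ (QuatSpace (n + 1)) = (4 * n + 3) + 1) :=
    ⟨by rw [finrank_quatSpace]; ring⟩
  exact Submodule.finrank_orthogonal_span_singleton (ne_zero_of_mem_unit_sphere x)

theorem IsPosFrame.exists_eq_iff (h : IsPosFrame n x u) (w : QuatSpace (n + 1)) :
    (∃ v, u v = w) ↔ ⟪(x : QuatSpace (n + 1)), w⟫ = 0 := by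
  have h1 : LinearMap.range u = (Submodule.span ℝ {(x : QuatSpace (n + 1))})ᗮ := by
    apply Submodule.eq_of_le_of_finrank_eq
    · rintro _ ⟨v, rfl⟩
      exact Submodule.mem_orthogonal_singleton_iff_inner_right.mpr (h.1 v)
    · rw [LinearMap.finrank_range_of_inj h.injective, finrank_orthogonal_sph]; simp
  rw [← Submodule.mem_orthogonal_singleton_iff_inner_right, ← h1]
  rfl

theorem spinRot_dotProduct_spinRot (N : ℕ) (μ : Spin N) (v w : Fin N → ℝ) :
    spinRot N μ v ⬝ᵥ spinRot N μ w = v ⬝ᵥ w := by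
  have h := spinRot_dotProduct N μ (v + w)
  rw [map_add, add_dotProduct, dotProduct_add, dotProduct_add, add_dotProduct, dotProduct_add,
    dotProduct_add, spinRot_dotProduct, spinRot_dotProduct, dotProduct_comm (spinRot N μ w),
    dotProduct_comm w v] at h
  linarith

theorem IsPosFrame.comp_spinRot (h : IsPosFrame n x u) (μ : Spin (4 * n + 3)) :
    IsPosFrame n x (u ∘ₗ spinRot (4 * n + 3) μ) := by
  refine ⟨fun v => h.1 _, ?_, ?_⟩
  · rw [orthonormal_iff_ite]
    intro i j
    rw [LinearMap.comp_apply, LinearMap.comp_apply, h.inner_map, spinRot_dotProduct_spinRot]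
    simp [Pi.single_apply, eq_comm]
  · change 0 < (quatBasis n).det (Fin.cons (x : QuatSpace (n + 1))
      fun i => u (spinRot (4 * n + 3) μ (Pi.single i 1)))
    rw [det_cons_comp, spinRot_det, one_mul]
    exact h.2.2

theorem IsPosFrame.exists_spinRot (h : IsPosFrame n x u) (h' : IsPosFrame n x u') :
    ∃ μ, u' = u ∘ₗ spinRot (4 * n + 3) μ := by
  obtain ⟨l, hl⟩ := LinearMap.exists_leftInverse_of_injective u
    (LinearMap.ker_eq_bot.mpr h.injective)
  have h1 : ∀ v, u (l (u' v)) = u' v := by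
    intro v
    obtain ⟨w, hw⟩ := (h.exists_eq_iff (u' v)).mpr (h'.1 v)
    rw [← hw]
    exact congrArg u (LinearMap.congr_fun hl w)
  obtain ⟨μ, hμ⟩ := spinRot_surjective (4 * n + 3) (l ∘ₗ u')
    (fun v => by
      rw [← h.inner_map, LinearMap.comp_apply, h1, h'.inner_map])
    (by
      have h2 := det_cons_comp (x : QuatSpace (n + 1)) u (l ∘ₗ u')
      simp only [LinearMap.comp_apply, h1] at h2
      have h3 := h'.2.2
      rw [h2] at h3
      exact pos_of_mul_pos_left h3 h.2.2.le)
  refine ⟨μ, LinearMap.ext fun v => ?_⟩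
  rw [LinearMap.comp_apply, hμ]
  exact (h1 v).symm

theorem inner_spuRep (g : SpU (n + 1)) (v w : QuatSpace (n + 1)) :
    ⟪spuRep (n + 1) g v, spuRep (n + 1) g w⟫ = ⟪v, w⟫ :=
  (⟨spuRep (n + 1) g, norm_spuRep (n + 1) g⟩ : QuatSpace (n + 1) →ₗᵢ[ℝ] QuatSpace (n + 1)).inner_map_map v w

theorem det_spuRep_ne_zero (m : ℕ) (g : SpU m) : LinearMap.det (spuRep m g) ≠ 0 := by
  intro h
  have h1 : LinearMap.det (spuRep m g) * LinearMap.det (spuRep m g⁻¹) = 1 := by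
    rw [← map_mul, ← map_mul, mul_inv_cancel, map_one, map_one]
  rw [h, zero_mul] at h1
  exact zero_ne_one h1

/-- Every element of the group is a product of squares, since `fix_induction` gives generators
coming from circles, where square roots exist. A square has positive determinant, so no
connectedness argument is needed. -/
theorem det_spuRep_pos (m : ℕ) (g : SpU m) : 0 < LinearMap.det (spuRep m g) := by
  have hsq : ∀ g : SpU m, 0 < LinearMap.det (spuRep m (g ^ 2)) := by
    intro g
    rw [map_pow, map_pow]
    exact lt_of_le_of_ne (sq_nonneg _) (pow_ne_zero 2 (det_spuRep_ne_zero m g)).symm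
  have hmul : ∀ g h : SpU m, 0 < LinearMap.det (spuRep m g) → 0 < LinearMap.det (spuRep m h) →
      0 < LinearMap.det (spuRep m (g * h)) := by
    intro g h hg hh
    rw [map_mul, map_mul]
    exact mul_pos hg hh
  induction g using QuotientGroup.induction_on with
  | H p =>
    obtain ⟨A, z⟩ := p
    obtain ⟨w, rfl⟩ := Circle.exists_sq z
    have hA : 0 < LinearMap.det (spuRep m (SpU.mk A 1)) := by
      refine fix_induction (fun A : Sp m => 0 < LinearMap.det (spuRep m (SpU.mk A 1))) ?_ _ ∅ rfl
        ?_ A (by simp)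
      · rw [show SpU.mk (1 : Sp m) 1 = 1 from rfl, map_one, map_one]
        exact one_pos
      · intro a ha _ z B hB
        obtain ⟨y, rfl⟩ := Circle.exists_sq z
        have h1 : SpU.mk (spRefl a ha (circleQuat (y ^ 2)) * B) 1 =
            (SpU.mk (spRefl a ha (circleQuat y)) 1) ^ 2 * SpU.mk B 1 := by
          rw [map_pow, map_pow, sq, sq]
          change _ = SpU.mk (_ * _ * _) (1 * 1 * 1)
          simp
        rw [h1]
        exact hmul _ _ (hsq _) hB
    have h2 : (QuotientGroup.mk (A, w ^ 2) : (Sp m × Circle) ⧸ spuCenter m) =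
        (SpU.mk A 1 * (SpU.mk 1 w) ^ 2 : SpU m) := by
      rw [sq, sq]
      change SpU.mk _ _ = SpU.mk (A * (1 * 1)) (1 * (w * w))
      simp
    exact h2 ▸ hmul _ _ hA (hsq _)

theorem IsPosFrame.spuRep_comp (h : IsPosFrame n x u) (g : SpU (n + 1)) :
    IsPosFrame n (g • x) (spuRep (n + 1) g ∘ₗ u) := by
  refine ⟨fun v => ?_, ?_, ?_⟩
  · change ⟪spuRep (n + 1) g x, spuRep (n + 1) g (u v)⟫ = 0
    rw [inner_spuRep]
    exact h.1 v
  · rw [orthonormal_iff_ite]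
    intro i j
    rw [LinearMap.comp_apply, LinearMap.comp_apply, inner_spuRep]
    exact orthonormal_iff_ite.mp h.2.1 i j
  · have h1 : (Fin.cons ((g • x : Sph n) : QuatSpace (n + 1))
        fun i => (spuRep (n + 1) g ∘ₗ u) (Pi.single i 1) : Fin (4 * n + 3 + 1) → QuatSpace (n + 1)) =
        spuRep (n + 1) g ∘ Fin.cons (x : QuatSpace (n + 1)) fun i => u (Pi.single i 1) := by
      funext i
      refine Fin.cases ?_ (fun i => ?_) i <;> rfl
    rw [h1, Module.Basis.det_comp]
    exact mul_pos (det_spuRep_pos _ _) h.2.2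

/-- The coordinates of a frame. -/
def frameCoord (u : (Fin (4 * n + 3) → ℝ) →ₗ[ℝ] QuatSpace (n + 1)) :
    (Fin (4 * n + 3) → ℝ) →ₗ[ℝ] (Fin (n + 1) → ℍ[ℝ]) :=
  (WithLp.linearEquiv 2 ℝ (Fin (n + 1) → ℍ[ℝ])).toLinearMap ∘ₗ u

theorem frameCoord_apply (u : (Fin (4 * n + 3) → ℝ) →ₗ[ℝ] QuatSpace (n + 1))
    (v : Fin (4 * n + 3) → ℝ) : frameCoord u v = (u v).ofLp := rfl

theorem inner_basePoint (w : QuatSpace (n + 1)) :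
    ⟪(basePoint n : QuatSpace (n + 1)), w⟫ = (w (Fin.last n)).re := by
  rw [PiLp.inner_apply, Finset.sum_eq_single (Fin.last n)]
  · simp [basePoint, Quaternion.inner_def]
  · intro i _ hi
    simp [basePoint, hi]
  · simp

theorem re_star_dotProduct_self {m : ℕ} (w : QuatSpace m) :
    (star w.ofLp ⬝ᵥ w.ofLp).re = ⟪w, w⟫ := by
  rw [PiLp.inner_apply, dotProduct, quat_sum_re]
  refine Finset.sum_congr rfl fun i _ => ?_
  rw [Quaternion.inner_def, Pi.star_apply, Quaternion.star_mul_self, Quaternion.self_mul_star]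

theorem IsPosFrame.isIsoFrame (h : IsPosFrame n (basePoint n) u) : IsIsoFrame (frameCoord u) where
  norm_sq v := by
    rw [frameCoord_apply, re_star_dotProduct_self, h.inner_map]
  mem_range w := by
    have h1 := h.exists_eq_iff (WithLp.toLp 2 w)
    rw [inner_basePoint] at h1
    rw [← show _ ↔ (w (Fin.last n)).re = 0 from h1]
    refine exists_congr fun v => ?_
    rw [frameCoord_apply, ← (WithLp.ofLp_injective 2).eq_iff]

theorem exists_isPosFrame (x : Sph n) : ∃ u, IsPosFrame n x u := by
  let b := (stdOrthonormalBasis ℝ (Submodule.span ℝ {(x : QuatSpace (n + 1))})ᗮ).reindex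
    (finCongr (finrank_orthogonal_sph x))
  let u : (Fin (4 * n + 3) → ℝ) →ₗ[ℝ] QuatSpace (n + 1) :=
    Submodule.subtype _ ∘ₗ (Pi.basisFun ℝ (Fin (4 * n + 3))).constr ℝ b
  have hu : ∀ i, u (Pi.single i 1) = b i := by
    intro i
    have h := (Pi.basisFun ℝ (Fin (4 * n + 3))).constr_basis ℝ b i
    rw [Pi.basisFun_apply] at h
    exact congrArg Subtype.val h
  have horth : ∀ v, ⟪(x : QuatSpace (n + 1)), u v⟫ = 0 := fun v =>
    Submodule.mem_orthogonal_singleton_iff_inner_right.mp (Submodule.coe_mem _)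
  have hon : Orthonormal ℝ fun i => u (Pi.single i 1) := by
    simp only [hu]
    exact b.orthonormal.comp_linearIsometry (Submodule.subtypeₗᵢ _)
  clear_value u
  clear hu
  have hcons : Orthonormal ℝ (Fin.cons (x : QuatSpace (n + 1)) fun i => u (Pi.single i 1) :
      Fin (4 * n + 3 + 1) → QuatSpace (n + 1)) := by
    rw [orthonormal_iff_ite]
    intro i j
    refine Fin.cases ?_ (fun i => ?_) i <;> refine Fin.cases ?_ (fun j => ?_) j
    · simp [norm_eq_of_mem_sphere x]
    · simp [horth, (Fin.succ_ne_zero j).symm]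
    · rw [Fin.cons_succ, Fin.cons_zero, real_inner_comm, horth]
      simp
    · rw [Fin.cons_succ, Fin.cons_succ, orthonormal_iff_ite.mp hon i j]
      simp
  have hfr : 4 * n + 3 + 1 = Module.finrank ℝ (QuatSpace (n + 1)) := by
    rw [finrank_quatSpace]; ring
  have hne : (quatBasis n).det (Fin.cons (x : QuatSpace (n + 1)) fun i => u (Pi.single i 1)) ≠ 0 := by
    have h1 := (quatBasis n).isUnit_det (basisOfLinearIndependentOfCardEqFinrank
      hcons.linearIndependent ((Fintype.card_fin _).trans hfr))
    rw [coe_basisOfLinearIndependentOfCardEqFinrank] at h1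
    exact h1.ne_zero
  rcases lt_or_gt_of_ne hne with h | h
  -- A frame of the wrong orientation is corrected by -1, whose determinant is -1 because 4n+3 is
  -- odd.
  · refine ⟨u ∘ₗ (-1 : Module.End ℝ (Fin (4 * n + 3) → ℝ)), fun v => horth ((-1 : Module.End ℝ _) v), ?_, ?_⟩
    · rw [orthonormal_iff_ite]
      intro i j
      simp only [LinearMap.comp_apply, LinearMap.neg_apply, Module.End.one_apply, map_neg,
        inner_neg_neg]
      exact orthonormal_iff_ite.mp hon i j
    · have h1 := det_cons_comp (x : QuatSpace (n + 1)) u (-1)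
      have h2 : LinearMap.det (-1 : Module.End ℝ (Fin (4 * n + 3) → ℝ)) = -1 := by
        have h3 := LinearMap.det_smul (-1 : ℝ) (LinearMap.id : Module.End ℝ (Fin (4 * n + 3) → ℝ))
        have h4 : Odd (4 * n + 3) := ⟨2 * n + 1, by ring⟩
        rw [LinearMap.det_id, Module.finrank_fin_fun, mul_one, h4.neg_one_pow] at h3
        rw [← h3]
        congr 1
        refine LinearMap.ext fun v => ?_
        simp
      change 0 < (quatBasis n).det (Fin.cons (x : QuatSpace (n + 1)) fun i => u _)
      rw [h1, h2]
      linarith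
  · exact ⟨u, horth, hon, h⟩

end Frames

/-! ### Smooth local sections of Sp(n+1) → S^{4n+3}. -/

section LocalSections

open Matrix

variable {n : ℕ}

theorem star_dotProduct_of_mem_sph (x : Sph n) :
    star (x : QuatSpace (n + 1)).ofLp ⬝ᵥ (x : QuatSpace (n + 1)).ofLp = 1 := by
  have h := re_star_dotProduct_self (x : QuatSpace (n + 1))
  rw [real_inner_self_eq_norm_sq, norm_eq_of_mem_sphere x, star_dotProduct_self,
    Quaternion.re_coe] at h
  rw [star_dotProduct_self, h]
  simp

theorem smul_basePoint_eq_iff (A : Sp (n + 1)) (z : Circle) (x : Sph n) :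
    SpU.mk A z • basePoint n = x ↔
      spuFun (A : Matrix (Fin (n + 1)) (Fin (n + 1)) ℍ[ℝ]) z (Pi.single (Fin.last n) 1) =
        (x : QuatSpace (n + 1)).ofLp := by
  rw [Subtype.ext_iff, ← (WithLp.ofLp_injective 2).eq_iff]
  rfl

theorem smul_basePoint_one_eq_iff (A : Sp (n + 1)) (x : Sph n) :
    SpU.mk A 1 • basePoint n = x ↔ (A : Matrix (Fin (n + 1)) (Fin (n + 1)) ℍ[ℝ]) *ᵥ
      Pi.single (Fin.last n) 1 = (x : QuatSpace (n + 1)).ofLp := by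
  rw [smul_basePoint_eq_iff]
  have h : ∀ v, spuFun (A : Matrix (Fin (n + 1)) (Fin (n + 1)) ℍ[ℝ]) 1 v =
      (A : Matrix (Fin (n + 1)) (Fin (n + 1)) ℍ[ℝ]) *ᵥ v := by
    intro v
    funext i
    simp [spuFun]
  rw [h]

theorem star_smul_vec {m : ℕ} (ε : ℝ) (v : Fin m → ℍ[ℝ]) : star (ε • v) = ε • star v := by
  funext i
  ext <;> simp

theorem star_smul_matrix {m : ℕ} (ε : ℝ) (A : Matrix (Fin m) (Fin m) ℍ[ℝ]) :
    star (ε • A) = ε • star A := by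
  ext1 i j
  ext <;> simp [star_apply]

/-- The matrix `ε · reflTo (ε e) x`, where `e` is the last basis vector. -/
def sectionMatrix (n : ℕ) (ε : ℝ) (x : Fin (n + 1) → ℍ[ℝ]) :
    Matrix (Fin (n + 1)) (Fin (n + 1)) ℍ[ℝ] :=
  ε • reflTo (ε • Pi.single (Fin.last n) 1) x

theorem one_sub_smul_ne_zero_iff {ε : ℝ} (hε : ε * ε = 1) (x : Sph n) :
    (1 - ε • star ((x : QuatSpace (n + 1)) (Fin.last n)) ≠ 0) ↔
      ε • Pi.single (Fin.last n) 1 ≠ (x : QuatSpace (n + 1)).ofLp := by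
  have he : star (ε • Pi.single (Fin.last n) 1 : Fin (n + 1) → ℍ[ℝ]) ⬝ᵥ
      (ε • Pi.single (Fin.last n) 1 : Fin (n + 1) → ℍ[ℝ]) = 1 := by
    rw [star_smul_vec, smul_dotProduct, dotProduct_smul, single_unit, smul_smul, hε,
      one_smul]
  have h1 : (1 : ℍ[ℝ]) - ε • star ((x : QuatSpace (n + 1)) (Fin.last n)) =
      1 - star (x : QuatSpace (n + 1)).ofLp ⬝ᵥ (ε • Pi.single (Fin.last n) 1) := by
    rw [dotProduct_smul]; simp
  constructor
  · intro h h2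
    rw [h1, h2, star_dotProduct_of_mem_sph, sub_self] at h
    exact h rfl
  · intro h
    rw [h1]
    exact one_sub_ne_zero he (star_dotProduct_of_mem_sph x) h

/-- The reflection takes ε e to x, and the factor ε in front makes the matrix take e to x. The
formula breaks down only at x = ε e, so the two signs cover the sphere. -/
theorem sectionMatrix_spec {ε : ℝ} (hε : ε * ε = 1) {x : Sph n}
    (h : 1 - ε • star ((x : QuatSpace (n + 1)) (Fin.last n)) ≠ 0) :
    ∃ A : Sp (n + 1), SpU.mk A 1 • basePoint n = x ∧
      (A : Matrix (Fin (n + 1)) (Fin (n + 1)) ℍ[ℝ]) =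
        sectionMatrix n ε (x : QuatSpace (n + 1)).ofLp := by
  have he : star (ε • Pi.single (Fin.last n) 1 : Fin (n + 1) → ℍ[ℝ]) ⬝ᵥ
      (ε • Pi.single (Fin.last n) 1 : Fin (n + 1) → ℍ[ℝ]) = 1 := by
    rw [star_smul_vec, smul_dotProduct, dotProduct_smul, single_unit, smul_smul, hε,
      one_smul]
  rw [one_sub_smul_ne_zero_iff hε] at h
  have h1 := reflTo_mem he (star_dotProduct_of_mem_sph x) h
  have h2 := reflTo_mulVec he (star_dotProduct_of_mem_sph x) h
  have h3 : sectionMatrix n ε (x : QuatSpace (n + 1)).ofLp ∈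
      unitary (Matrix (Fin (n + 1)) (Fin (n + 1)) ℍ[ℝ]) := by
    rw [Unitary.mem_iff] at h1 ⊢
    rw [sectionMatrix, star_smul_matrix, smul_mul_smul_comm, smul_mul_smul_comm, hε,
      h1.1, h1.2, one_smul]
    exact ⟨rfl, rfl⟩
  refine ⟨⟨_, h3⟩, ?_, rfl⟩
  rw [smul_basePoint_one_eq_iff]
  change sectionMatrix n ε _ *ᵥ _ = _
  rw [sectionMatrix, smul_mulVec, ← mulVec_smul, h2]

theorem exists_sign (x : Sph n) : ∃ ε : ℝ, ε * ε = 1 ∧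
    1 - ε • star ((x : QuatSpace (n + 1)) (Fin.last n)) ≠ 0 := by
  by_cases h : 1 - star ((x : QuatSpace (n + 1)) (Fin.last n)) = 0
  · refine ⟨-1, by norm_num, ?_⟩
    rw [← sub_eq_zero.mp h]
    intro h1
    have h2 := congrArg QuaternionAlgebra.re h1
    rw [Quaternion.re_sub, Quaternion.re_smul, Quaternion.re_one, Quaternion.re_zero] at h2
    norm_num at h2
  · exact ⟨1, by norm_num, by rwa [one_smul]⟩

theorem exists_smul_basePoint (x : Sph n) : ∃ A : Sp (n + 1), SpU.mk A 1 • basePoint n = x := by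
  obtain ⟨ε, hε, h⟩ := exists_sign x
  obtain ⟨A, hA, -⟩ := sectionMatrix_spec hε h
  exact ⟨A, hA⟩

theorem contDiffOn_quat_inv {V : Type*} [NormedAddCommGroup V] [NormedSpace ℝ V] {O : Set V}
    {f : V → ℍ[ℝ]} (hf : ContDiffOn ℝ ∞ f O) (h0 : ∀ x ∈ O, f x ≠ 0) :
    ContDiffOn ℝ ∞ (fun x => (f x)⁻¹) O := by
  intro x hx
  have h := contDiffAt_ringInverse ℝ (n := ∞) (Units.mk0 (f x) (h0 x hx))
  have h1 : ContDiffAt ℝ ∞ (Inv.inv : ℍ[ℝ] → ℍ[ℝ]) (f x) := by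
    simpa only [Ring.inverse_eq_inv'] using! h
  exact h1.comp_contDiffWithinAt x (hf x hx)

/-- Quaternionic conjugation as a linear map. -/
def quatStar : ℍ[ℝ] →ₗ[ℝ] ℍ[ℝ] where
  toFun := star
  map_add' := star_add
  map_smul' r q := by ext <;> simp

theorem contDiff_quat_star : ContDiff ℝ ∞ (star : ℍ[ℝ] → ℍ[ℝ]) :=
  (LinearMap.toContinuousLinearMap (quatStar : ℍ[ℝ] →ₗ[ℝ] ℍ[ℝ])).contDiff

theorem contDiffOn_sectionMatrix (ε : ℝ) :
    ContDiffOn ℝ ∞ (fun (x : QuatSpace (n + 1)) i j => sectionMatrix n ε x.ofLp i j)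
      {x | 1 - ε • star (x (Fin.last n)) ≠ 0} := by
  have hproj : ∀ i (O : Set (QuatSpace (n + 1))), ContDiffOn ℝ ∞
      (fun x : QuatSpace (n + 1) => x i) O := fun i O =>
    (PiLp.proj (𝕜 := ℝ) 2 (fun _ : Fin (n + 1) => ℍ[ℝ]) i).contDiff.contDiffOn
  have hstar : ∀ i (O : Set (QuatSpace (n + 1))), ContDiffOn ℝ ∞
      (fun x : QuatSpace (n + 1) => star (x i)) O := fun i O =>
    contDiff_quat_star.comp_contDiffOn (hproj i O)
  refine contDiffOn_pi.mpr fun i => contDiffOn_pi.mpr fun j => ?_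
  have h : ∀ x : QuatSpace (n + 1), sectionMatrix n ε x.ofLp i j =
      ε • ((1 : Matrix (Fin (n + 1)) (Fin (n + 1)) ℍ[ℝ]) i j +
        ((ε • Pi.single (Fin.last n) 1 : Fin (n + 1) → ℍ[ℝ]) i - x i) *
          (-(1 - ε • star (x (Fin.last n)))⁻¹ *
            (star ((ε • Pi.single (Fin.last n) 1 : Fin (n + 1) → ℍ[ℝ]) j) - star (x j)))) := by
    intro x
    rw [sectionMatrix, reflTo, quatRefl, dotProduct_smul]
    simp
  refine ContDiffOn.congr ?_ fun x _ => h x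
  refine (contDiffOn_const.add ((contDiffOn_const.sub (hproj i _)).mul
    (((contDiffOn_quat_inv (contDiffOn_const.sub ((hstar _ _).const_smul ε)) ?_).neg).mul
      (contDiffOn_const.sub (hstar j _))))).const_smul ε
  intro x hx
  exact hx

/-- The homogeneous space `S^{4n+3}` of `Sp(n+1)` has smooth local sections. -/
theorem exists_local_section (x₀ : Sph n) : ∃ (O : Set (QuatSpace (n + 1))) (M : Sph n → Sp (n + 1))
    (F : QuatSpace (n + 1) → Fin (n + 1) → Fin (n + 1) → ℍ[ℝ]), IsOpen O ∧
    (x₀ : QuatSpace (n + 1)) ∈ O ∧ (∀ x, SpU.mk (M x) 1 • basePoint n = x) ∧ ContDiffOn ℝ ∞ F O ∧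
    ∀ x : Sph n, (x : QuatSpace (n + 1)) ∈ O → ∀ i j,
      F x i j = (M x : Matrix (Fin (n + 1)) (Fin (n + 1)) ℍ[ℝ]) i j := by
  obtain ⟨ε, hε, h0⟩ := exists_sign x₀
  have hM : ∀ x : Sph n, ∃ A : Sp (n + 1), SpU.mk A 1 • basePoint n = x ∧
      (1 - ε • star ((x : QuatSpace (n + 1)) (Fin.last n)) ≠ 0 →
        (A : Matrix (Fin (n + 1)) (Fin (n + 1)) ℍ[ℝ]) =
          sectionMatrix n ε (x : QuatSpace (n + 1)).ofLp) := by
    intro x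
    by_cases h : 1 - ε • star ((x : QuatSpace (n + 1)) (Fin.last n)) ≠ 0
    · obtain ⟨A, hA, hA'⟩ := sectionMatrix_spec hε h
      exact ⟨A, hA, fun _ => hA'⟩
    · obtain ⟨A, hA⟩ := exists_smul_basePoint x
      exact ⟨A, hA, fun h' => absurd h' h⟩
  choose M hM1 hM2 using hM
  refine ⟨{x | 1 - ε • star (x (Fin.last n)) ≠ 0}, M, _, ?_, h0, hM1, contDiffOn_sectionMatrix ε,
    fun x hx i j => by rw [hM2 x hx]⟩
  refine isOpen_ne_fun (Continuous.sub continuous_const (Continuous.const_smul (continuous_star.comp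
    (PiLp.continuous_apply 2 _ _)) ε)) continuous_const

end LocalSections

/-! ### Isotropy homomorphisms and the cocycles of local sections. -/

section Construction

open Matrix

variable {n r : ℕ}

/-- The class `[μ, ν] ∈ Spin^r(N)`. -/
def spinRMk (N r : ℕ) : Spin N × Spin r →* SpinR N r :=
  QuotientGroup.mk' (spinCenter N r)

theorem spinRMk_surjective (N r : ℕ) : Function.Surjective (spinRMk N r) :=
  QuotientGroup.mk'_surjective _

theorem lamR_spinRMk (N r : ℕ) (x : Spin N × Spin r) :
    lamR N r (spinRMk N r x) = spinRot N x.1 := rfl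

theorem xiR_spinRMk (N r : ℕ) (x : Spin N × Spin r) :
    xiR N r (spinRMk N r x) = spinRot r x.2 := rfl

theorem spinREmb_spinRMk (N r : ℕ) (x : Spin N × Spin r) :
    spinREmb N r (spinRMk N r x) = (x.1 : Cl N) ⊗ₜ[ℝ] (x.2 : Cl r) := rfl

theorem spinRMk_eq_one_iff (N r : ℕ) (x : Spin N × Spin r) :
    spinRMk N r x = 1 ↔ ((x.1 : Cl N) = 1 ∧ (x.2 : Cl r) = 1) ∨
      ((x.1 : Cl N) = -1 ∧ (x.2 : Cl r) = -1) :=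
  QuotientGroup.eq_one_iff x

/-- The projection of `isoCover n` onto the isotropy group. -/
def isoProj (n : ℕ) : isoCover n →* isotropy n where
  toFun k := ⟨SpU.mk k.1.1 k.1.2, k.2⟩
  map_one' := rfl
  map_mul' _ _ := rfl

theorem isoProj_surjective (n : ℕ) : Function.Surjective (isoProj n) := by
  rintro ⟨h, hh⟩
  induction h using QuotientGroup.induction_on with
  | H k => exact ⟨⟨k, hh⟩, rfl⟩

theorem eq_of_isoProj_eq_one {k : isoCover n} (h : isoProj n k = 1) :
    k = 1 ∨ k = isoNegOne n := by
  have h1 : k.1 ∈ spuCenter (n + 1) := (QuotientGroup.eq_one_iff k.1).mp (congrArg Subtype.val h)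
  rcases h1 with ⟨h1, h2⟩ | ⟨h1, h2⟩
  · exact Or.inl (Subtype.ext (Prod.ext (Subtype.ext h1) (Circle.ext h2)))
  · exact Or.inr (Subtype.ext (Prod.ext (Subtype.ext h1) (Circle.ext h2)))

variable {u : (Fin (4 * n + 3) → ℝ) →ₗ[ℝ] QuatSpace (n + 1)}

/-- The homomorphism `(A, z) ↦ [isoLift (A, z), ν z]`. -/
def coverTau (hu : IsPosFrame n (basePoint n) u) (ν : Circle →* Spin r) :
    isoCover n →* SpinR (4 * n + 3) r :=
  (spinRMk _ _).comp ((isoLift hu.isIsoFrame).prod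
    (ν.comp ((MonoidHom.snd _ _).comp (isoCover n).subtype)))

theorem coverTau_apply (hu : IsPosFrame n (basePoint n) u) (ν : Circle →* Spin r) (k : isoCover n) :
    coverTau hu ν k = spinRMk _ _ (isoLift hu.isIsoFrame k, ν k.1.2) := rfl

theorem coe_isoLift_isoNegOne (hu : IsPosFrame n (basePoint n) u) :
    (isoLift hu.isIsoFrame (isoNegOne n) : Cl (4 * n + 3)) = (-1) ^ (n + 1) := by
  rw [isoLift_isoNegOne]
  rfl

/-- The only nontrivial element of the kernel of `isoProj` is (-1, -1). The condition on ν gives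
both components of its image the same sign (-1)^(n+1), so their class in Spin^r is trivial. -/
theorem coverTau_eq_one (hu : IsPosFrame n (basePoint n) u) {ν : Circle →* Spin r}
    (hν : (ν (-1) : Cl r) = (-1) ^ (n + 1)) {k : isoCover n} (h : isoProj n k = 1) :
    coverTau hu ν k = 1 := by
  rcases eq_of_isoProj_eq_one h with rfl | rfl
  · exact map_one _
  · rw [coverTau_apply, spinRMk_eq_one_iff]
    change ((isoLift hu.isIsoFrame (isoNegOne n) : Cl (4 * n + 3)) = 1 ∧ (ν (-1) : Cl r) = 1) ∨ _
    change _ ∨ ((isoLift hu.isIsoFrame (isoNegOne n) : Cl (4 * n + 3)) = -1 ∧ (ν (-1) : Cl r) = -1)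
    rw [coe_isoLift_isoNegOne hu, hν]
    rcases Nat.even_or_odd (n + 1) with h1 | h1
    · rw [h1.neg_one_pow, h1.neg_one_pow]; exact Or.inl ⟨rfl, rfl⟩
    · rw [h1.neg_one_pow, h1.neg_one_pow]; exact Or.inr ⟨rfl, rfl⟩

/-- The homomorphism of the isotropy group induced by `coverTau`. -/
def isoTau (hu : IsPosFrame n (basePoint n) u) (ν : Circle →* Spin r)
    (hν : (ν (-1) : Cl r) = (-1) ^ (n + 1)) : isotropy n →* SpinR (4 * n + 3) r :=
  (isoProj n).liftOfSurjective (isoProj_surjective n)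
    ⟨coverTau hu ν, fun _ hk => coverTau_eq_one hu hν hk⟩

theorem isoTau_isoProj (hu : IsPosFrame n (basePoint n) u) (ν : Circle →* Spin r)
    (hν : (ν (-1) : Cl r) = (-1) ^ (n + 1)) (k : isoCover n) :
    isoTau hu ν hν (isoProj n k) = coverTau hu ν k :=
  MonoidHom.liftOfRightInverse_comp_apply _ _ (Function.rightInverse_surjInv (isoProj_surjective n))
    ⟨coverTau hu ν, fun _ hk => coverTau_eq_one hu hν hk⟩ k

theorem comp_spinRot_isoLift (hu : IsPosFrame n (basePoint n) u) (k : isoCover n) :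
    u ∘ₗ spinRot _ (isoLift hu.isIsoFrame k) = spuRep (n + 1) (isoProj n k) ∘ₗ u := by
  refine LinearMap.ext fun v => (WithLp.ofLp_injective 2) ?_
  exact (isLift_isoLift hu.isIsoFrame k).1 v

theorem comp_lamR_isoTau (hu : IsPosFrame n (basePoint n) u) (ν : Circle →* Spin r)
    (hν : (ν (-1) : Cl r) = (-1) ^ (n + 1)) (h : isotropy n) :
    u ∘ₗ lamR _ _ (isoTau hu ν hν h) = spuRep (n + 1) h ∘ₗ u := by
  obtain ⟨k, rfl⟩ := isoProj_surjective n h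
  rw [isoTau_isoProj, coverTau_apply, lamR_spinRMk]
  exact comp_spinRot_isoLift hu k

/-- A homomorphism `U(1) → Spin(r)` that is the restriction of a smooth function on `ℂ`. -/
def SmoothCharacter (ν : Circle →* Spin r) : Prop :=
  ∃ F : ℂ → Cl r, SmoothVal Set.univ F ∧ ∀ z : Circle, F z = ν z

theorem smoothOnVia_coverTau (hu : IsPosFrame n (basePoint n) u) {ν : Circle →* Spin r}
    (hν : SmoothCharacter ν) {T V : Type} [NormedAddCommGroup V] [NormedSpace ℝ V] {e : T → V}
    {U : Set T} {K : T → isoCover n} {O : Set V} (hO : IsOpen O) (hU : ∀ t ∈ U, e t ∈ O)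
    {Φ : V → SpuSpace (n + 1)} (hΦ : ContDiffOn ℝ ∞ Φ O)
    (hK : ∀ t ∈ U, Φ (e t) = spuEmb (K t).1) :
    SmoothOnVia e (fun t => spinREmb (4 * n + 3) r (coverTau hu ν (K t))) U := by
  obtain ⟨F, hF, hFk⟩ := exists_smooth_isoLift hu.isIsoFrame
  obtain ⟨G, hG, hGk⟩ := hν
  refine smoothOnVia_of_smoothVal fun t ht => ⟨O, fun x => F (Φ x) ⊗ₜ[ℝ] G (Φ x).2, hO, hU t ht,
    (hF.comp hΦ (Set.mapsTo_univ _ _)).bilin (hG.comp (contDiff_snd.comp_contDiffOn hΦ)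
      (Set.mapsTo_univ _ _)) (TensorProduct.mk ℝ _ _), fun t' ht' _ => ?_⟩
  dsimp only
  rw [hK t' ht', hFk, coverTau_apply, spinREmb_spinRMk]
  exact congrArg _ (hGk _)

theorem contDiffOn_matMul {V : Type*} [NormedAddCommGroup V] [NormedSpace ℝ V] {O : Set V} {m : ℕ}
    {f g : V → Fin m → Fin m → ℍ[ℝ]} (hf : ContDiffOn ℝ ∞ f O) (hg : ContDiffOn ℝ ∞ g O) :
    ContDiffOn ℝ ∞ (fun x i j => ∑ k, f x i k * g x k j) O :=
  contDiffOn_pi.mpr fun i => contDiffOn_pi.mpr fun j => ContDiffOn.sum fun k _ =>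
    (contDiffOn_pi.mp (contDiffOn_pi.mp hf i) k).mul (contDiffOn_pi.mp (contDiffOn_pi.mp hg k) j)

theorem contDiffOn_matStar {V : Type*} [NormedAddCommGroup V] [NormedSpace ℝ V] {O : Set V} {m : ℕ}
    {f : V → Fin m → Fin m → ℍ[ℝ]} (hf : ContDiffOn ℝ ∞ f O) :
    ContDiffOn ℝ ∞ (fun x i j => star (f x j i)) O :=
  contDiffOn_pi.mpr fun i => contDiffOn_pi.mpr fun j =>
    contDiff_quat_star.comp_contDiffOn (contDiffOn_pi.mp (contDiffOn_pi.mp hf j) i)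

/-- The frame `v ↦ A (u v)`, depending linearly on the matrix `A`. -/
def matFrame (u : (Fin (4 * n + 3) → ℝ) →ₗ[ℝ] QuatSpace (n + 1)) :
    (Fin (n + 1) → Fin (n + 1) → ℍ[ℝ]) →ₗ[ℝ] ((Fin (4 * n + 3) → ℝ) →ₗ[ℝ] QuatSpace (n + 1)) where
  toFun A := spuLin (n + 1) (Matrix.of A) 1 ∘ₗ u
  map_add' A B := by
    refine LinearMap.ext fun v => ?_
    ext1 i
    simp only [spuLin, LinearMap.comp_apply, LinearMap.coe_mk, AddHom.coe_mk, LinearMap.add_apply,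
      PiLp.add_apply]
    rw [← add_mul]
    congr 1
    exact congrFun (Matrix.add_mulVec A B _) i
  map_smul' c A := by
    refine LinearMap.ext fun v => ?_
    ext1 i
    simp only [spuLin, LinearMap.comp_apply, LinearMap.coe_mk, AddHom.coe_mk, LinearMap.smul_apply,
      PiLp.smul_apply, RingHom.id_apply]
    rw [← smul_mul_assoc]
    congr 1
    exact congrFun (Matrix.smul_mulVec c A _) i

/-- A family of local sections of `Sp(n+1) → S^{4n+3}` whose domains cover the sphere. -/
structure SectionAtlas (n : ℕ) where
  O : Sph n → Set (QuatSpace (n + 1))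
  M : Sph n → Sph n → Sp (n + 1)
  F : Sph n → QuatSpace (n + 1) → Fin (n + 1) → Fin (n + 1) → ℍ[ℝ]
  isOpen_O : ∀ i, IsOpen (O i)
  mem_O : ∀ i : Sph n, (i : QuatSpace (n + 1)) ∈ O i
  smul_base : ∀ i x, SpU.mk (M i x) 1 • basePoint n = x
  contDiffOn_F : ∀ i, ContDiffOn ℝ ∞ (F i) (O i)
  F_eq : ∀ i, ∀ x : Sph n, (x : QuatSpace (n + 1)) ∈ O i →
    F i x = fun k l => (M i x : Matrix (Fin (n + 1)) (Fin (n + 1)) ℍ[ℝ]) k l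

theorem nonempty_sectionAtlas (n : ℕ) : Nonempty (SectionAtlas n) := by
  choose O M F h1 h2 h3 h4 h5 using exists_local_section (n := n)
  exact ⟨⟨O, M, F, h1, h2, h3, h4, fun i x hx => funext fun k => funext fun l => h5 i x hx k l⟩⟩

theorem mk_mem_isoCover (Λ : SectionAtlas n) (i j : Sph n) (A : Sp (n + 1)) (z : Circle)
    (x : Sph n) : ((Λ.M j (SpU.mk A z • x))⁻¹ * (A * Λ.M i x), z) ∈ isoCover n := by
  change SpU.mk _ _ • basePoint n = basePoint n
  have h : SpU.mk ((Λ.M j (SpU.mk A z • x))⁻¹ * (A * Λ.M i x)) z =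
      (SpU.mk (Λ.M j (SpU.mk A z • x)) 1)⁻¹ * (SpU.mk A z * SpU.mk (Λ.M i x) 1) := by
    change _ = SpU.mk _ (1⁻¹ * (z * 1))
    simp
  rw [h, mul_smul, mul_smul, Λ.smul_base, inv_smul_eq_iff, Λ.smul_base]

/-- The element `(M_j(gx)⁻¹ g M_i(x))` of the isotropy group, for `g = (A, z)`. -/
def SectionAtlas.coc (Λ : SectionAtlas n) (i j : Sph n) (A : Sp (n + 1)) (z : Circle) (x : Sph n) :
    isoCover n := ⟨_, mk_mem_isoCover Λ i j A z x⟩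

/-- The isotropy element `s(gx)⁻¹ g s(x)` for a set-theoretic section `s`. -/
def cocElt (a b : SpU (n + 1)) (h : a • basePoint n = b • basePoint n) : isotropy n :=
  ⟨a⁻¹ * b, by
    rw [MulAction.mem_stabilizer_iff, mul_smul, inv_smul_eq_iff]
    exact h.symm⟩

/-- This cocycle identity, with `cocElt_smul`, yields the transition functions and the action laws
of `homogeneousStructure`. -/
theorem cocElt_mul {a b c : SpU (n + 1)} (h : a • basePoint n = b • basePoint n)
    (h' : b • basePoint n = c • basePoint n) :
    cocElt a b h * cocElt b c h' = cocElt a c (h.trans h') :=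
  Subtype.ext (by simp [cocElt])

theorem cocElt_self (a : SpU (n + 1)) : cocElt a a rfl = 1 :=
  Subtype.ext (by simp [cocElt])

theorem cocElt_smul {a b : SpU (n + 1)} (g : SpU (n + 1))
    (h : a • basePoint n = b • basePoint n) :
    cocElt (g * a) (g * b) (by rw [mul_smul, mul_smul, h]) = cocElt a b h :=
  Subtype.ext (by simp [cocElt, mul_assoc])

theorem cocElt_congr {a b c d : SpU (n + 1)} (h : a • basePoint n = b • basePoint n)
    (hac : a = c) (hbd : b = d) : cocElt a b h = cocElt c d (hac ▸ hbd ▸ h) := by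
  subst hac hbd
  rfl

theorem isoProj_coc (Λ : SectionAtlas n) (i j : Sph n) (A : Sp (n + 1)) (z : Circle) (x : Sph n) :
    isoProj n (Λ.coc i j A z x) = cocElt (SpU.mk (Λ.M j (SpU.mk A z • x)) 1)
      (SpU.mk A z * SpU.mk (Λ.M i x) 1) (by rw [mul_smul, Λ.smul_base, Λ.smul_base]) := by
  refine Subtype.ext ?_
  change SpU.mk _ z = SpU.mk _ (1⁻¹ * (z * 1))
  congr 1
  simp

end Construction

/-! ### The invariant structure on G ×_H Spin^r. -/

section Structure

open Matrix

variable {n r : ℕ} {u : (Fin (4 * n + 3) → ℝ) →ₗ[ℝ] QuatSpace (n + 1)}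

/-- The point of the sphere over which `sigma` lies. -/
def SectionAtlas.sigma (Λ : SectionAtlas n) (x : Sph n) : SpU (n + 1) :=
  SpU.mk (Λ.M (basePoint n) x) 1

theorem SectionAtlas.sigma_smul (Λ : SectionAtlas n) (x : Sph n) :
    Λ.sigma x • basePoint n = x := Λ.smul_base _ x

/-- The normed space containing `(Sp(n+1) × U(1)) × S^{4n+3}`. -/
abbrev SpuSphSpace (n : ℕ) : Type :=
  (Fin (n + 1) → Fin (n + 1) → ℍ[ℝ]) × ℂ × QuatSpace (n + 1)

/-- The polynomial map extending the action of `Sp(n+1) × U(1)` on the sphere. -/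
def spuAct (n : ℕ) (w : SpuSphSpace n) : QuatSpace (n + 1) :=
  WithLp.toLp 2 fun a => (∑ b, w.1 a b * w.2.2 b) * ((star w.2.1 : ℂ) : ℍ[ℝ])

theorem contDiff_spuAct (n : ℕ) : ContDiff ℝ ∞ (spuAct n) := by
  have h1 : ∀ a b, SmoothVal Set.univ fun w : SpuSphSpace n => w.1 a b := fun a b =>
    smoothVal_of_contDiffOn (contDiffOn_pi.mp (contDiffOn_pi.mp contDiff_fst.contDiffOn a) b)
  have h2 : ∀ b, SmoothVal Set.univ fun w : SpuSphSpace n => w.2.2 b := fun b =>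
    smoothVal_of_contDiffOn (((PiLp.proj (𝕜 := ℝ) 2 (fun _ : Fin (n + 1) => ℍ[ℝ]) b).contDiff.comp
      contDiff_snd.snd).contDiffOn)
  have h3 : SmoothVal Set.univ fun w : SpuSphSpace n => w.2.1 :=
    smoothVal_of_contDiffOn contDiff_snd.fst.contDiffOn
  have h4 : SmoothVal Set.univ fun w : SpuSphSpace n => ((star w.2.1 : ℂ) : ℍ[ℝ]) :=
    h3.map (Quaternion.ofComplex.toLinearMap ∘ₗ Complex.conjAe.toLinearMap)
  have h5 : SmoothVal Set.univ fun (w : SpuSphSpace n) a =>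
      (∑ b, w.1 a b * w.2.2 b) * ((star w.2.1 : ℂ) : ℍ[ℝ]) :=
    SmoothVal.pi fun a => (SmoothVal.sum _ fun b _ => (h1 a b).mul (h2 b)).mul h4
  have h6 : SmoothVal Set.univ (spuAct n) :=
    h5.map (WithLp.linearEquiv 2 ℝ (Fin (n + 1) → ℍ[ℝ])).symm.toLinearMap
  exact contDiffOn_univ.mp h6.contDiffOn

theorem spuAct_spuSphEmb (A : Sp (n + 1)) (z : Circle) (x : Sph n) :
    spuAct n (spuSphEmb n ((A, z), x)) = ((SpU.mk A z • x : Sph n) : QuatSpace (n + 1)) := by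
  refine WithLp.ofLp_injective 2 ?_
  have h : ((SpU.mk A z • x : Sph n) : QuatSpace (n + 1)).ofLp =
    spuFun (A : Matrix (Fin (n + 1)) (Fin (n + 1)) ℍ[ℝ]) z (x : QuatSpace (n + 1)).ofLp := rfl
  rw [h]
  funext a
  rw [spuFun, Circle.coe_inv_eq_conj, mulVec, dotProduct]
  rfl

theorem contDiffOn_coc (Λ : SectionAtlas n) (i j : Sph n) :
    ∃ (O : Set (SpuSphSpace n)) (Φ : SpuSphSpace n → SpuSpace (n + 1)),
      IsOpen O ∧ ContDiffOn ℝ ∞ Φ O ∧ ∀ t : (Sp (n + 1) × Circle) × Sph n,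
        (t.2 : QuatSpace (n + 1)) ∈ Λ.O i →
        ((SpU.mk t.1.1 t.1.2 • t.2 : Sph n) : QuatSpace (n + 1)) ∈ Λ.O j →
        spuSphEmb n t ∈ O ∧ Φ (spuSphEmb n t) = spuEmb (Λ.coc i j t.1.1 t.1.2 t.2).1 := by
  have hsnd : ContDiff ℝ ∞ fun w : SpuSphSpace n => w.2.2 := contDiff_snd.snd
  refine ⟨(fun w : SpuSphSpace n => w.2.2) ⁻¹' Λ.O i ∩ spuAct n ⁻¹' Λ.O j, fun w =>
    (fun a b => ∑ c, star (Λ.F j (spuAct n w) c a) * ∑ d, w.1 c d * Λ.F i w.2.2 d b, w.2.1),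
    ((Λ.isOpen_O i).preimage hsnd.continuous).inter ((Λ.isOpen_O j).preimage (contDiff_spuAct n).continuous),
    ContDiffOn.prodMk (contDiffOn_matMul (contDiffOn_matStar ((Λ.contDiffOn_F j).comp
      (contDiff_spuAct n).contDiffOn fun w hw => hw.2)) (contDiffOn_matMul contDiff_fst.contDiffOn
      ((Λ.contDiffOn_F i).comp hsnd.contDiffOn fun w hw => hw.1))) contDiff_snd.fst.contDiffOn,
    fun t hi hj => ⟨⟨hi, ?_⟩, ?_⟩⟩
  · rw [Set.mem_preimage, spuAct_spuSphEmb]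
    exact hj
  · refine Prod.ext (funext fun a => funext fun b => ?_) rfl
    dsimp only
    rw [spuAct_spuSphEmb, Λ.F_eq j _ hj]
    change ∑ c, _ * ∑ d, _ * Λ.F i t.2 d b = _
    rw [Λ.F_eq i _ hi]
    rfl

/-- The invariant spin^r structure defined by a homomorphism `ν : U(1) → Spin(r)`. -/
def homogeneousStructure (Λ : SectionAtlas n) (hu : IsPosFrame n (basePoint n) u)
    (ν : Circle →* Spin r) (hν : (ν (-1) : Cl r) = (-1) ^ (n + 1)) (hs : SmoothCharacter ν) :
    InvariantSpinStructure n r where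
  -- This is G ×_H Spin^r, written as a product by means of the set-theoretic section `sigma`: the
  -- pair (x, k) stands for the class [σ(x), k]. No continuity of `sigma` is required, because the
  -- smooth structure is carried by the local sections, where `sec i x` stands for [M_i(x), 1].
  P := Sph n × SpinR (4 * n + 3) r
  act p k := (p.1, p.2 * k)
  act_one p := by simp
  act_mul p k l := by simp [mul_assoc]
  proj p := p.1
  proj_act _ _ := rfl
  act_simply_transitive p q h := by
    refine ⟨p.2⁻¹ * q.2, Prod.ext h (by simp), fun k hk => ?_⟩
    rw [eq_inv_mul_iff_mul_eq]
    exact congrArg Prod.snd hk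
  I := Sph n
  dom i := {x | (x : QuatSpace (n + 1)) ∈ Λ.O i}
  isOpen_dom i := (Λ.isOpen_O i).preimage continuous_subtype_val
  exists_mem_dom x := ⟨x, Λ.mem_O x⟩
  sec i x := (x, isoTau hu ν hν (cocElt (Λ.sigma x) (SpU.mk (Λ.M i x) 1)
    (by rw [Λ.sigma_smul, Λ.smul_base])))
  proj_sec _ _ _ := rfl
  smooth_transition i j := by
    have hone : ∀ x : Sph n, SpU.mk (1 : Sp (n + 1)) 1 • x = x := fun x => one_smul _ x
    -- The section `sigma` cancels: the transition function is the image of M_i(x)⁻¹ M_j(x), which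
    -- is smooth on the overlap.
    refine ⟨fun x => coverTau hu ν (Λ.coc j i 1 1 x), fun x _ => Prod.ext rfl ?_, ?_⟩
    · dsimp only
      rw [← isoTau_isoProj hu ν hν, ← map_mul, isoProj_coc, cocElt_congr _
        (show SpU.mk (Λ.M i (SpU.mk 1 1 • x)) 1 = SpU.mk (Λ.M i x) 1 by rw [hone])
        (show SpU.mk 1 1 * SpU.mk (Λ.M j x) 1 = SpU.mk (Λ.M j x) 1 from one_mul _), cocElt_mul]
    · obtain ⟨O, Φ, hO, hΦ, hK⟩ := contDiffOn_coc Λ j i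
      let em : QuatSpace (n + 1) → (Fin (n + 1) → Fin (n + 1) → ℍ[ℝ]) × ℂ × QuatSpace (n + 1) :=
        fun x => (fun a b => (1 : Matrix (Fin (n + 1)) (Fin (n + 1)) ℍ[ℝ]) a b, 1, x)
      have hem : ContDiff ℝ ∞ em := contDiff_const.prodMk (contDiff_const.prodMk contDiff_id)
      have hem' : ∀ x : Sph n, em x = spuSphEmb n ((1, 1), x) := fun x => rfl
      have hK' := fun (x : Sph n) (hx : x ∈ {x : Sph n | (x : QuatSpace (n + 1)) ∈ Λ.O i} ∩
        {x : Sph n | (x : QuatSpace (n + 1)) ∈ Λ.O j}) => hK ((1, 1), x) hx.2 (by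
          dsimp only
          rw [hone]
          exact hx.1)
      refine smoothOnVia_coverTau hu hs (hO.preimage hem.continuous)
        (fun x hx => (hK' x hx).1) (hΦ.comp hem.contDiffOn fun x hx => hx) fun x hx => (hK' x hx).2
  frame p := spuRep (n + 1) (Λ.sigma p.1) ∘ₗ u ∘ₗ lamR _ _ p.2
  isPosFrame_frame p := by
    obtain ⟨x, k⟩ := p
    obtain ⟨m, rfl⟩ := spinRMk_surjective _ _ k
    have h := (hu.comp_spinRot m.1).spuRep_comp (Λ.sigma x)
    rw [Λ.sigma_smul] at h
    exact h
  frame_act p k := by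
    rw [map_mul]
    rfl
  smooth_frame i := by
    refine smoothOnVia_of_smoothVal fun x hx => ⟨Λ.O i, fun y => matFrame u (Λ.F i y),
      Λ.isOpen_O i, hx, (smoothVal_of_contDiffOn (Λ.contDiffOn_F i)).map (matFrame u),
      fun y _ hy => ?_⟩
    dsimp only
    rw [comp_lamR_isoTau, ← LinearMap.comp_assoc]
    change _ = (spuRep (n + 1) (Λ.sigma y) * spuRep (n + 1) ((Λ.sigma y)⁻¹ * _)) ∘ₗ u
    rw [← map_mul, mul_inv_cancel_left, Λ.F_eq i y hy]
    rfl
  gact g p := (g • p.1, isoTau hu ν hν (cocElt (Λ.sigma (g • p.1)) (g * Λ.sigma p.1)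
    (by rw [mul_smul, Λ.sigma_smul, Λ.sigma_smul])) * p.2)
  gact_one p := by
    refine Prod.ext (one_smul _ _) ?_
    dsimp only
    rw [cocElt_congr _ (show Λ.sigma ((1 : SpU (n + 1)) • p.1) = Λ.sigma p.1 by rw [one_smul])
      (one_mul (Λ.sigma p.1)), cocElt_self, map_one, one_mul]
  gact_mul g h p := by
    refine Prod.ext (mul_smul _ _ _) ?_
    dsimp only
    rw [← mul_assoc, ← map_mul, ← cocElt_smul (a := Λ.sigma (h • p.1)) g, cocElt_mul]
    congr 2
    exact cocElt_congr _ (by rw [mul_smul]) (mul_assoc _ _ _)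
  gact_act g p k := by
    refine Prod.ext rfl ?_
    exact (mul_assoc _ _ _).symm
  proj_gact _ _ := rfl
  frame_gact g p := by
    rw [map_mul]
    change spuRep (n + 1) (Λ.sigma (g • p.1)) ∘ₗ (u ∘ₗ lamR _ _ (isoTau hu ν hν _)) ∘ₗ lamR _ _ p.2 = _
    rw [comp_lamR_isoTau]
    change (spuRep (n + 1) (Λ.sigma (g • p.1)) * spuRep (n + 1) ((Λ.sigma (g • p.1))⁻¹ *
      (g * Λ.sigma p.1))) ∘ₗ u ∘ₗ _ = _
    rw [← map_mul, mul_inv_cancel_left, map_mul]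
    rfl
  smooth_gact i j := by
    refine ⟨fun t => coverTau hu ν (Λ.coc i j t.1.1 t.1.2 t.2), fun A z x _ _ => Prod.ext rfl ?_, ?_⟩
    · dsimp only
      rw [← isoTau_isoProj hu ν hν, ← map_mul, ← map_mul, isoProj_coc,
        ← cocElt_smul (a := Λ.sigma x) (SpU.mk A z), cocElt_mul, cocElt_mul]
    · obtain ⟨O, Φ, hO, hΦ, hK⟩ := contDiffOn_coc Λ i j
      exact smoothOnVia_coverTau hu hs hO (fun t ht => (hK t ht.1 ht.2).1) hΦ
        fun t ht => (hK t ht.1 ht.2).2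

end Structure

/-! ### Characters of the circle and the homomorphisms φₛ. -/

section Characters

/-- Multiplicativity carries differentiability from 0 to every point as f' = c f, and then f(t)
exp(-c t) has derivative zero. -/
theorem eq_exp_of_add_eq_mul {f : ℝ → ℂ} (h0 : f 0 = 1) (hf : ∀ s t, f (s + t) = f s * f t)
    (hd : DifferentiableAt ℝ f 0) : ∃ c : ℂ, ∀ t, f t = Complex.exp (c * t) := by
  set c := deriv f 0 with hc
  have h1 : ∀ t, HasDerivAt f (f t * c) t := by
    intro t
    have h2 : HasDerivAt f c (t - t) := by rw [sub_self]; exact hd.hasDerivAt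
    have h3 := (h2.comp_sub_const t t).const_mul (f t)
    refine h3.congr_of_eventuallyEq (Filter.Eventually.of_forall fun s => ?_)
    dsimp only
    rw [← hf, add_sub_cancel]
  have h2 : ∀ t : ℝ, HasDerivAt (fun t : ℝ => Complex.exp (-(c * t))) (Complex.exp (-(c * t)) * (-c)) t := by
    intro t
    have h3 : HasDerivAt (fun t : ℝ => -(c * (t : ℂ))) (-(c * 1)) t :=
      ((Complex.ofRealCLM.hasDerivAt (x := t)).const_mul c).neg
    rw [mul_one] at h3
    exact h3.cexp
  have h3 : ∀ t, HasDerivAt (fun t : ℝ => f t * Complex.exp (-(c * t))) 0 t := by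
    intro t
    have h4 := (h1 t).mul (h2 t)
    convert! h4 using 1
    ring
  refine ⟨c, fun t => ?_⟩
  have h4 := is_const_of_deriv_eq_zero (fun t => (h3 t).differentiableAt) (fun t => (h3 t).deriv) t 0
  simp only [h0, Complex.ofReal_zero, mul_zero, neg_zero, Complex.exp_zero, mul_one] at h4
  rw [Complex.exp_neg, mul_inv_eq_one₀ (Complex.exp_ne_zero _)] at h4
  exact h4

/-- A differentiable endomorphism of the circle is a power map. -/
theorem circle_hom_eq_zpow (χ : Circle →* Circle)
    (hd : DifferentiableAt ℝ (fun t : ℝ => (χ (Circle.exp t) : ℂ)) 0) :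
    ∃ k : ℤ, ∀ z, χ z = z ^ k := by
  obtain ⟨c, hc⟩ := eq_exp_of_add_eq_mul (f := fun t : ℝ => (χ (Circle.exp t) : ℂ)) (by simp)
    (fun s t => by rw [Circle.exp_add, map_mul, Circle.coe_mul]) hd
  have h1 := hc (2 * Real.pi)
  rw [Circle.exp_two_pi, map_one, Circle.coe_one] at h1
  obtain ⟨k, hk⟩ := Complex.exp_eq_one_iff.mp h1.symm
  have hpi : (2 * Real.pi : ℂ) ≠ 0 := by simp [Real.pi_ne_zero]
  have hk' : c = k * Complex.I := by
    push_cast at hk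
    apply mul_right_cancel₀ hpi
    rw [hk]; ring
  refine ⟨k, fun z => Circle.ext ?_⟩
  have h2 := hc (Complex.arg z)
  rw [Circle.exp_arg] at h2
  rw [h2, hk', Circle.coe_zpow, mul_assoc, Complex.exp_int_mul, mul_comm Complex.I, ← Circle.coe_exp,
    Circle.exp_arg]

theorem rotation_injective : Function.Injective rotation := by
  intro w z h
  have h1 := LinearMap.congr_fun h (Pi.single 0 1)
  apply Circle.ext
  apply Complex.ext
  · simpa [rotation] using congrFun h1 0
  · simpa [rotation] using congrFun h1 1

/-- As Spin(2) ≅ U(1) is abelian, ξ does not see conjugation in Spin². Hence the homomorphism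
attached to a structure does not depend on the chosen point. -/
theorem xiR_two_commute (N : ℕ) (k l : SpinR N 2) : xiR N 2 (k * l) = xiR N 2 (l * k) := by
  obtain ⟨⟨x, y⟩, rfl⟩ := spinRMk_surjective _ _ k
  obtain ⟨⟨x', y'⟩, rfl⟩ := spinRMk_surjective _ _ l
  obtain ⟨w, rfl⟩ := spinTwo_surjective y
  obtain ⟨w', rfl⟩ := spinTwo_surjective y'
  rw [← map_mul, ← map_mul, xiR_spinRMk, xiR_spinRMk]
  change spinRot 2 (spinTwo w * spinTwo w') = spinRot 2 (spinTwo w' * spinTwo w)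
  rw [← map_mul, ← map_mul, mul_comm]

theorem phi_isoProj {n : ℕ} (s : ℤ) (hs : Even s) (k : isoCover n) :
    phi n s hs (isoProj n k) = k.1.2 ^ s := rfl

theorem phi_injective {n : ℕ} {s t : ℤ} {hs : Even s} {ht : Even t}
    (h : phi n s hs = phi n t ht) : s = t := by
  by_contra hne
  have h1 : ∀ z : Circle, z ^ (s - t) = 1 := by
    intro z
    have h2 := DFunLike.congr_fun h (isoProj n (diagHom n z))
    rw [phi_isoProj, phi_isoProj] at h2
    rw [zpow_sub, mul_inv_eq_one]
    exact h2
  have hst : ((s - t : ℤ) : ℝ) ≠ 0 := Int.cast_ne_zero.mpr (sub_ne_zero.mpr hne)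
  -- At the argument π/(s - t), the power s - t takes the value -1 instead of 1.
  have h3 := congrArg (fun z : Circle => (z : ℂ)) (h1 (Circle.exp (Real.pi / ((s - t : ℤ) : ℝ))))
  rw [Circle.coe_zpow, Circle.coe_exp, ← Complex.exp_int_mul, Circle.coe_one] at h3
  have h4 : ((s - t : ℤ) : ℂ) * (((Real.pi / ((s - t : ℤ) : ℝ) : ℝ) : ℂ) * Complex.I) =
      Real.pi * Complex.I := by
    have : ((s - t : ℤ) : ℂ) ≠ 0 := Int.cast_ne_zero.mpr (sub_ne_zero.mpr hne)
    rw [Complex.ofReal_div, Complex.ofReal_intCast]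
    field_simp
  rw [h4, Complex.exp_pi_mul_I] at h3
  norm_num at h3

end Characters

/-! ### Existence of invariant structures. -/

section Existence

open Matrix

variable {n : ℕ} {u : (Fin (4 * n + 3) → ℝ) →ₗ[ℝ] QuatSpace (n + 1)}

theorem smoothCharacter_spinTwo_zpow (k : ℤ) :
    SmoothCharacter (spinTwo.comp (zpowGroupHom k)) := by
  have hlin : ∃ L : ℂ →ₗ[ℝ] Cl 2, ∀ w : Circle, L w = spinTwo w := by
    refine ⟨(Algebra.linearMap ℝ (Cl 2)) ∘ₗ Complex.reLm +
      (LinearMap.toSpanSingleton ℝ (Cl 2) (gen 2 0 * gen 2 1)) ∘ₗ Complex.imLm, fun w => ?_⟩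
    rw [coe_spinTwo]
    rfl
  obtain ⟨L, hL⟩ := hlin
  obtain ⟨m, rfl | rfl⟩ := k.eq_nat_or_neg
  · refine ⟨fun z => L (z ^ m), ((SmoothVal.linear _ LinearMap.id).pow m).map L, fun z => ?_⟩
    dsimp only
    rw [← Circle.coe_pow, hL]
    simp
  · refine ⟨fun z => L ((Complex.conjAe.toLinearMap z) ^ m),
      ((SmoothVal.linear _ Complex.conjAe.toLinearMap).pow m).map L, fun z => ?_⟩
    dsimp only
    have h : Complex.conjAe.toLinearMap (z : ℂ) = ((z⁻¹ : Circle) : ℂ) := by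
      rw [Circle.coe_inv_eq_conj]
      rfl
    rw [h, ← Circle.coe_pow, hL]
    simp

theorem coe_spinTwo_neg_one_zpow {k : ℤ} (hk : (-1 : ℂ) ^ k = (-1) ^ (n + 1)) :
    ((spinTwo.comp (zpowGroupHom k)) (-1) : Cl 2) = (-1) ^ (n + 1) := by
  have h1 : ((((-1 : Circle) ^ k : Circle)) : ℂ) = (-1) ^ (n + 1) := by
    rw [Circle.coe_zpow, ← hk]
    rfl
  change (spinTwo ((-1 : Circle) ^ k) : Cl 2) = _
  rw [coe_spinTwo, h1]
  rcases Nat.even_or_odd (n + 1) with h | h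
  · rw [h.neg_one_pow, h.neg_one_pow]; simp
  · rw [h.neg_one_pow, h.neg_one_pow]; simp

/-- The homogeneous structure with ν(z) = z^k in Spin(2) ≅ U(1) is used; applying ξ doubles the
exponent. -/
theorem exists_correspondsTo_phi {k : ℤ} (hk : (-1 : ℂ) ^ k = (-1) ^ (n + 1)) :
    ∃ S : InvariantSpinStructure n 2, S.CorrespondsTo (phi n (2 * k) (even_two_mul k)) := by
  obtain ⟨u, hu⟩ := exists_isPosFrame (basePoint n)
  obtain ⟨Λ⟩ := nonempty_sectionAtlas n
  have hν := coe_spinTwo_neg_one_zpow hk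
  refine ⟨homogeneousStructure Λ hu _ hν (smoothCharacter_spinTwo_zpow k), (basePoint n, 1), rfl, ?_⟩
  let b : isotropy n := ⟨Λ.sigma (basePoint n), Λ.sigma_smul _⟩
  -- The section `sigma` need not be 1 at the base point. The point (base point, 1) stands for [b,
  -- 1] with b = σ(base point), so its isotropy homomorphism is precomposed with h ↦ b⁻¹ h b; a
  -- homomorphism to the circle does not notice this.
  refine ⟨(isoTau hu _ hν).comp (MulAut.conj b⁻¹).toMonoidHom, fun h => ?_, fun h => ?_⟩
  · refine Prod.ext h.2 ?_
    change isoTau hu _ hν _ * 1 = 1 * isoTau hu _ hν _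
    rw [mul_one, one_mul]
    congr 1
    refine Subtype.ext ?_
    have h2 : Λ.sigma (h.1 • basePoint n) = Λ.sigma (basePoint n) :=
      congrArg Λ.sigma h.2
    change (Λ.sigma (h.1 • basePoint n))⁻¹ * (h.1 * Λ.sigma (basePoint n)) = _
    rw [h2]
    simp [b, mul_assoc]
  · have h1 : ∀ f : isotropy n →* Circle, f h = f (MulAut.conj b⁻¹ h) := by
      intro f
      simp [mul_comm]
    rw [h1]
    obtain ⟨l, hl⟩ := isoProj_surjective n (MulAut.conj b⁻¹ h)
    change xiR _ _ (isoTau hu _ hν (MulAut.conj b⁻¹ h)) = _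
    rw [← hl, isoTau_isoProj, coverTau_apply, xiR_spinRMk, phi_isoProj]
    change spinRot 2 (spinTwo (l.1.2 ^ k)) = _
    rw [spinRot_spinTwo, mul_comm 2 k, _root_.zpow_mul]
    rfl

theorem nonempty_of_odd (h : Odd n) : Nonempty (InvariantSpinStructure n 1) := by
  obtain ⟨u, hu⟩ := exists_isPosFrame (basePoint n)
  obtain ⟨Λ⟩ := nonempty_sectionAtlas n
  exact ⟨homogeneousStructure Λ hu 1 (by rw [h.add_one.neg_one_pow]; rfl)
    ⟨fun _ => 1, SmoothVal.const _ _, fun _ => rfl⟩⟩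

end Existence

/-! ### The form of the isotropy homomorphism of an arbitrary invariant structure. -/

section Necessity

open Matrix

variable {n r : ℕ}

theorem SpinStructure.act_injective (S : SpinStructure n r) {p : S.P}
    {k l : SpinR (4 * n + 3) r} (h : S.act p k = S.act p l) : k = l :=
  (S.act_simply_transitive p (S.act p l) (S.proj_act p l).symm).unique h rfl

theorem SpinStructure.exists_act_eq (S : SpinStructure n r) {p q : S.P} (h : S.proj p = S.proj q) :
    ∃ k, S.act p k = q := (S.act_simply_transitive p q h).exists

namespace InvariantSpinStructure

theorem exists_proj_eq (S : InvariantSpinStructure n r) (x : Sph n) : ∃ p, S.proj p = x := by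
  obtain ⟨i, hi⟩ := S.exists_mem_dom x
  exact ⟨_, S.proj_sec i x hi⟩

theorem exists_tau (S : InvariantSpinStructure n r) {p : S.P} (hp : S.proj p = basePoint n) :
    ∃ τ : isotropy n →* SpinR (4 * n + 3) r, ∀ h : isotropy n, S.gact h p = S.act p (τ h) := by
  have h1 : ∀ h : isotropy n, ∃ k, S.act p k = S.gact h p := by
    intro h
    apply S.exists_act_eq
    rw [S.proj_gact, hp]
    exact h.2.symm
  choose τ hτ using h1
  refine ⟨⟨⟨τ, S.act_injective (p := p) ?_⟩, fun g h => S.act_injective (p := p) ?_⟩, fun h => (hτ h).symm⟩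
  · rw [hτ, S.act_one]
    exact S.gact_one p
  · rw [hτ, S.act_mul, hτ, ← S.gact_act, hτ]
    exact S.gact_mul g h p

variable {S : InvariantSpinStructure n r} {p : S.P} {τ : isotropy n →* SpinR (4 * n + 3) r}

theorem isPosFrame_of_proj (hp : S.proj p = basePoint n) :
    IsPosFrame n (basePoint n) (S.frame p) := hp ▸ S.isPosFrame_frame p

theorem lamR_tau (hp : S.proj p = basePoint n)
    (hτ : ∀ h : isotropy n, S.gact h p = S.act p (τ h)) (k : isoCover n) :
    lamR _ _ (τ (isoProj n k)) =
      spinRot _ (isoLift (isPosFrame_of_proj hp).isIsoFrame k) := by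
  have h1 := comp_spinRot_isoLift (isPosFrame_of_proj hp) k
  rw [← S.frame_gact, hτ, S.frame_act] at h1
  exact LinearMap.ext fun v => (isPosFrame_of_proj hp).injective (LinearMap.congr_fun h1.symm v)

theorem one_ne_neg_one_cl (N : ℕ) : (1 : Cl N) ≠ -1 := fun h => one_ne_zero (eq_zero_of_eq_neg_self h)

/-- Equivariance of the frame map determines the Spin(4n+3)-component up to sign. The relation by
(-1, -1) moves this sign into the second component, which is then unique because 1 ≠ -1, and
therefore multiplicative. -/
theorem exists_nu [NeZero r] (hp : S.proj p = basePoint n)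
    (hτ : ∀ h : isotropy n, S.gact h p = S.act p (τ h)) :
    ∃ ν : isoCover n →* Spin r, ∀ k, τ (isoProj n k) =
      spinRMk _ _ (isoLift (isPosFrame_of_proj hp).isIsoFrame k, ν k) := by
  have h1 : ∀ k, ∃ y : Spin r, τ (isoProj n k) =
      spinRMk _ _ (isoLift (isPosFrame_of_proj hp).isIsoFrame k, y) := by
    intro k
    obtain ⟨⟨x, y⟩, hxy⟩ := spinRMk_surjective _ _ (τ (isoProj n k))
    have h2 := lamR_tau hp hτ k
    rw [← hxy, lamR_spinRMk] at h2
    rcases spin_eq_or_eq_neg h2 with h3 | h3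
    · exact ⟨y, by rw [← hxy]; exact congrArg (fun x => spinRMk _ _ (x, y)) (Subtype.ext h3)⟩
    · refine ⟨spinNegOne r * y, ?_⟩
      rw [← hxy]
      have h4 : (x, y) = (spinNegOne _, spinNegOne r) *
          (isoLift (isPosFrame_of_proj hp).isIsoFrame k, spinNegOne r * y) := by
        refine Prod.ext (Subtype.ext ?_) (Subtype.ext ?_)
        · rw [h3]; simp [spinNegOne]
        · simp [spinNegOne]
      rw [h4, map_mul, (spinRMk_eq_one_iff _ _ _).mpr (Or.inr ⟨rfl, rfl⟩), one_mul]
  have huniq : ∀ (x : Spin (4 * n + 3)) (y y' : Spin r),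
      spinRMk _ _ (x, y) = spinRMk _ _ (x, y') → y = y' := by
    intro x y y' h
    have h2 : spinRMk (4 * n + 3) r (1, y⁻¹ * y') = 1 := by
      have h3 : ((1, y⁻¹ * y') : Spin (4 * n + 3) × Spin r) = (x, y)⁻¹ * (x, y') := by simp
      rw [h3, map_mul, map_inv, h, inv_mul_cancel]
    rcases (spinRMk_eq_one_iff _ _ _).mp h2 with ⟨-, h3⟩ | ⟨h3, -⟩
    · exact inv_mul_eq_one.mp (Subtype.ext h3)
    · exact absurd h3 (one_ne_neg_one_cl _)
  choose ν hν using h1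
  refine ⟨⟨⟨ν, huniq 1 _ _ ?_⟩, fun k l =>
    huniq (isoLift (isPosFrame_of_proj hp).isIsoFrame (k * l)) _ _ ?_⟩, hν⟩
  · have h2 := hν 1
    rw [map_one, map_one, map_one] at h2
    rw [← h2]
    exact (map_one (spinRMk _ _)).symm
  · rw [← hν, map_mul, map_mul, hν, hν, map_mul (isoLift _)]
    exact (map_mul (spinRMk _ _) _ _).symm

/-- The element (-1, -1) is trivial in the isotropy group, so both components have the same sign,
and that of the first is known from `isoLift_isoNegOne`. -/
theorem nu_isoNegOne {ν : isoCover n →* Spin r} (hp : S.proj p = basePoint n)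
    (hν : ∀ k, τ (isoProj n k) =
      spinRMk _ _ (isoLift (isPosFrame_of_proj hp).isIsoFrame k, ν k)) :
    (ν (isoNegOne n) : Cl r) = (-1) ^ (n + 1) := by
  have h1 : isoProj n (isoNegOne n) = 1 :=
    Subtype.ext ((QuotientGroup.eq_one_iff ((-1 : Sp (n + 1)), (-1 : Circle))).mpr (Or.inr ⟨rfl, rfl⟩))
  have h2 := hν (isoNegOne n)
  rw [h1, map_one, eq_comm, spinRMk_eq_one_iff, coe_isoLift_isoNegOne (isPosFrame_of_proj hp)] at h2
  rcases Nat.even_or_odd (n + 1) with h | h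
  · rw [h.neg_one_pow] at h2 ⊢
    rcases h2 with ⟨-, h2⟩ | ⟨h2, -⟩
    · exact h2
    · exact absurd h2 (one_ne_neg_one_cl _)
  · rw [h.neg_one_pow] at h2 ⊢
    rcases h2 with ⟨h2, -⟩ | ⟨-, h2⟩
    · exact absurd h2.symm (one_ne_neg_one_cl _)
    · exact h2

/-- The group Spin(1) is {±1}, so ν is trivial by `isoCover_hom_trivial`, whereas its value at (-1,
-1) is (-1)^(n+1). -/
theorem odd_of_spin (S : InvariantSpinStructure n 1) : Odd n := by
  obtain ⟨p, hp⟩ := S.exists_proj_eq (basePoint n)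
  obtain ⟨τ, hτ⟩ := S.exists_tau hp
  obtain ⟨ν, hν⟩ := exists_nu hp hτ
  let _ : CommGroup (Spin 1) :=
    { (inferInstance : Group (Spin 1)) with
      mul_comm := fun x y => Subtype.ext (by
        rcases spin_one_eq x with hx | hx <;> simp [hx]) }
  have h1 : ν (isoNegOne n) = 1 := isoCover_hom_trivial ν (fun k => Subtype.ext (by
    rcases spin_one_eq (ν k) with hx | hx <;> simp [hx])) _
  have h2 := nu_isoNegOne hp hν
  rw [h1] at h2
  by_contra h
  rw [Nat.not_odd_iff_even] at h
  rw [h.add_one.neg_one_pow] at h2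
  exact one_ne_neg_one_cl _ h2

/-- Two points over the base point differ by some m in Spin², which conjugates τ by m, and
`xiR_two_commute` applies. -/
theorem CorrespondsTo.unique {S : InvariantSpinStructure n 2} {φ ψ : isotropy n →* Circle}
    (hφ : S.CorrespondsTo φ) (hψ : S.CorrespondsTo ψ) : φ = ψ := by
  obtain ⟨p, hp, τ, hτ, hτφ⟩ := hφ
  obtain ⟨q, hq, σ, hσ, hσψ⟩ := hψ
  obtain ⟨m, rfl⟩ := S.exists_act_eq (hp.trans hq.symm)
  refine MonoidHom.ext fun h => rotation_injective ?_
  have h1 : τ h * m = m * σ h := by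
    apply S.act_injective (p := p)
    rw [S.act_mul, S.act_mul, ← hσ, S.gact_act, hτ]
  rw [← hτφ, ← hσψ]
  have h2 : σ h = m⁻¹ * (τ h * m) := by rw [h1, inv_mul_cancel_left]
  rw [h2, xiR_two_commute, mul_assoc, mul_inv_cancel, mul_one]

/-- The complex number by which `x` acts on the vacuum component of the Fock space. -/
def vacuumValue {u : (Fin (4 * n + 3) → ℝ) →ₗ[ℝ] (Fin (n + 1) → ℍ[ℝ])} (hu : IsIsoFrame u) :
    Cl (4 * n + 3) →ₗ[ℝ] ℂ where
  toFun x := ExteriorAlgebra.algebraMapInv (fockRep hu x 1)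
  map_add' x y := by rw [map_add, LinearMap.add_apply, map_add]
  map_smul' c x := by
    rw [map_smul, LinearMap.smul_apply]
    exact map_smul (ExteriorAlgebra.algebraMapInv (R := ℂ) (M := FockBase (n + 1))) (c : ℂ) _

theorem vacuumValue_isoLift {u : (Fin (4 * n + 3) → ℝ) →ₗ[ℝ] (Fin (n + 1) → ℍ[ℝ])}
    (hu : IsIsoFrame u) (k : isoCover n) :
    vacuumValue hu (isoLift hu k) = (k.1.2 : ℂ) ^ (n + 1) := by
  change ExteriorAlgebra.algebraMapInv (fockRep hu (isoLift hu k) 1) = _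
  rw [(isLift_isoLift hu k).2, map_smul, map_one, smul_eq_mul, mul_one]

/-- The inverse of `spinTwo`, as a linear map on `Cl 2`. -/
def spinTwoValue : Cl 2 →ₗ[ℝ] ℂ where
  toFun y := ⟨(clTwoQuat y).re, (clTwoQuat y).imK⟩
  map_add' x y := by rw [map_add]; rfl
  map_smul' c x := by
    rw [map_smul]
    apply Complex.ext <;> simp

theorem spinTwoValue_spinTwo (w : Circle) : spinTwoValue (spinTwo w) = w := by
  change (⟨(clTwoQuat (spinTwo w)).re, (clTwoQuat (spinTwo w)).imK⟩ : ℂ) = w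
  rw [clTwoQuat_spinTwo]
  apply Complex.ext <;> simp

theorem contDiff_spuSphEmb_diagHom (n : ℕ) : ContDiff ℝ ∞ fun t : ℝ =>
    spuSphEmb n ((diagHom n (Circle.exp t)).1, basePoint n) := by
  have h1 : ContDiff ℝ ∞ fun t : ℝ => ((Circle.exp t : Circle) : ℂ) := by
    simp only [Circle.coe_exp]
    exact (Complex.ofRealCLM.contDiff.mul contDiff_const).cexp
  have h2 : ContDiff ℝ ∞ fun t : ℝ => (((Circle.exp t : Circle) : ℂ) : ℍ[ℝ]) :=
    (LinearMap.toContinuousLinearMap Quaternion.ofComplex.toLinearMap).contDiff.comp h1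
  refine ContDiff.prodMk (contDiff_pi.mpr fun i => contDiff_pi.mpr fun j => ?_)
    (h1.prodMk contDiff_const)
  exact contDiff_const.add (contDiff_const.mul ((h2.sub contDiff_const).mul contDiff_const))

/-- The second component ν factors through a character χ of z. The smooth action gives smoothness
only of the class [`isoLift`, ν] in the tensor product; a linear functional turns that class into
the number z^(n+1) χ(z). So this product is a power of z, and then so is χ. Its exponent has the
parity of n+1 by `nu_isoNegOne`. -/
theorem exists_eq_zpow (S : InvariantSpinStructure n 2) :
    ∃ k : ℤ, (-1 : ℂ) ^ k = (-1) ^ (n + 1) ∧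
      S.CorrespondsTo (phi n (2 * k) (even_two_mul k)) := by
  obtain ⟨i, hi⟩ := S.exists_mem_dom (basePoint n)
  have hp := S.proj_sec i _ hi
  -- Taking p to be the value of a local section makes the coordinate expression of the action along
  -- the isotropy group equal to τ itself.
  set p := S.sec i (basePoint n) with hpdef
  obtain ⟨τ, hτ⟩ := S.exists_tau hp
  obtain ⟨ν, hν⟩ := exists_nu hp hτ
  let χ' : isoCover n →* Circle := spinTwoEquiv.symm.toMonoidHom.comp ν
  let χ : Circle →* Circle := χ'.comp (diagHom n)
  have hχ : ∀ k, ν k = spinTwo (χ k.1.2) := by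
    intro k
    have h1 : χ' k = χ k.1.2 := isoCover_hom_eq χ' k
    rw [← h1]
    exact (spinTwoEquiv.apply_symm_apply (ν k)).symm
  have hu := (isPosFrame_of_proj hp).isIsoFrame
  obtain ⟨c, hc, hcs⟩ := S.smooth_gact i i
  let γ : ℝ → isoCover n := fun t => diagHom n (Circle.exp t)
  let B : Cl (4 * n + 3) ⊗[ℝ] Cl 2 →ₗ[ℝ] ℂ :=
    -- The product of the vacuum value and the Spin(2)-coordinate is unchanged under (μ, ν) ↦ (-μ,
    -- -ν), so it is readable from the tensor μ ⊗ ν.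
    LinearMap.mul' ℝ ℂ ∘ₗ TensorProduct.map (vacuumValue hu) spinTwoValue
  have hbase : ∀ t, SpU.mk (γ t).1.1 (γ t).1.2 • basePoint n = basePoint n := fun t => (γ t).2
  have hct : ∀ t, c ((γ t).1, basePoint n) = τ (isoProj n (γ t)) := by
    intro t
    have h1 := hc (γ t).1.1 (γ t).1.2 (basePoint n) hi (by rw [hbase]; exact hi)
    rw [hbase] at h1
    exact S.act_injective (p := p) (h1.symm.trans (hτ (isoProj n (γ t))))
  have hB : ∀ t, B (spinREmb (4 * n + 3) 2 (c ((γ t).1, basePoint n))) =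
      (Circle.exp t : ℂ) ^ (n + 1) * (χ (Circle.exp t) : ℂ) := by
    intro t
    rw [hct, hν, hχ, spinREmb_spinRMk]
    change vacuumValue hu _ * spinTwoValue _ = _
    rw [vacuumValue_isoLift, spinTwoValue_spinTwo]
    rfl
  have hmem : ∀ t, ((γ t).1, basePoint n) ∈
      {t : (Sp (n + 1) × Circle) × Sph n | t.2 ∈ S.dom i ∧ SpU.mk t.1.1 t.1.2 • t.2 ∈ S.dom i} :=
    fun t => ⟨hi, by
      change SpU.mk (γ t).1.1 (γ t).1.2 • basePoint n ∈ S.dom i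
      rw [hbase]
      exact hi⟩
  have hd : DifferentiableAt ℝ
      (fun t : ℝ => (((powMonoidHom (n + 1) : Circle →* Circle) * χ) (Circle.exp t) : ℂ)) 0 := by
    have h1 : ∀ ℓ : ℂ →ₗ[ℝ] ℝ, DifferentiableAt ℝ (fun t : ℝ =>
        ℓ (((powMonoidHom (n + 1) : Circle →* Circle) * χ) (Circle.exp t) : ℂ)) 0 := by
      intro ℓ
      obtain ⟨O, F, hO, hO0, hF, hFc⟩ := hcs (ℓ ∘ₗ B) _ (hmem 0)
      have hγ := contDiff_spuSphEmb_diagHom n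
      have h2 : ContDiffAt ℝ ∞ (fun t : ℝ => F (spuSphEmb n ((γ t).1, basePoint n))) 0 :=
        ContDiffAt.comp (0 : ℝ) (hF.contDiffAt (hO.mem_nhds hO0)) hγ.contDiffAt
      refine (h2.differentiableAt (by simp)).congr_of_eventuallyEq ?_
      filter_upwards [(hO.preimage hγ.continuous).mem_nhds hO0] with t ht
      rw [hFc _ (hmem t) ht, LinearMap.comp_apply, hB]
      rfl
    have h3 := ((Complex.ofRealCLM.differentiableAt).comp (0 : ℝ) (h1 Complex.reLm)).add
      (((Complex.ofRealCLM.differentiableAt).comp (0 : ℝ) (h1 Complex.imLm)).mul_const Complex.I)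
    refine h3.congr_of_eventuallyEq (Filter.Eventually.of_forall fun t => ?_)
    exact (Complex.re_add_im _).symm
  obtain ⟨m, hm⟩ := circle_hom_eq_zpow _ hd
  have hχz : ∀ z, χ z = z ^ (m - (n + 1 : ℕ)) := by
    intro z
    rw [_root_.zpow_sub, ← hm, zpow_natCast, eq_mul_inv_iff_mul_eq, mul_comm]
    rfl
  refine ⟨m - (n + 1 : ℕ), ?_, p, hp, τ, hτ, fun h => ?_⟩
  · have h1 := nu_isoNegOne hp hν
    rw [hχ] at h1
    have h2 := congrArg spinTwoValue h1
    rw [spinTwoValue_spinTwo, hχz] at h2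
    change (((-1 : Circle) ^ _ : Circle) : ℂ) = _ at h2
    rw [Circle.coe_zpow] at h2
    refine Eq.trans h2 ?_
    rcases Nat.even_or_odd (n + 1) with h | h
    · rw [h.neg_one_pow, h.neg_one_pow]
      have := spinTwoValue_spinTwo 1
      simpa using this
    · rw [h.neg_one_pow, h.neg_one_pow, map_neg]
      have := spinTwoValue_spinTwo 1
      simpa using this
  · obtain ⟨k, rfl⟩ := isoProj_surjective n h
    rw [hν, xiR_spinRMk, phi_isoProj]
    change spinRot 2 (ν k) = _
    rw [hχ, spinRot_spinTwo, hχz, mul_comm 2 (m - _), _root_.zpow_mul]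
    rfl

end InvariantSpinStructure

end Necessity

/-! ### Equivalence of invariant structures and conclusion. -/

section Equivalence

open Matrix

namespace InvariantSpinStructure

variable {n r : ℕ}

theorem CorrespondsTo.of_equivalent {S T : InvariantSpinStructure n 2} {φ : isotropy n →* Circle}
    (hφ : S.CorrespondsTo φ) (h : S.Equivalent T) : T.CorrespondsTo φ := by
  obtain ⟨f, hproj, hact, hgact, -, -⟩ := h
  obtain ⟨p, hp, τ, hτ, hτφ⟩ := hφ
  refine ⟨f p, (hproj p).trans hp, τ, fun h => ?_, hτφ⟩
  rw [← hgact, hτ, hact]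

/-- Two invariant structures with points over the base point that have the same frame and the same
isotropy homomorphism are equivalent. -/
theorem exists_map {S T : InvariantSpinStructure n r} {p : S.P} {q : T.P}
    (hp : S.proj p = basePoint n)
    {τ : isotropy n →* SpinR (4 * n + 3) r} (hS : ∀ h : isotropy n, S.gact h p = S.act p (τ h))
    (hT : ∀ h : isotropy n, T.gact h q = T.act q (τ h)) :
    ∃ f : S.P → T.P, ∀ g k, f (S.act (S.gact g p) k) = T.act (T.gact g q) k := by
  have hsurj : ∀ s : S.P, ∃ gk : SpU (n + 1) × SpinR (4 * n + 3) r,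
      S.act (S.gact gk.1 p) gk.2 = s := by
    intro s
    obtain ⟨A, hA⟩ := exists_smul_basePoint (S.proj s)
    obtain ⟨k, hk⟩ := S.exists_act_eq (p := S.gact (SpU.mk A 1) p) (q := s) (by
      rw [S.proj_gact, hp, hA])
    exact ⟨(SpU.mk A 1, k), hk⟩
  choose c hc using hsurj
  refine ⟨fun s => T.act (T.gact (c s).1 q) (c s).2, fun g k => ?_⟩
  set s := S.act (S.gact g p) k with hs
  have h1 := hc s
  have h2 : (c s).1 • basePoint n = g • basePoint n := by
    have h3 := congrArg S.proj h1
    rwa [S.proj_act, S.proj_gact, hp, hs, S.proj_act, S.proj_gact, hp] at h3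
  -- Two ways of writing s as g p k differ by an isotropy element, which τ absorbs into k
  -- identically on both sides; so the map does not depend on the choice.
  have h4 : g = (c s).1 * (cocElt _ _ h2 : isotropy n) := by
    change g = _ * (_⁻¹ * g)
    rw [mul_inv_cancel_left]
  set h := cocElt _ _ h2
  have h6 : S.act (S.gact (c s).1 p) (τ h * k) = S.act (S.gact g p) k := by
    rw [S.act_mul, ← S.gact_act, ← hS, ← S.gact_mul, ← h4]
  have h5 : (c s).2 = τ h * k := S.act_injective (h1.trans h6.symm)
  dsimp only
  rw [h5, T.act_mul, ← T.gact_act, ← hT, ← T.gact_mul, ← h4]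

/-- Inversion in `Spin^r(N)` is the restriction of a linear map. -/
theorem exists_inv_linear (N r : ℕ) : ∃ L : Cl N ⊗[ℝ] Cl r →ₗ[ℝ] Cl N ⊗[ℝ] Cl r,
    ∀ k : SpinR N r, spinREmb N r k⁻¹ = L (spinREmb N r k) := by
  let st : ∀ m, Cl m →ₗ[ℝ] Cl m := fun m =>
    { toFun := star
      map_add' := star_add
      map_smul' := fun c x => CliffordAlgebra.star_smul c x }
  refine ⟨TensorProduct.map (st N) (st r), fun k => ?_⟩
  obtain ⟨⟨x, y⟩, rfl⟩ := spinRMk_surjective _ _ k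
  rw [← map_inv]
  rfl

/-- The action on a point over the base point is smooth in the section coordinates. -/
theorem exists_smooth_section (S : InvariantSpinStructure n r) {p : S.P}
    (hp : S.proj p = basePoint n) (Λ : SectionAtlas n) (i : S.I) (x₀ : Sph n)
    (hx₀ : x₀ ∈ S.dom i) : ∃ (O : Set (QuatSpace (n + 1)))
      (F : QuatSpace (n + 1) → Cl (4 * n + 3) ⊗[ℝ] Cl r) (c : Sph n → SpinR (4 * n + 3) r),
      IsOpen O ∧ (x₀ : QuatSpace (n + 1)) ∈ O ∧ SmoothVal O F ∧
      (∀ x ∈ S.dom i, S.gact (SpU.mk (Λ.M x₀ x) 1) p = S.act (S.sec i x) (c x)) ∧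
      ∀ x ∈ S.dom i, (x : QuatSpace (n + 1)) ∈ O → F x = spinREmb (4 * n + 3) r (c x) := by
  obtain ⟨i₀, hi₀⟩ := S.exists_mem_dom (basePoint n)
  obtain ⟨a, rfl⟩ := S.exists_act_eq (p := S.sec i₀ (basePoint n)) (q := p) (by
    rw [S.proj_sec _ _ hi₀, hp])
  obtain ⟨c, hc, hcs⟩ := S.smooth_gact i₀ i
  have hmem : ∀ x ∈ S.dom i, ((Λ.M x₀ x, (1 : Circle)), basePoint n) ∈
      {t : (Sp (n + 1) × Circle) × Sph n |
        t.2 ∈ S.dom i₀ ∧ SpU.mk t.1.1 t.1.2 • t.2 ∈ S.dom i} := by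
    intro x hx
    refine ⟨hi₀, ?_⟩
    change SpU.mk (Λ.M x₀ x) 1 • basePoint n ∈ S.dom i
    rw [Λ.smul_base]
    exact hx
  obtain ⟨O, F, hO, hO0, hF, hFc⟩ := hcs.exists_smoothVal (hmem x₀ hx₀)
  let em : QuatSpace (n + 1) → SpuSphSpace n := fun y => (Λ.F x₀ y, 1, (basePoint n : QuatSpace (n + 1)))
  have hem : ContDiffOn ℝ ∞ em (Λ.O x₀) :=
    (Λ.contDiffOn_F x₀).prodMk (contDiffOn_const.prodMk contDiffOn_const)
  have hem' : ∀ x : Sph n, (x : QuatSpace (n + 1)) ∈ Λ.O x₀ →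
      em x = spuSphEmb n ((Λ.M x₀ x, 1), basePoint n) := by
    intro x hx
    refine Prod.ext ?_ rfl
    exact Λ.F_eq x₀ x hx
  refine ⟨Λ.O x₀ ∩ em ⁻¹' O, fun y => F (em y) * spinREmb _ _ a,
    fun x => c ((Λ.M x₀ x, 1), basePoint n) * a,
    hem.continuousOn.isOpen_inter_preimage (Λ.isOpen_O x₀) hO, ⟨Λ.mem_O x₀, ?_⟩,
    (hF.comp (hem.mono Set.inter_subset_left) fun y hy => hy.2).mul (SmoothVal.const _ _),
    fun x hx => ?_, fun x hx hxO => ?_⟩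
  · rw [Set.mem_preimage, hem' _ (Λ.mem_O x₀)]
    exact hO0
  · have h1 := hc (Λ.M x₀ x) 1 (basePoint n) hi₀ (by rw [Λ.smul_base]; exact hx)
    rw [S.gact_act, h1, Λ.smul_base, S.act_mul]
  · dsimp only
    have h2 : spuSphEmb n ((Λ.M x₀ x, 1), basePoint n) ∈ O := hem' x hxO.1 ▸ hxO.2
    rw [hem' x hxO.1, hFc _ (hmem x hx) h2, map_mul]

/-- The equivalence sends g p k to g q k. If a and b are the coordinates of the orbits of p and q
along a smooth section of Sp(n+1), the map is given in bundle charts by b a⁻¹, which is smooth since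
inversion in Spin^r is linear on the tensor algebra. -/
theorem equivalent_of_tau_eq {S T : InvariantSpinStructure n r} {p : S.P} {q : T.P}
    (hp : S.proj p = basePoint n) (hq : T.proj q = basePoint n) (hframe : T.frame q = S.frame p)
    {τ : isotropy n →* SpinR (4 * n + 3) r} (hS : ∀ h : isotropy n, S.gact h p = S.act p (τ h))
    (hT : ∀ h : isotropy n, T.gact h q = T.act q (τ h)) : S.Equivalent T := by
  obtain ⟨f, hf⟩ := exists_map hp hS hT
  obtain ⟨Λ⟩ := nonempty_sectionAtlas n
  have hsurj : ∀ s : S.P, ∃ g k, s = S.act (S.gact g p) k := by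
    intro s
    obtain ⟨A, hA⟩ := exists_smul_basePoint (S.proj s)
    obtain ⟨k, hk⟩ := S.exists_act_eq (p := S.gact (SpU.mk A 1) p) (q := s) (by
      rw [S.proj_gact, hp, hA])
    exact ⟨_, k, hk.symm⟩
  have hproj : ∀ s, T.proj (f s) = S.proj s := by
    intro s
    obtain ⟨g, k, rfl⟩ := hsurj s
    rw [hf, T.proj_act, T.proj_gact, hq, S.proj_act, S.proj_gact, hp]
  have hact : ∀ s l, f (S.act s l) = T.act (f s) l := by
    intro s l
    obtain ⟨g, k, rfl⟩ := hsurj s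
    rw [← S.act_mul, hf, hf, T.act_mul]
  refine ⟨f, hproj, hact, fun g' s => ?_, fun s => ?_, fun i j => ?_⟩
  · obtain ⟨g, k, rfl⟩ := hsurj s
    rw [S.gact_act, ← S.gact_mul, hf, hf, T.gact_act, ← T.gact_mul]
  · obtain ⟨g, k, rfl⟩ := hsurj s
    rw [hf, T.frame_act, T.frame_gact, S.frame_act, S.frame_gact, hframe]
  · have hex : ∀ x, ∃ c, x ∈ S.dom i ∩ T.dom j → f (S.sec i x) = T.act (T.sec j x) c := by
      intro x
      by_cases hx : x ∈ S.dom i ∩ T.dom j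
      · obtain ⟨c, hc⟩ := T.exists_act_eq (p := T.sec j x) (q := f (S.sec i x)) (by
          rw [T.proj_sec _ _ hx.2, hproj, S.proj_sec _ _ hx.1])
        exact ⟨c, fun _ => hc.symm⟩
      · exact ⟨1, fun h => absurd h hx⟩
    choose c hc using hex
    refine ⟨c, hc, smoothOnVia_of_smoothVal fun x₀ hx₀ => ?_⟩
    obtain ⟨O, F, a, hO, hO0, hF, ha, hFa⟩ := S.exists_smooth_section hp Λ i x₀ hx₀.1
    obtain ⟨O', F', b, hO', hO0', hF', hb, hFb⟩ := T.exists_smooth_section hq Λ j x₀ hx₀.2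
    obtain ⟨L, hL⟩ := exists_inv_linear (4 * n + 3) r
    refine ⟨O ∩ O', fun y => F' y * L (F y), hO.inter hO', ⟨hO0, hO0'⟩,
      (hF'.mono Set.inter_subset_right).mul ((hF.mono Set.inter_subset_left).map L),
      fun x hx hxO => ?_⟩
    have h1 : c x = b x * (a x)⁻¹ := by
      apply T.act_injective (p := T.sec j x)
      rw [← hc x hx, T.act_mul, ← hb x hx.2, ← hf, ha x hx.1, ← S.act_mul, mul_inv_cancel,
        S.act_one]
    dsimp only
    rw [hFa x hx.1 hxO.1, hFb x hx.2 hxO.2, ← hL, ← map_mul, h1]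

/-- Invariant spin^ℂ structures corresponding to the same homomorphism are equivalent. -/
theorem CorrespondsTo.equivalent {S T : InvariantSpinStructure n 2} {φ : isotropy n →* Circle}
    (hSφ : S.CorrespondsTo φ) (hTφ : T.CorrespondsTo φ) : S.Equivalent T := by
  obtain ⟨p, hp, τ, hτ, hτφ⟩ := hSφ
  obtain ⟨q, hq, σ, hσ, hσφ⟩ := hTφ
  -- The point q is moved within its fibre until its frame equals that of p. Then both isotropy
  -- homomorphisms have the same Spin(4n+3)-component.
  obtain ⟨μ, hμ⟩ := (isPosFrame_of_proj hq).exists_spinRot (isPosFrame_of_proj hp)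
  set m := spinRMk (4 * n + 3) 2 (μ, 1) with hm
  have hframe : T.frame (T.act q m) = S.frame p := by
    rw [T.frame_act, hμ]
    rfl
  have hq' : T.proj (T.act q m) = basePoint n := by rw [T.proj_act, hq]
  obtain ⟨τ', hτ'⟩ := T.exists_tau hq'
  have hτ'φ : ∀ h, xiR (4 * n + 3) 2 (τ' h) = rotation (φ h) := by
    intro h
    have h1 : σ h * m = m * τ' h := by
      apply T.act_injective (p := q)
      rw [T.act_mul, T.act_mul, ← hτ', T.gact_act, hσ]
    have h2 : τ' h = m⁻¹ * (σ h * m) := by rw [h1, inv_mul_cancel_left]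
    rw [← hσφ, h2, xiR_two_commute, mul_assoc, mul_inv_cancel, mul_one]
  obtain ⟨ν, hν⟩ := exists_nu hp hτ
  obtain ⟨ν', hν'⟩ := exists_nu hq' hτ'
  let χ : isoCover n →* Circle := spinTwoEquiv.symm.toMonoidHom.comp ν
  let χ' : isoCover n →* Circle := spinTwoEquiv.symm.toMonoidHom.comp ν'
  have hχ : ∀ k, ν k = spinTwo (χ k) := fun k => (spinTwoEquiv.apply_symm_apply (ν k)).symm
  have hχ' : ∀ k, ν' k = spinTwo (χ' k) := fun k => (spinTwoEquiv.apply_symm_apply (ν' k)).symm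
  have hsq : ∀ k, χ k ^ 2 = χ' k ^ 2 := by
    intro k
    apply rotation_injective
    rw [← spinRot_spinTwo, ← spinRot_spinTwo, ← hχ, ← hχ']
    have h1 := hτφ (isoProj n k)
    have h2 := hτ'φ (isoProj n k)
    rw [hν, xiR_spinRMk] at h1
    rw [hν', xiR_spinRMk] at h2
    exact h1.trans h2.symm
  -- Equality of φ fixes only the squares of the characters; their quotient has exponent two, so it
  -- is trivial by `isoCover_hom_trivial`.
  have hνν' : ∀ k, ν k = ν' k := by
    intro k
    have h1 := isoCover_hom_trivial (χ / χ') (fun k => by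
      rw [MonoidHom.div_apply, div_pow, hsq, div_self']) k
    rw [hχ, hχ', div_eq_one.mp h1]
  have hττ' : τ = τ' := by
    refine MonoidHom.ext fun h => ?_
    obtain ⟨k, rfl⟩ := isoProj_surjective n h
    rw [hν, hν', hνν']
    have h1 : ∀ {u u' : (Fin (4 * n + 3) → ℝ) →ₗ[ℝ] (Fin (n + 1) → ℍ[ℝ])} (hu : IsIsoFrame u)
        (hu' : IsIsoFrame u'), u = u' → isoLift hu k = isoLift hu' k := by
      rintro u u' hu hu' rfl
      rfl
    rw [h1 _ _ (congrArg frameCoord hframe.symm)]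
  subst hττ'
  exact equivalent_of_tau_eq hp hq' hframe hτ hτ'

end InvariantSpinStructure

theorem neg_one_zpow_eq_iff {k : ℤ} : (-1 : ℂ) ^ k = -1 ↔ Odd k := by
  constructor
  · intro h
    by_contra hk
    rw [Int.not_odd_iff_even] at hk
    rw [hk.neg_one_zpow] at h
    norm_num at h
  · exact fun h => h.neg_one_zpow

theorem invariantSpinType_of_odd {n : ℕ} (h : Odd n) : invariantSpinType n = 1 :=
  le_antisymm (Nat.sInf_le ⟨le_rfl, nonempty_of_odd h⟩)
    (le_csInf ⟨1, le_rfl, nonempty_of_odd h⟩ fun _ hr => hr.1)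

theorem invariantSpinType_of_even {n : ℕ} (h : Even n) : invariantSpinType n = 2 := by
  obtain ⟨S, -⟩ := exists_correspondsTo_phi (n := n) (k := 1) (by
    rw [h.add_one.neg_one_pow, zpow_one])
  refine le_antisymm (Nat.sInf_le ⟨one_le_two, ⟨S⟩⟩) (le_csInf ⟨2, one_le_two, ⟨S⟩⟩ ?_)
  rintro r ⟨hr, ⟨T⟩⟩
  by_contra hlt
  obtain rfl : r = 1 := by omega
  exact Nat.not_odd_iff_even.mpr h T.odd_of_spin

theorem neg_one_pow_two_mul_add_one (n : ℕ) : (-1 : ℂ) ^ (2 * n + 1) = -1 :=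
  Odd.neg_one_pow ⟨n, rfl⟩

theorem exists_correspondsTo_iff (n : ℕ) (φ : isotropy (2 * n) →* Circle) :
    (∃ S : InvariantSpinStructure (2 * n) 2, S.CorrespondsTo φ) ↔
      ∃ (s : ℤ) (hs : Even s), s ≡ 2 [ZMOD 4] ∧ φ = phi (2 * n) s hs := by
  constructor
  · rintro ⟨S, hS⟩
    obtain ⟨k, hk, hSk⟩ := S.exists_eq_zpow
    rw [neg_one_pow_two_mul_add_one, neg_one_zpow_eq_iff] at hk
    refine ⟨2 * k, even_two_mul k, ?_, hS.unique hSk⟩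
    obtain ⟨l, rfl⟩ := hk
    rw [Int.ModEq]
    omega
  · rintro ⟨s, hs, hs4, rfl⟩
    obtain ⟨k, rfl⟩ : ∃ k, s = 2 * k := hs.two_dvd
    refine exists_correspondsTo_phi ?_
    rw [neg_one_pow_two_mul_add_one, neg_one_zpow_eq_iff, Int.odd_iff]
    rw [Int.ModEq] at hs4
    omega

end Equivalence

end SpinSphere

end

open SpinSphere
theorem mainTheorem5 :
    (∀ n : ℕ, invariantSpinType (2 * n) = 2) ∧
    (∀ n : ℕ, (Odd n → invariantSpinType n = 1) ∧ (Even n → invariantSpinType n = 2)) ∧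
    ∀ n : ℕ,
      (∀ S : InvariantSpinStructure (2 * n) 2, ∃! φ, S.CorrespondsTo φ) ∧
      (∀ φ : isotropy (2 * n) →* Circle,
        (∃ S : InvariantSpinStructure (2 * n) 2, S.CorrespondsTo φ) ↔
          ∃ (s : ℤ) (hs : Even s), s ≡ 2 [ZMOD 4] ∧ φ = phi (2 * n) s hs) ∧
      (∀ (S T : InvariantSpinStructure (2 * n) 2) (φ ψ : isotropy (2 * n) →* Circle),
        S.CorrespondsTo φ → T.CorrespondsTo ψ → (S.Equivalent T ↔ φ = ψ)) ∧
      (∀ (s t : ℤ) (hs : Even s) (ht : Even t),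
        phi (2 * n) s hs = phi (2 * n) t ht → s = t) := by
  refine ⟨fun n => invariantSpinType_of_even (even_two_mul n),
    fun n => ⟨invariantSpinType_of_odd, invariantSpinType_of_even⟩, fun n => ⟨fun S => ?_,
      exists_correspondsTo_iff n, fun S T φ ψ hS hT => ⟨fun h => ?_, fun h => ?_⟩,
      fun s t hs ht => phi_injective⟩⟩
  · obtain ⟨k, -, hk⟩ := S.exists_eq_zpow
    exact ⟨_, hk, fun ψ hψ => hψ.unique hk⟩
  · exact (hS.of_equivalent h).unique hT
  · subst h
    exact hS.equivalent hT
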